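/- Identify a permutation $\sigma$ of size $N$ with its diagram $\{(i,\sigma(i))\}_{i=1}^N$. A point of $\sigma$ is *external* if it is a record (a left-to-right maximum, left-to-right minimum, right-to-left maximum or right-to-left minimum) and *internal* otherwise. Let $ASq(n,k)$ be the set of permutations of size $n+k$ with exactly $n$ external points and exactly $k$ internal points. A *permuton* is a Borel probability measure $\mu$ on $[0,1]^2$ with uniform marginals, i.e. $\mu([0,1]\times[a,b])=\mu([a,b]\times[0,1])=b-a$ for all $0\le a\le b\le 1$; the set of permutons carries the topology of weak convergence. The permuton associated with a permutation $\sigma$ of size $N\ge 1$ is $$\mu_\sigma(S) = N\sum_{i=1}^N \mathrm{Leb}\Big(S\cap\big[\tfrac{i-1}{N},\tfrac iN\big]\times\big[\tfrac{\sigma(i)-1}{N},\tfrac{\sigma(i)}N\big]\Big).$$ For $z\in[0,1]$ let $L_1,L_2,L_3,L_4$ be the segments joining $(0,z)$ to $(z,0)$, $(0,z)$ to $(1-z,1)$, $(z,0)$ to $(1,1-z)$, and $(1-z,1)$ to $(1,1-z)$, respectively, and let $\mu^z$ be the permuton $$\mu^z(S)=\tfrac12\sum_{i=1}^4\nu\big(\pi_x(S\cap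 L_i)\big),$$ where $\nu$ is Lebesgue measure on $[0,1]$ and $\pi_x$ is the projection onto the $x$-axis. **Theorem 1.4.** Let $n=n_m\ge 1$ and $k=k_m$ be sequences of integers with $n_m\to\infty$, $k_m\to\infty$ and $k_m=o(n_m)$ as $m\to\infty$. If, for every $m$, $\boldsymbol\sigma_m$ is a uniform random permutation in $ASq(n_m,k_m)$, then the random permuton $\mu_{\boldsymbol\sigma_m}$ converges in distribution to the deterministic permuton $\mu^{1/2}$ as $m\to\infty$. -/

import Mathlib

open MeasureTheory ProbabilityTheory Filter Topology Set
open scoped ENNReal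

noncomputable section

namespace AlmostSquare

/-! ### Records, internal points and almost square permutations

A permutation of size `N` is an element of `Equiv.Perm (Fin N)`: positions and values are numbered
from `0` to `N - 1` instead of from `1` to `N`. -/

/-- The point `(i, σ i)` is a record: a left-to-right maximum, a left-to-right minimum, a
right-to-left maximum or a right-to-left minimum. -/
def IsExternal {N : ℕ} (σ : Equiv.Perm (Fin N)) (i : Fin N) : Prop :=
  (∀ j, j < i → σ j < σ i) ∨ (∀ j, j < i → σ i < σ j) ∨
    (∀ j, i < j → σ j < σ i) ∨ (∀ j, i < j → σ i < σ j)

/-- The point `(i, σ i)` is internal: it is not a record. -/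
def IsInternal {N : ℕ} (σ : Equiv.Perm (Fin N)) (i : Fin N) : Prop :=
  ¬ IsExternal σ i

/-- `ASq(n, k)`: the permutations of size `n + k` that have exactly `n` external points and `k`
internal points. -/
def ASq (n k : ℕ) : Set (Equiv.Perm (Fin (n + k))) :=
  {σ | {i | IsExternal σ i}.ncard = n ∧ {i | IsInternal σ i}.ncard = k}

/-- Every set of permutations of size `N` is measurable. -/
instance instMeasurableSpacePerm (N : ℕ) : MeasurableSpace (Equiv.Perm (Fin N)) := ⊤

instance instDiscreteMeasurableSpacePerm (N : ℕ) :
    DiscreteMeasurableSpace (Equiv.Perm (Fin N)) := ⟨fun _ => trivial⟩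

/-! ### Permutons -/

/-- The unit square `[0, 1]²`. -/
abbrev Square : Type := unitInterval × unitInterval

/-- A Borel measure on the unit square has uniform marginals. -/
def HasUniformMarginals (μ : Measure Square) : Prop :=
  ∀ a b : unitInterval, a ≤ b →
    μ (univ ×ˢ Icc a b) = ENNReal.ofReal ((b : ℝ) - a) ∧
      μ (Icc a b ×ˢ univ) = ENNReal.ofReal ((b : ℝ) - a)

lemma HasUniformMarginals.isProbabilityMeasure {μ : Measure Square}
    (h : HasUniformMarginals μ) : IsProbabilityMeasure μ := by
  constructor
  have h1 := (h 0 1 zero_le_one).1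
  have h2 : (Icc (0 : unitInterval) 1) = univ := by
    ext x; simp [unitInterval.le_one']
  rw [h2, univ_prod_univ] at h1
  simpa using h1

/-- A permuton: a Borel probability measure on the unit square with uniform marginals. -/
def Permuton : Type :=
  {μ : ProbabilityMeasure Square // HasUniformMarginals (μ : Measure Square)}

namespace Permuton

/-- The topology of weak convergence of measures. -/
instance : TopologicalSpace Permuton :=
  inferInstanceAs (TopologicalSpace
    {μ : ProbabilityMeasure Square // HasUniformMarginals (μ : Measure Square)})

instance : MeasurableSpace Permuton := borel Permuton

instance : BorelSpace Permuton := ⟨rfl⟩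

end Permuton

/-- The Lebesgue measure of a subinterval of `ℝ`, intersected with `[0, 1]`. -/
lemma volume_between (c d : ℝ) :
    volume {x : unitInterval | c ≤ x ∧ (x : ℝ) ≤ d} = ENNReal.ofReal (min d 1 - max c 0) := by
  rw [unitInterval.volume_apply]
  have : (Subtype.val '' {x : unitInterval | c ≤ x ∧ (x : ℝ) ≤ d}) = Icc (max c 0) (min d 1) := by
    ext x
    constructor
    · rintro ⟨y, ⟨h1, h2⟩, rfl⟩
      exact ⟨max_le h1 y.2.1, le_min h2 y.2.2⟩
    · rintro ⟨h1, h2⟩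
      exact ⟨⟨x, (le_max_right _ _).trans h1, h2.trans (min_le_right _ _)⟩,
        ⟨(le_max_left _ _).trans h1, h2.trans (min_le_left _ _)⟩, rfl⟩
  rw [this, Real.volume_Icc]

/-! ### The permuton of a permutation -/

/-- For `i = 0, …, N - 1`, the interval `[i/N, (i+1)/N]`. -/
def cell (N : ℕ) (i : Fin N) : Set unitInterval :=
  {x | (i : ℝ) / N ≤ x ∧ (x : ℝ) ≤ ((i : ℝ) + 1) / N}

/-- `N` times the sum over the points `(i, σ i)` of the Lebesgue area measure on the corresponding
square of side `1/N`. -/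
def permMeasure {N : ℕ} (σ : Equiv.Perm (Fin N)) : Measure Square :=
  (N : ℝ≥0∞) • ∑ i : Fin N, (volume : Measure Square).restrict (cell N i ×ˢ cell N (σ i))

lemma volume_cell {N : ℕ} (i : Fin N) : volume (cell N i) = (N : ℝ≥0∞)⁻¹ := by
  have hN : 0 < N := i.pos
  have hN' : (0 : ℝ) < N := by exact_mod_cast hN
  rw [cell, volume_between, max_eq_left (by positivity), min_eq_left, ← sub_div,
    add_sub_cancel_left, one_div, ENNReal.ofReal_inv_of_pos hN', ENNReal.ofReal_natCast]
  rw [div_le_one hN']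
  exact_mod_cast i.2

lemma measurableSet_cell {N : ℕ} (i : Fin N) : MeasurableSet (cell N i) :=
  (measurableSet_le measurable_const measurable_subtype_coe).inter
    (measurableSet_le measurable_subtype_coe measurable_const)

lemma sum_volume_cell {N : ℕ} (hN : 0 < N) (a b : unitInterval) (hab : a ≤ b) :
    ∑ i : Fin N, volume (Icc a b ∩ cell N i) = ENNReal.ofReal ((b : ℝ) - a) := by
  have hN' : (0 : ℝ) < N := by exact_mod_cast hN
  have hab' : (a : ℝ) ≤ b := hab
  set f : ℕ → ℝ := fun j => max (a : ℝ) (min b ((j : ℝ) / N)) with hf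
  have hmono : ∀ j, f j ≤ f (j + 1) := by
    intro j
    simp only [hf]
    gcongr
    simp
  have key : ∀ i : Fin N, volume (Icc a b ∩ cell N i) = ENNReal.ofReal (f (i + 1) - f i) := by
    intro i
    have : Icc a b ∩ cell N i = {x : unitInterval | max (a : ℝ) ((i : ℝ) / N) ≤ x ∧
        (x : ℝ) ≤ min (b : ℝ) (((i : ℝ) + 1) / N)} := by
      ext x
      simp only [cell, mem_inter_iff, mem_Icc, mem_ofPred_eq, max_le_iff, le_min_iff,
        ← Subtype.coe_le_coe]
      tauto
    rw [this, volume_between]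
    have h0 : (0 : ℝ) ≤ (i : ℝ) / N := by positivity
    have h1 : (i : ℝ) / N ≤ ((i : ℝ) + 1) / N := by gcongr; simp
    have hb := b.2.2
    have ha := a.2.1
    rw [min_eq_left ((min_le_left _ _).trans hb), max_eq_left (h0.trans (le_max_right _ _))]
    simp only [hf, Nat.cast_add, Nat.cast_one]
    rcases le_total ((i : ℝ) / N) b with h | h
    · rw [min_eq_right h]
      rcases le_total (a : ℝ) (min (b : ℝ) (((i : ℝ) + 1) / N)) with h' | h'
      · rw [max_eq_right h']
      · rw [max_eq_left h', max_eq_left ((le_min h h1).trans h'), sub_self, ENNReal.ofReal_zero,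
          ENNReal.ofReal_eq_zero]
        linarith
    · rw [min_eq_left h, min_eq_left (h.trans h1), max_eq_right hab', sub_self,
        ENNReal.ofReal_zero, ENNReal.ofReal_eq_zero]
      linarith [le_max_right (a : ℝ) ((i : ℝ) / N)]
  rw [Finset.sum_congr rfl (fun i _ => key i),
    ← ENNReal.ofReal_sum_of_nonneg (fun i _ => sub_nonneg.2 (hmono _)),
    Fin.sum_univ_eq_sum_range (fun j => f (j + 1) - f j), Finset.sum_range_sub]
  congr 1
  simp only [hf, Nat.cast_zero, zero_div]
  rw [div_self hN'.ne', min_eq_left b.2.2, min_eq_right b.2.1, max_eq_right hab',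
    max_eq_left a.2.1]

lemma permMeasure_prod {N : ℕ} (σ : Equiv.Perm (Fin N)) {A B : Set unitInterval}
    (hA : MeasurableSet A) (hB : MeasurableSet B) :
    permMeasure σ (A ×ˢ B) =
      N * ∑ i, volume (A ∩ cell N i) * volume (B ∩ cell N (σ i)) := by
  simp only [permMeasure, Measure.smul_apply, Measure.coe_finsetSum, Finset.sum_apply,
    smul_eq_mul]
  congr 1
  refine Finset.sum_congr rfl fun i _ => ?_
  rw [Measure.restrict_apply (hA.prod hB), prod_inter_prod, Measure.volume_eq_prod,
    Measure.prod_prod]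

lemma permMeasure_hasUniformMarginals {N : ℕ} (hN : 0 < N) (σ : Equiv.Perm (Fin N)) :
    HasUniformMarginals (permMeasure σ) := by
  intro a b hab
  have h0 : (N : ℝ≥0∞) ≠ 0 := by exact_mod_cast hN.ne'
  have h1 : (N : ℝ≥0∞) ≠ ⊤ := ENNReal.natCast_ne_top N
  constructor
  · rw [permMeasure_prod σ MeasurableSet.univ measurableSet_Icc]
    simp only [univ_inter, volume_cell]
    rw [← Finset.mul_sum, ← mul_assoc, ENNReal.mul_inv_cancel h0 h1, one_mul,
      Equiv.sum_comp σ (fun j => volume (Icc a b ∩ cell N j)), sum_volume_cell hN a b hab]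
  · rw [permMeasure_prod σ measurableSet_Icc MeasurableSet.univ]
    simp only [univ_inter, volume_cell]
    rw [← Finset.sum_mul, mul_comm, mul_assoc, ENNReal.inv_mul_cancel h0 h1, mul_one,
      sum_volume_cell hN a b hab]

/-- The permuton `μ_σ` of a permutation `σ` of positive size. -/
def permPermuton {N : ℕ} (hN : 0 < N) (σ : Equiv.Perm (Fin N)) : Permuton :=
  ⟨⟨permMeasure σ, (permMeasure_hasUniformMarginals hN σ).isProbabilityMeasure⟩,
    permMeasure_hasUniformMarginals hN σ⟩

/-! ### The rectangle permuton -/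

/-- The segment from `(0, z)` to `(z, 0)`. -/
def seg₁ (z : unitInterval) : Set Square := {p | (p.1 : ℝ) + p.2 = z}

/-- The segment from `(0, z)` to `(1 - z, 1)`. -/
def seg₂ (z : unitInterval) : Set Square := {p | (p.2 : ℝ) - p.1 = z}

/-- The segment from `(z, 0)` to `(1, 1 - z)`. -/
def seg₃ (z : unitInterval) : Set Square := {p | (p.1 : ℝ) - p.2 = z}

/-- The segment from `(1 - z, 1)` to `(1, 1 - z)`. -/
def seg₄ (z : unitInterval) : Set Square := {p | (p.1 : ℝ) + p.2 = 2 - z}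

/-- For a segment `L` of slope `1` or `-1`, the measure that assigns to a Borel set `S` half of the
Lebesgue measure of the projection of `S ∩ L` onto the `x`-axis: see `segMeasure_apply`. -/
def segMeasure (L : Set Square) : Measure Square :=
  (1 / 2 : ℝ≥0∞) • ((volume : Measure unitInterval).comap fun p : L => p.1.1).map Subtype.val

lemma segMeasure_apply {L : Set Square} (hL : IsClosed L) (hinj : InjOn Prod.fst L)
    {S : Set Square} (hS : MeasurableSet S) :
    segMeasure L S = 1 / 2 * volume (Prod.fst '' (S ∩ L)) := by
  have : CompactSpace L := isCompact_iff_compactSpace.1 hL.isCompact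
  have hemb : MeasurableEmbedding fun p : L => p.1.1 := by
    refine (Topology.IsClosedEmbedding.measurableEmbedding ?_)
    refine Continuous.isClosedEmbedding (by fun_prop) ?_
    intro p q h
    exact Subtype.ext (hinj p.2 q.2 h)
  rw [segMeasure, Measure.smul_apply, Measure.map_apply measurable_subtype_coe hS,
    hemb.comap_apply, smul_eq_mul]
  congr 2
  ext x
  simp only [mem_image, mem_preimage, Subtype.exists, mem_inter_iff]
  constructor
  · rintro ⟨p, hp, hpS, rfl⟩
    exact ⟨p, ⟨hpS, hp⟩, rfl⟩
  · rintro ⟨p, ⟨hpS, hp⟩, rfl⟩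
    exact ⟨p, hp, hpS, rfl⟩

lemma isClosed_seg (z : unitInterval) :
    IsClosed (seg₁ z) ∧ IsClosed (seg₂ z) ∧ IsClosed (seg₃ z) ∧ IsClosed (seg₄ z) := by
  refine ⟨?_, ?_, ?_, ?_⟩ <;> exact isClosed_eq (by fun_prop) (by fun_prop)

lemma injOn_seg (z : unitInterval) : InjOn Prod.fst (seg₁ z) ∧ InjOn Prod.fst (seg₂ z) ∧
    InjOn Prod.fst (seg₃ z) ∧ InjOn Prod.fst (seg₄ z) := by
  refine ⟨?_, ?_, ?_, ?_⟩ <;>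
  · intro p hp q hq h
    simp only [seg₁, seg₂, seg₃, seg₄, mem_ofPred_eq] at hp hq
    have h' : (p.1 : ℝ) = q.1 := congrArg Subtype.val h
    exact Prod.ext h (Subtype.ext (by linarith))

/-- The measure `μ^z`, the sum of the measures of the four sides of the rectangle with corners
`(z, 0)`, `(0, z)`, `(1 - z, 1)` and `(1, 1 - z)`. -/
def rectMeasure (z : unitInterval) : Measure Square :=
  segMeasure (seg₁ z) + segMeasure (seg₂ z) + segMeasure (seg₃ z) + segMeasure (seg₄ z)

lemma half_sum_ofReal {w₁ w₂ w₃ w₄ t : ℝ}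
    (h : max w₁ 0 + max w₂ 0 + max w₃ 0 + max w₄ 0 = 2 * t) :
    1 / 2 * ENNReal.ofReal w₁ + 1 / 2 * ENNReal.ofReal w₂ + 1 / 2 * ENNReal.ofReal w₃ +
      1 / 2 * ENNReal.ofReal w₄ = ENNReal.ofReal t := by
  have e : ∀ w : ℝ, ENNReal.ofReal w = ENNReal.ofReal (max w 0) := fun w => by
    rcases le_total w 0 with h | h
    · rw [max_eq_right h, ENNReal.ofReal_zero, ENNReal.ofReal_eq_zero.2 h]
    · rw [max_eq_left h]
  rw [← mul_add, ← mul_add, ← mul_add, e w₁, e w₂, e w₃, e w₄,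
    ← ENNReal.ofReal_add (by positivity) (by positivity),
    ← ENNReal.ofReal_add (by positivity) (by positivity),
    ← ENNReal.ofReal_add (by positivity) (by positivity), h,
    ENNReal.ofReal_mul (by norm_num), ENNReal.ofReal_ofNat, ← mul_assoc, one_div,
    ENNReal.inv_mul_cancel (by norm_num) (by norm_num), one_mul]

lemma rectMeasure_hasUniformMarginals (z : unitInterval) : HasUniformMarginals (rectMeasure z) := by
  intro a b hab
  have hab' : (a : ℝ) ≤ b := hab
  obtain ⟨c₁, c₂, c₃, c₄⟩ := isClosed_seg z
  obtain ⟨i₁, i₂, i₃, i₄⟩ := injOn_seg z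
  obtain ⟨hz0, hz1⟩ := z.2
  obtain ⟨ha0, ha1⟩ := a.2
  obtain ⟨hb0, hb1⟩ := b.2
  -- a set of points on a segment, cut out by bounds on the first coordinate
  have im : ∀ (L S : Set Square) (c d : ℝ),
      (∀ p ∈ S ∩ L, c ≤ p.1 ∧ (p.1 : ℝ) ≤ d) →
      (∀ x : unitInterval, c ≤ x → (x : ℝ) ≤ d → ∃ y : ℝ, ∃ hy : y ∈ Icc (0 : ℝ) 1,
        (x, (⟨y, hy⟩ : unitInterval)) ∈ S ∩ L) →
      volume (Prod.fst '' (S ∩ L)) = ENNReal.ofReal (min d 1 - max c 0) := by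
    intro L S c d h1 h2
    rw [← volume_between]
    congr 1
    ext x
    constructor
    · rintro ⟨p, hp, rfl⟩
      exact h1 p hp
    · rintro ⟨hx1, hx2⟩
      obtain ⟨y, hy, h⟩ := h2 x hx1 hx2
      exact ⟨_, h, rfl⟩
  constructor
  · have hS : MeasurableSet ((univ : Set unitInterval) ×ˢ Icc a b) :=
      MeasurableSet.univ.prod measurableSet_Icc
    simp only [rectMeasure, Measure.add_apply]
    rw [segMeasure_apply c₁ i₁ hS, segMeasure_apply c₂ i₂ hS, segMeasure_apply c₃ i₃ hS,
      segMeasure_apply c₄ i₄ hS,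
      im (seg₁ z) _ (z - b) (z - a) ?_ ?_, im (seg₂ z) _ (a - z) (b - z) ?_ ?_,
      im (seg₃ z) _ (a + z) (b + z) ?_ ?_, im (seg₄ z) _ (2 - z - b) (2 - z - a) ?_ ?_]
    · apply half_sum_ofReal
      generalize (z : ℝ) = z at *
      generalize (a : ℝ) = a at *
      generalize (b : ℝ) = b at *
      have e₁ : max (min (z - a) 1 - max (z - b) 0) 0 = min z b - min z a := by
        simp only [max_def, min_def]
        split_ifs <;> linarith
      have e₂ : max (min (b - z) 1 - max (a - z) 0) 0 = max b z - max a z := by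
        simp only [max_def, min_def]
        split_ifs <;> linarith
      have e₃ : max (min (b + z) 1 - max (a + z) 0) 0 = min (b + z) 1 - min (a + z) 1 := by
        simp only [max_def, min_def]
        split_ifs <;> linarith
      have e₄ : max (min (2 - z - a) 1 - max (2 - z - b) 0) 0 =
          max (b + z) 1 - max (a + z) 1 := by
        simp only [max_def, min_def]
        split_ifs <;> linarith
      rw [e₁, e₂, e₃, e₄]
      linarith [min_add_max z b, min_add_max z a, max_comm b z, max_comm a z,
        min_add_max (b + z) 1, min_add_max (a + z) 1]
    all_goals
      first
      | (rintro p ⟨⟨-, h1, h2⟩, hp⟩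
         have h1' : (a : ℝ) ≤ p.2 := h1
         have h2' : (p.2 : ℝ) ≤ b := h2
         simp only [seg₁, seg₂, seg₃, seg₄, mem_ofPred_eq] at hp
         constructor <;> linarith)
      | (intro x hx1 hx2
         first
         | exact ⟨z - x, ⟨by linarith, by linarith⟩, ⟨trivial, by
              constructor <;> rw [← Subtype.coe_le_coe] <;> simp only <;> linarith⟩, by
              simp [seg₁]⟩
         | exact ⟨z + x, ⟨by linarith, by linarith⟩, ⟨trivial, by
              constructor <;> rw [← Subtype.coe_le_coe] <;> simp only <;> linarith⟩, by
              simp [seg₂]⟩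
         | exact ⟨x - z, ⟨by linarith, by linarith⟩, ⟨trivial, by
              constructor <;> rw [← Subtype.coe_le_coe] <;> simp only <;> linarith⟩, by
              simp [seg₃]⟩
         | exact ⟨2 - z - x, ⟨by linarith, by linarith⟩, ⟨trivial, by
              constructor <;> rw [← Subtype.coe_le_coe] <;> simp only <;> linarith⟩, by
              simp [seg₄]⟩)
  · have hS : MeasurableSet (Icc a b ×ˢ (univ : Set unitInterval)) :=
      measurableSet_Icc.prod MeasurableSet.univ
    simp only [rectMeasure, Measure.add_apply]
    rw [segMeasure_apply c₁ i₁ hS, segMeasure_apply c₂ i₂ hS, segMeasure_apply c₃ i₃ hS,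
      segMeasure_apply c₄ i₄ hS,
      im (seg₁ z) _ a (min b z) ?_ ?_, im (seg₂ z) _ a (min b (1 - z)) ?_ ?_,
      im (seg₃ z) _ (max a z) b ?_ ?_, im (seg₄ z) _ (max a (1 - z)) b ?_ ?_]
    · apply half_sum_ofReal
      generalize (z : ℝ) = z at *
      generalize (a : ℝ) = a at *
      generalize (b : ℝ) = b at *
      have e₁ : max (min (min b z) 1 - max a 0) 0 = min b z - min a z := by
        simp only [max_def, min_def]
        split_ifs <;> linarith
      have e₂ : max (min (min b (1 - z)) 1 - max a 0) 0 = min b (1 - z) - min a (1 - z) := by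
        simp only [max_def, min_def]
        split_ifs <;> linarith
      have e₃ : max (min b 1 - max (max a z) 0) 0 = max b z - max a z := by
        simp only [max_def, min_def]
        split_ifs <;> linarith
      have e₄ : max (min b 1 - max (max a (1 - z)) 0) 0 = max b (1 - z) - max a (1 - z) := by
        simp only [max_def, min_def]
        split_ifs <;> linarith
      rw [e₁, e₂, e₃, e₄]
      linarith [min_add_max b z, min_add_max a z, min_add_max b (1 - z), min_add_max a (1 - z)]
    all_goals
      first
      | (rintro p ⟨⟨⟨h1, h2⟩, -⟩, hp⟩
         have h1' : (a : ℝ) ≤ p.1 := h1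
         have h2' : (p.1 : ℝ) ≤ b := h2
         have h3 := p.2.2.1
         have h4 := p.2.2.2
         simp only [seg₁, seg₂, seg₃, seg₄, mem_ofPred_eq] at hp
         constructor <;> (try simp only [max_le_iff, le_min_iff]) <;> (try constructor) <;> linarith)
      | (intro x hx1 hx2
         have hx3 := x.2.1
         have hx4 := x.2.2
         simp only [max_le_iff, le_min_iff] at hx1 hx2
         first
         | exact ⟨z - x, ⟨by linarith, by linarith⟩, ⟨by
              constructor <;> rw [← Subtype.coe_le_coe] <;> simp only <;> linarith, trivial⟩, by
              simp [seg₁]⟩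
         | exact ⟨z + x, ⟨by linarith, by linarith⟩, ⟨by
              constructor <;> rw [← Subtype.coe_le_coe] <;> simp only <;> linarith, trivial⟩, by
              simp [seg₂]⟩
         | exact ⟨x - z, ⟨by linarith, by linarith⟩, ⟨by
              constructor <;> rw [← Subtype.coe_le_coe] <;> simp only <;> linarith, trivial⟩, by
              simp [seg₃]⟩
         | exact ⟨2 - z - x, ⟨by linarith, by linarith⟩, ⟨by
              constructor <;> rw [← Subtype.coe_le_coe] <;> simp only <;> linarith, trivial⟩, by
              simp [seg₄]⟩)

/-- The permuton `μ^z`. -/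
def rectPermuton (z : unitInterval) : Permuton :=
  ⟨⟨rectMeasure z, (rectMeasure_hasUniformMarginals z).isProbabilityMeasure⟩,
    rectMeasure_hasUniformMarginals z⟩

end AlmostSquare

end

noncomputable section

namespace AlmostSquare

/-! ### Ranks and balanced sets -/

/-! An almost square permutation consists of four monotone chains of records surrounding its
internal points. Label each external position upper (U) or lower (D), each external value left (L)
or right (R), and let `m` be the number of points labelled both D and L. Monotonicity of the chains
turns the order of the external points into identities between ranks inside these label sets
(`Fits`). A permutation together with an ordering of its `k` internal points is therefore determined
by `m`, the list of internal points and the two sets U and R, each contained in a set of `n`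
elements; call this a code.

Most label sets are balanced, in that every prefix lies about half inside the set; by a Chernoff
bound the exceptions are exponentially few (`card_not_balanced_le`). With balanced labels a rank is
about half an index, so the chains follow the sides of the rectangle with parameter `z = 2m/N`,
where `N = n + k`, and they trap the internal points in it. This rectangle holds about `4m(N - 2m) =
(N² - (4m - N)²)/2` grid points, so a given `m` admits about that number to the power `k`, times `4
^ n`, codes. The base has its unique maximum at `m = N/4`, that is `z = 1/2`, and since `k → ∞` the
power makes every macroscopically different `m` negligible. The hypothesis `k = o(n)` ensures that
constants to the power `k` do not outweigh the exponential rarity of unbalanced labels.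

To make this a statement about proportions, both sides are counted with the same factor `k!`. For
the upper bounds it is enough that every permutation has some code (`exists_fits`,
`card_mul_factorial_le`). The lower bound (`le_card_mul_factorial`) builds permutations from codes
with `m` near `N/4`, internal points well inside the rectangle and balanced labels, where both ends
are labelled D and L; with this convention a code can be read off from its permutation
(`CentralFits.unique`). Dividing gives `card_not_nearSquare_le`: the proportion of bad permutations
is at most a constant times `ρ ^ k` with `ρ < 1`, plus a constant times `N exp(-cN)`.

The rest is deterministic. The square permuton draws a uniform abscissa and then the upper or lower
boundary with equal weights. A permutation near the square does the same up to a small error,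
because its U and D positions alternate evenly at every scale; summation by parts gives this for
Lipschitz test functions (`NearSquare.abs_integral_sub_le`). The limit being deterministic, the
portmanteau theorem on open sets finishes the proof. -/

/-- The number of elements of `s` that are smaller than `i`. -/
def rank {N : ℕ} (s : Finset (Fin N)) (i : ℕ) : ℕ := (s.filter fun j : Fin N => (j : ℕ) < i).card

lemma rank_mono {N : ℕ} (s : Finset (Fin N)) {i j : ℕ} (h : i ≤ j) : rank s i ≤ rank s j :=
  Finset.card_le_card fun x hx => by
    simp only [Finset.mem_filter] at hx ⊢; exact ⟨hx.1, by omega⟩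

lemma rank_lt_rank {N : ℕ} {s : Finset (Fin N)} {i : Fin N} {j : ℕ} (hi : i ∈ s) (h : (i : ℕ) < j) :
    rank s i < rank s j := by
  apply Finset.card_lt_card
  rw [Finset.ssubset_iff_of_subset]
  · exact ⟨i, by simp [hi, h], by simp⟩
  · intro x hx
    simp only [Finset.mem_filter] at hx ⊢; exact ⟨hx.1, by omega⟩

lemma rank_lt_card {N : ℕ} {s : Finset (Fin N)} {i : Fin N} (hi : i ∈ s) : rank s i < s.card := by
  apply Finset.card_lt_card
  rw [Finset.ssubset_iff_of_subset (Finset.filter_subset _ _)]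
  exact ⟨i, hi, by simp⟩

lemma lt_of_rank_lt {N : ℕ} {s : Finset (Fin N)} {i j : ℕ} (h : rank s i < rank s j) : i < j := by
  by_contra hc
  exact absurd (rank_mono s (not_lt.1 hc)) (by omega)

lemma rank_injOn {N : ℕ} {s : Finset (Fin N)} {i j : Fin N} (hi : i ∈ s) (hj : j ∈ s)
    (h : rank s i = rank s j) : i = j := by
  rcases lt_trichotomy i j with h' | h' | h'
  · exact absurd (rank_lt_rank hi h') (by omega)
  · exact h'
  · exact absurd (rank_lt_rank hj h') (by omega)

lemma rank_eq_card {N : ℕ} (s : Finset (Fin N)) : rank s N = s.card := by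
  rw [rank, Finset.filter_true_of_mem fun j _ => j.2]

lemma rank_succ {N : ℕ} (s : Finset (Fin N)) {i : ℕ} (hi : i < N) :
    rank s (i + 1) = rank s i + if (⟨i, hi⟩ : Fin N) ∈ s then 1 else 0 := by
  have : (s.filter fun j : Fin N => (j : ℕ) < i + 1) =
      (s.filter fun j : Fin N => (j : ℕ) < i) ∪ (s.filter fun j : Fin N => j = ⟨i, hi⟩) := by
    ext x
    simp only [Finset.mem_filter, Finset.mem_union, Fin.ext_iff, Nat.lt_succ_iff_lt_or_eq]
    tauto
  rw [rank, this, Finset.card_union_of_disjoint, ← rank]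
  · congr 1
    split_ifs with h
    · rw [Finset.filter_eq', if_pos h, Finset.card_singleton]
    · rw [Finset.filter_eq', if_neg h, Finset.card_empty]
  · rw [Finset.disjoint_left]
    intro x hx hx'
    simp only [Finset.mem_filter, Fin.ext_iff] at hx hx'
    omega

lemma rank_union {N : ℕ} {s t : Finset (Fin N)} (h : Disjoint s t) (i : ℕ) :
    rank (s ∪ t) i = rank s i + rank t i := by
  rw [rank, Finset.filter_union, Finset.card_union_of_disjoint (Finset.disjoint_filter_filter h)]
  rfl

lemma rank_univ {N : ℕ} {i : ℕ} (hi : i ≤ N) : rank (Finset.univ : Finset (Fin N)) i = i := by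
  induction i with
  | zero => simp [rank]
  | succ i ih => rw [rank_succ _ hi, ih (by omega)]; simp

/-- A discrete intermediate value argument: `rank s` rises by at most one per step, and the step at
which it first exceeds `r` occurs at the element sought. -/
lemma exists_rank_eq {N : ℕ} (s : Finset (Fin N)) {r : ℕ} (hr : r < s.card) :
    ∃ i ∈ s, rank s i = r := by
  have hN : ∃ i, r < rank s i := ⟨N, by rwa [rank_eq_card]⟩
  have h1 := Nat.find_spec hN
  have h2 : ∀ j < Nat.find hN, rank s j ≤ r := fun j hj => not_lt.1 (Nat.find_min hN hj)
  set i := Nat.find hN with hi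
  have hiN : i ≤ N := Nat.find_min' hN (by rwa [rank_eq_card])
  rcases Nat.eq_zero_or_pos i with h0 | h0
  · rw [h0] at h1; simp [rank] at h1
  · obtain ⟨j, hj⟩ : ∃ j, i = j + 1 := ⟨i - 1, by omega⟩
    have h3 := h2 j (by omega)
    rw [hj, rank_succ s (by omega)] at h1
    split_ifs at h1 with hm
    · exact ⟨_, hm, by simp only; omega⟩
    · omega

/-- All the prefixes of `{0, …, N - 1}` have about half of their points in `s`. -/
def Balanced {N : ℕ} (E : ℕ) (s : Finset (Fin N)) : Prop :=
  ∀ i ≤ N, 2 * rank s i ≤ i + E ∧ i ≤ 2 * rank s i + E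

lemma Balanced.mono {N E E' : ℕ} {s : Finset (Fin N)} (h : Balanced E s) (hE : E ≤ E') :
    Balanced E' s := fun i hi => by have := h i hi; omega

/-- The part of a partition that is complementary to a balanced part, up to a small part. -/
lemma Balanced.compl {N E k : ℕ} {U D P : Finset (Fin N)} (h : Balanced E U) (hUD : Disjoint U D)
    (hP : Disjoint (U ∪ D) P) (hu : U ∪ D ∪ P = Finset.univ) (hk : P.card ≤ k) :
    Balanced (E + 2 * k) D := by
  intro i hi
  have h1 := h i hi
  have h2 := rank_univ hi
  rw [← hu, rank_union hP, rank_union hUD] at h2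
  have h3 : rank P i ≤ k := (Finset.card_le_card (Finset.filter_subset _ _)).trans hk
  omega

/-! ### Exponentially few sets are not balanced -/

/-- Up to normalisation this is the moment generating function at time `i` of a simple random walk
whose steps are `+1` on `s` and `-1` off it; it follows from `cosh t ≤ exp (t ^ 2 / 2)`. -/
lemma sum_exp_rank_le {N : ℕ} (t : ℝ) {i : ℕ} (hi : i ≤ N) :
    ∑ s : Finset (Fin N), Real.exp (t * (2 * rank s i - i)) ≤ 2 ^ N * Real.exp (N * (t ^ 2 / 2)) := by
  have key : ∀ s : Finset (Fin N), Real.exp (t * (2 * rank s i - i)) =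
      (∏ j ∈ s, if (j : ℕ) < i then Real.exp t else 1) *
        ∏ j ∈ Finset.univ \ s, if (j : ℕ) < i then Real.exp (-t) else 1 := by
    intro s
    have e1 : rank s i + rank (Finset.univ \ s) i = i := by
      rw [← rank_union Finset.disjoint_sdiff, Finset.union_sdiff_of_subset (Finset.subset_univ s),
        rank_univ hi]
    rw [← Finset.prod_filter, ← Finset.prod_filter, Finset.prod_const, Finset.prod_const,
      ← Real.exp_nat_mul, ← Real.exp_nat_mul, ← Real.exp_add]
    congr 1
    change _ = (rank s i : ℝ) * t + (rank (Finset.univ \ s) i : ℝ) * (-t)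
    have e2 : (i : ℝ) = rank s i + rank (Finset.univ \ s) i := by exact_mod_cast e1.symm
    rw [e2]; ring
  -- Summed over all subsets, the product factorises over positions: a position below `i`
  -- contributes `exp t + exp (-t)`, any other contributes `2`.
  rw [Finset.sum_congr rfl fun s _ => key s, ← Finset.powerset_univ, ← Finset.prod_add]
  calc _ ≤ ∏ _j : Fin N, 2 * Real.exp (t ^ 2 / 2) := by
        refine Finset.prod_le_prod (fun j _ => by split_ifs <;> positivity) fun j _ => ?_
        split_ifs
        · have := Real.cosh_le_exp_half_sq t
          rw [Real.cosh_eq] at this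
          linarith
        · have := Real.one_le_exp (show 0 ≤ t ^ 2 / 2 by positivity)
          linarith
    _ = _ := by
        rw [Finset.prod_const, mul_pow, ← Real.exp_nat_mul]; simp

-- Chernoff's bound for both tails, with a union bound over the `N + 1` prefixes.
open Classical in
lemma card_not_balanced_le {N : ℕ} (hN : 0 < N) (E : ℕ) :
    (((Finset.univ : Finset (Finset (Fin N))).filter fun s => ¬ Balanced E s).card : ℝ) ≤
      2 * (N + 1) * 2 ^ N * Real.exp (-((E : ℝ) ^ 2 / (2 * N))) := by
  have hN' : (0 : ℝ) < N := by exact_mod_cast hN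
  -- The minimiser of `N t² / 2 - t E`.
  set t : ℝ := E / N with ht
  have ht0 : 0 ≤ t := by positivity
  -- one tail
  have tail : ∀ i ≤ N, ∑ s : Finset (Fin N), (Real.exp (t * (2 * rank s i - i)) +
      Real.exp (-t * (2 * rank s i - i))) * Real.exp (-(t * E)) ≤
      2 * 2 ^ N * Real.exp (-((E : ℝ) ^ 2 / (2 * N))) := by
    intro i hi
    rw [← Finset.sum_mul, Finset.sum_add_distrib]
    have h1 := sum_exp_rank_le (N := N) t hi
    have h2 := sum_exp_rank_le (N := N) (-t) hi
    rw [neg_sq] at h2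
    calc _ ≤ (2 ^ N * Real.exp (N * (t ^ 2 / 2)) + 2 ^ N * Real.exp (N * (t ^ 2 / 2))) *
          Real.exp (-(t * E)) := by gcongr
      _ = 2 * 2 ^ N * (Real.exp (N * (t ^ 2 / 2)) * Real.exp (-(t * E))) := by ring
      _ = _ := by
        rw [← Real.exp_add]; congr 2; rw [ht]; field_simp; ring
  have hsum : (((Finset.univ : Finset (Finset (Fin N))).filter fun s => ¬ Balanced E s).card : ℝ) ≤
      ∑ s : Finset (Fin N), ∑ i ∈ Finset.range (N + 1), (Real.exp (t * (2 * rank s i - i)) +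
        Real.exp (-t * (2 * rank s i - i))) * Real.exp (-(t * E)) := by
    rw [Finset.card_filter, Nat.cast_sum]
    refine Finset.sum_le_sum fun s _ => ?_
    by_cases h : Balanced E s
    · rw [if_neg (not_not.2 h), Nat.cast_zero]; positivity
    · rw [if_pos h]
      simp only [Balanced, not_forall] at h
      obtain ⟨i, hi, h⟩ := h
      refine le_trans ?_ (Finset.single_le_sum (fun j _ => by positivity)
        (Finset.mem_range.2 (Nat.lt_succ_of_le hi)))
      rw [add_mul, ← Real.exp_add, ← Real.exp_add, Nat.cast_one]
      rw [not_and_or, not_le, not_le] at h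
      rcases h with h | h
      · have h' : (i : ℝ) + E ≤ 2 * rank s i := by exact_mod_cast h.le
        have : 1 ≤ Real.exp (t * (2 * rank s i - i) + -(t * E)) := by
          apply Real.one_le_exp
          nlinarith
        have := Real.exp_nonneg (-t * (2 * rank s i - i) + -(t * E))
        linarith
      · have h' : (2 * rank s i : ℝ) + E ≤ i := by exact_mod_cast h.le
        have : 1 ≤ Real.exp (-t * (2 * rank s i - i) + -(t * E)) := by
          apply Real.one_le_exp
          nlinarith
        have := Real.exp_nonneg (t * (2 * rank s i - i) + -(t * E))
        linarith
  refine hsum.trans ?_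
  rw [Finset.sum_comm]
  refine (Finset.sum_le_sum fun i hi => tail i (by simpa [Nat.lt_succ_iff] using hi)).trans ?_
  rw [Finset.sum_const, Finset.card_range, nsmul_eq_mul]
  push_cast
  apply le_of_eq; ring

/-! ### Counting tuples with distinct coordinates -/

open Classical in
/-- The `k`-tuples of points of `A` with distinct first coordinates and distinct second ones. -/
def goodTuples {N : ℕ} (A : Finset (Fin N × Fin N)) (k : ℕ) : Finset (Fin k → Fin N × Fin N) :=
  (Fintype.piFinset fun _ => A).filter fun w =>
    Function.Injective (fun j => (w j).1) ∧ Function.Injective (fun j => (w j).2)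

lemma mem_goodTuples {N : ℕ} {A : Finset (Fin N × Fin N)} {k : ℕ} {w : Fin k → Fin N × Fin N} :
    w ∈ goodTuples A k ↔ (∀ j, w j ∈ A) ∧ Function.Injective (fun j => (w j).1) ∧
      Function.Injective (fun j => (w j).2) := by
  simp [goodTuples]

/-- Each of the `k` points already chosen forbids one row and one column, hence at most `2 * N`
points of `A`. The subtraction is truncated, so nothing is claimed when `A` is small. -/
lemma le_card_goodTuples_succ {N : ℕ} (A : Finset (Fin N × Fin N)) (k : ℕ) :
    (goodTuples A k).card * (A.card - 2 * k * N) ≤ (goodTuples A (k + 1)).card := by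
  classical
  let F : (Fin k → Fin N × Fin N) → Finset (Fin N × Fin N) := fun w =>
    A.filter fun a => (∀ j, a.1 ≠ (w j).1) ∧ (∀ j, a.2 ≠ (w j).2)
  have hF : ∀ w, A.card - 2 * k * N ≤ (F w).card := by
    intro w
    have hsub : A ⊆ F w ∪ (Finset.univ.biUnion (fun j : Fin k => {(w j).1} ×ˢ Finset.univ) ∪
        Finset.univ.biUnion (fun j : Fin k => Finset.univ ×ˢ {(w j).2})) := by
      intro a ha
      by_cases h : a ∈ F w
      · simp [h]
      · simp only [F, Finset.mem_filter, ha, true_and, not_and_or, not_forall, not_not] at h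
        simp only [Finset.mem_union, Finset.mem_biUnion, Finset.mem_univ, true_and,
          Finset.mem_product, Finset.mem_singleton, and_true]
        right
        exact h
    have h1 := (Finset.card_le_card hsub).trans (Finset.card_union_le _ _)
    have h2 : (Finset.univ.biUnion (fun j : Fin k =>
        ({(w j).1} ×ˢ Finset.univ : Finset (Fin N × Fin N)))).card ≤ k * N := by
      refine (Finset.card_biUnion_le).trans ?_
      simp
    have h3 : (Finset.univ.biUnion (fun j : Fin k =>
        (Finset.univ ×ˢ {(w j).2} : Finset (Fin N × Fin N)))).card ≤ k * N := by
      refine (Finset.card_biUnion_le).trans ?_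
      simp
    have h4 := Finset.card_union_le (Finset.univ.biUnion (fun j : Fin k =>
        ({(w j).1} ×ˢ Finset.univ : Finset (Fin N × Fin N)))) (Finset.univ.biUnion (fun j : Fin k =>
        (Finset.univ ×ˢ {(w j).2} : Finset (Fin N × Fin N))))
    have h5 : 2 * k * N = k * N + k * N := by ring
    omega
  calc _ ≤ ∑ w ∈ goodTuples A k, (F w).card := by
        rw [← smul_eq_mul, ← Finset.sum_const]
        exact Finset.sum_le_sum fun w _ => hF w
    _ = ((goodTuples A k).sigma F).card := (Finset.card_sigma _ _).symm
    _ ≤ _ := by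
        refine Finset.card_le_card_of_injOn (fun x => Fin.cons x.2 x.1) ?_ ?_
        · rintro ⟨w, a⟩ hx
          simp only [Finset.coe_sigma, Set.mem_sigma_iff, Finset.mem_coe, mem_goodTuples, F,
            Finset.mem_filter] at hx
          obtain ⟨⟨h1, h2, h3⟩, ha, h4, h5⟩ := hx
          rw [Finset.mem_coe, mem_goodTuples]
          refine ⟨fun j => ?_, ?_, ?_⟩
          · refine Fin.cases ?_ (fun j => ?_) j
            · exact ha
            · exact h1 j
          · intro i j
            refine Fin.cases ?_ (fun i => ?_) i <;> refine Fin.cases ?_ (fun j => ?_) j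
            · simp
            · intro h; exact absurd h (h4 j)
            · intro h; exact absurd h.symm (h4 i)
            · intro h; exact congrArg _ (h2 h)
          · intro i j
            refine Fin.cases ?_ (fun i => ?_) i <;> refine Fin.cases ?_ (fun j => ?_) j
            · simp
            · intro h; exact absurd h (h5 j)
            · intro h; exact absurd h.symm (h5 i)
            · intro h; exact congrArg _ (h3 h)
        · rintro ⟨w, a⟩ - ⟨w', a'⟩ - h
          obtain ⟨h1, h2⟩ := Fin.cons_injective2 h
          exact Sigma.ext h2 (heq_of_eq h1)

lemma pow_le_card_goodTuples {N : ℕ} (A : Finset (Fin N × Fin N)) (k : ℕ) :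
    (A.card - 2 * k * N) ^ k ≤ (goodTuples A k).card := by
  have : ∀ j ≤ k, (A.card - 2 * k * N) ^ j ≤ (goodTuples A j).card := by
    intro j
    induction j with
    | zero =>
      intro _
      rw [pow_zero, Nat.one_le_iff_ne_zero, ← Nat.pos_iff_ne_zero, Finset.card_pos]
      exact ⟨Fin.elim0, mem_goodTuples.2 ⟨fun j => j.elim0, fun j => j.elim0, fun j => j.elim0⟩⟩
    | succ j ih =>
      intro hj
      refine le_trans ?_ (le_card_goodTuples_succ A j)
      rw [pow_succ]
      refine Nat.mul_le_mul (ih (by omega)) (Nat.sub_le_sub_left ?_ _)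
      gcongr
      omega
  exact this k le_rfl

/-! ### Counting the orderings of a set -/

open Classical in
lemma card_orderings {N k : ℕ} (I : Finset (Fin N)) (hI : I.card = k) :
    ((Finset.univ : Finset (Fin k → Fin N)).filter fun p =>
      Function.Injective p ∧ Finset.univ.image p = I).card = k.factorial := by
  rw [← Fintype.card_subtype]
  have e : Fin k ≃ I := (Finset.equivFinOfCardEq hI).symm
  have h : Fintype.card (Fin k ≃ I) = k.factorial := by
    rw [Fintype.card_equiv e, Fintype.card_fin]
  rw [← h]
  refine Fintype.card_congr
    { toFun := fun p => Equiv.ofBijective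
        (fun j => (⟨p.1 j, p.2.2.subset (Finset.mem_image_of_mem _ (Finset.mem_univ j))⟩ : I)) ?_
      invFun := fun f => ⟨fun j => f j, ?_, ?_⟩
      left_inv := ?_
      right_inv := ?_ }
  · rw [Fintype.bijective_iff_injective_and_card]
    refine ⟨fun i j hij => p.2.1 (congrArg Subtype.val hij), ?_⟩
    simp [hI]
  · exact Subtype.val_injective.comp f.injective
  · ext x
    simp only [Finset.mem_image, Finset.mem_univ, true_and]
    constructor
    · rintro ⟨j, rfl⟩; exact (f j).2
    · intro hx; exact ⟨f.symm ⟨x, hx⟩, by simp⟩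
  · intro p; rfl
  · intro f; ext j; rfl

/-! ### Encoding the external points of a permutation -/

/-- A partition of `{0, …, N - 1}` into three parts. -/
structure IsSplit {N : ℕ} (U D P : Finset (Fin N)) : Prop where
  disjoint : Disjoint U D
  disjoint_union : Disjoint (U ∪ D) P
  union_eq : U ∪ D ∪ P = Finset.univ

lemma IsSplit.card {N : ℕ} {U D P : Finset (Fin N)} (h : IsSplit U D P) :
    U.card + D.card + P.card = N := by
  rw [← Finset.card_union_of_disjoint h.disjoint, ← Finset.card_union_of_disjoint h.disjoint_union,
    h.union_eq, Finset.card_univ, Fintype.card_fin]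

lemma IsSplit.symm {N : ℕ} {U D P : Finset (Fin N)} (h : IsSplit U D P) : IsSplit D U P :=
  ⟨h.disjoint.symm, by rw [Finset.union_comm]; exact h.disjoint_union, by
    rw [Finset.union_comm D U]; exact h.union_eq⟩

lemma IsSplit.mem {N : ℕ} {U D P : Finset (Fin N)} (h : IsSplit U D P) (i : Fin N) :
    i ∈ U ∨ i ∈ D ∨ i ∈ P := by
  have := h.union_eq.symm.subset (Finset.mem_univ i)
  simpa [Finset.mem_union, or_assoc] using this

lemma isSplit_compl {N : ℕ} {U P : Finset (Fin N)} (h : Disjoint U P) : IsSplit U (U ∪ P)ᶜ P := by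
  refine ⟨?_, ?_, ?_⟩
  · rw [Finset.disjoint_left]
    intro x hx hx'
    simp [hx] at hx'
  · rw [Finset.disjoint_left] at h ⊢
    intro x hx hx'
    simp only [Finset.mem_union, Finset.mem_compl, not_or] at hx
    rcases hx with hx | hx
    · exact h hx hx'
    · exact hx.2 hx'
  · ext x
    simp only [Finset.mem_union, Finset.mem_compl, Finset.mem_univ, iff_true]
    tauto

lemma IsSplit.eq_compl {N : ℕ} {U D P : Finset (Fin N)} (h : IsSplit U D P) :
    D = (U ∪ P)ᶜ := by
  have h1 := h.disjoint
  have h2 := h.disjoint_union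
  rw [Finset.disjoint_left] at h1 h2
  ext x
  have h3 := h.mem x
  have h4 := @h1 x
  have h5 := @h2 x
  simp only [Finset.mem_union, Finset.mem_compl] at h5 ⊢
  tauto

/-- The external points of `σ` have positions in `U ∪ D` and values in `L ∪ R`. The points in
`U × L` and `D × R` are increasing, those in `D × L` and `U × R` are decreasing, there are `m`
points in `D × L` and they have the first positions of `D` and the lowest values of `L`, and
similarly for the other pairs. -/
structure Fits {N : ℕ} (U D L R : Finset (Fin N)) (m n : ℕ) (σ : Equiv.Perm (Fin N)) : Prop where
  upper : ∀ i ∈ U, (σ i ∈ L ∧ rank L (σ i) = m + rank U i) ∨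
    (σ i ∈ R ∧ rank U i + rank R (σ i) + m + 1 = n)
  lower : ∀ i ∈ D, (σ i ∈ L ∧ rank L (σ i) + rank D i + 1 = m) ∨
    (σ i ∈ R ∧ rank D i = m + rank R (σ i))

/-- A permutation is determined by its code. -/
lemma Fits.eq_of_eqOn {N : ℕ} {U D P L R Q : Finset (Fin N)} {m n : ℕ} {σ σ' : Equiv.Perm (Fin N)}
    (h : Fits U D L R m n σ) (h' : Fits U D L R m n σ') (hUD : IsSplit U D P) (hLR : IsSplit L R Q)
    (hn : n + Q.card = N) (hP : ∀ i ∈ P, σ i = σ' i) : σ = σ' := by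
  have hc := hLR.card
  ext1 i
  rcases hUD.mem i with hi | hi | hi
  -- The label of the value is forced as well: for a position in `U` it is `L` exactly when `m +
  -- rank U i < L.card`, so the mixed cases are contradictory. For a position in `D` the threshold
  -- is `rank D i < m`.
  · rcases h.upper i hi with ⟨h1, h2⟩ | ⟨h1, h2⟩ <;> rcases h'.upper i hi with ⟨h3, h4⟩ | ⟨h3, h4⟩
    · exact rank_injOn h1 h3 (by omega)
    · have := rank_lt_card h1; have := rank_lt_card h3; omega
    · have := rank_lt_card h1; have := rank_lt_card h3; omega
    · exact rank_injOn h1 h3 (by omega)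
  · rcases h.lower i hi with ⟨h1, h2⟩ | ⟨h1, h2⟩ <;> rcases h'.lower i hi with ⟨h3, h4⟩ | ⟨h3, h4⟩
    · exact rank_injOn h1 h3 (by omega)
    · omega
    · omega
    · exact rank_injOn h1 h3 (by omega)
  · exact hP i hi

lemma rank_image {N : ℕ} (s : Finset (Fin N)) (σ : Equiv.Perm (Fin N)) (v : Fin N) :
    rank (s.image σ) v = (s.filter fun j => σ j < v).card := by
  rw [rank, Finset.filter_image, Finset.card_image_of_injective _ σ.injective]
  rfl

lemma card_filter_lt_add_card_filter_gt {N : ℕ} {s : Finset (Fin N)} {i : Fin N} (hi : i ∈ s) :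
    (s.filter fun j => j < i).card + (s.filter fun j => i < j).card + 1 = s.card := by
  have h1 : s.filter (fun j => ¬ j < i) = insert i (s.filter fun j => i < j) := by
    ext x
    simp only [Finset.mem_filter, Finset.mem_insert]
    constructor
    · rintro ⟨h1, h2⟩
      rcases (not_lt.1 h2).eq_or_lt with h | h
      · exact Or.inl h.symm
      · exact Or.inr ⟨h1, h⟩
    · rintro (rfl | ⟨h1, h2⟩)
      · exact ⟨hi, lt_irrefl _⟩
      · exact ⟨h1, h2.le.not_gt⟩
  have h2 := Finset.card_filter_add_card_filter_not (s := s) (fun j => j < i)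
  rw [h1, Finset.card_insert_of_notMem (by simp)] at h2
  omega

/-- The set of positions of the internal points. -/
def internals {N : ℕ} (σ : Equiv.Perm (Fin N)) : Finset (Fin N) := by
  classical exact Finset.univ.filter fun i => IsInternal σ i

lemma mem_internals {N : ℕ} {σ : Equiv.Perm (Fin N)} {i : Fin N} :
    i ∈ internals σ ↔ IsInternal σ i := by
  simp [internals]

lemma mem_ASq {n k : ℕ} {σ : Equiv.Perm (Fin (n + k))} :
    σ ∈ ASq n k ↔ (internals σ).card = k := by
  have h1 : {i | IsInternal σ i} = (internals σ : Set (Fin (n + k))) := by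
    ext i; simp [mem_internals]
  have h2 : {i | IsExternal σ i} = ((internals σ)ᶜ : Finset (Fin (n + k))) := by
    ext i; simp [mem_internals, IsInternal]
  rw [ASq, Set.mem_ofPred_eq, h1, h2, Set.ncard_coe_finset, Set.ncard_coe_finset, Finset.card_compl,
    Fintype.card_fin]
  have := (Finset.card_le_univ (internals σ))
  rw [Fintype.card_fin] at this
  omega

/-- Every permutation has a code. -/
lemma exists_fits {N : ℕ} (σ : Equiv.Perm (Fin N)) {n : ℕ} (hn : n + (internals σ).card = N) :
    ∃ (U D L R : Finset (Fin N)) (m : ℕ), IsSplit U D (internals σ) ∧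
      IsSplit L R ((internals σ).image σ) ∧ m ≤ D.card ∧ Fits U D L R m n σ := by
  classical
  -- `A`, `B`, `C`, `F` stand for left-to-right maximum, right-to-left maximum, left-to-right
  -- minimum and right-to-left minimum.
  let A : Fin N → Prop := fun i => ∀ j, j < i → σ j < σ i
  let B : Fin N → Prop := fun i => ∀ j, i < j → σ j < σ i
  let C : Fin N → Prop := fun i => ∀ j, j < i → σ i < σ j
  let F : Fin N → Prop := fun i => ∀ j, i < j → σ i < σ j
  have hext : ∀ i, i ∈ internals σ ↔ ¬ (A i ∨ C i ∨ B i ∨ F i) := fun i => mem_internals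
  -- A point may be a record in several ways; it goes to the first class that applies, in the order
  -- `A`, `B`, `C`, `F`. The rank identities hold for any such tie-breaking.
  let UL := Finset.univ.filter A
  let UR := Finset.univ.filter fun i => B i ∧ ¬ A i
  let DL := Finset.univ.filter fun i => C i ∧ ¬ A i ∧ ¬ B i
  let DR := Finset.univ.filter fun i => F i ∧ ¬ A i ∧ ¬ B i ∧ ¬ C i
  have mUL : ∀ {i}, i ∈ UL → A i := fun h => (Finset.mem_filter.1 h).2
  have mUR : ∀ {i}, i ∈ UR → B i := fun h => (Finset.mem_filter.1 h).2.1
  have mDL : ∀ {i}, i ∈ DL → C i := fun h => (Finset.mem_filter.1 h).2.1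
  have mDR : ∀ {i}, i ∈ DR → F i := fun h => (Finset.mem_filter.1 h).2.1
  have d1 : Disjoint UL UR := by
    rw [Finset.disjoint_left]; intro x; simp only [UL, UR, Finset.mem_filter]; tauto
  have d2 : Disjoint UL DL := by
    rw [Finset.disjoint_left]; intro x; simp only [UL, DL, Finset.mem_filter]; tauto
  have d3 : Disjoint UL DR := by
    rw [Finset.disjoint_left]; intro x; simp only [UL, DR, Finset.mem_filter]; tauto
  have d4 : Disjoint UR DL := by
    rw [Finset.disjoint_left]; intro x; simp only [UR, DL, Finset.mem_filter]; tauto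
  have d5 : Disjoint UR DR := by
    rw [Finset.disjoint_left]; intro x; simp only [UR, DR, Finset.mem_filter]; tauto
  have d6 : Disjoint DL DR := by
    rw [Finset.disjoint_left]; intro x; simp only [DL, DR, Finset.mem_filter]; tauto
  -- how two records of different types are placed
  have AC : ∀ {i j}, A i → C j → i ≠ j → σ j < σ i := fun {i j} hi hj hne =>
    hne.lt_or_gt.elim (fun h => hj i h) (fun h => hi j h)
  have BF : ∀ {i j}, B i → F j → i ≠ j → σ j < σ i := fun {i j} hi hj hne =>
    hne.lt_or_gt.elim (fun h => hi j h) (fun h => hj i h)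
  have AB : ∀ {i j}, A i → B j → i ≠ j → i < j := fun {i j} hi hj hne =>
    hne.lt_or_gt.elim id (fun h => absurd (hi j h) (hj i h).not_gt)
  have CF : ∀ {i j}, C i → F j → i ≠ j → i < j := fun {i j} hi hj hne =>
    hne.lt_or_gt.elim id (fun h => absurd (hi j h) (hj i h).not_gt)
  have AA : ∀ {i j}, A i → A j → (σ j < σ i ↔ j < i) := fun {i j} hi hj =>
    ⟨fun h => not_le.1 fun h' => h'.eq_or_lt.elim (fun e => (e ▸ h).false)
      (fun h' => (hj i h').not_gt h), hi j⟩
  have FF : ∀ {i j}, F i → F j → (σ j < σ i ↔ j < i) := fun {i j} hi hj =>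
    ⟨fun h => not_le.1 fun h' => h'.eq_or_lt.elim (fun e => (e ▸ h).false)
      (fun h' => (hi j h').not_gt h), hj i⟩
  have BB : ∀ {i j}, B i → B j → (σ j < σ i ↔ i < j) := fun {i j} hi hj =>
    ⟨fun h => not_le.1 fun h' => h'.eq_or_lt.elim (fun e => (e ▸ h).false)
      (fun h' => (hj i h').not_gt h), hi j⟩
  have CC : ∀ {i j}, C i → C j → (σ j < σ i ↔ i < j) := fun {i j} hi hj =>
    ⟨fun h => not_le.1 fun h' => h'.eq_or_lt.elim (fun e => (e ▸ h).false)
      (fun h' => (hi j h').not_gt h), hj i⟩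
  have sU : IsSplit (UL ∪ UR) (DL ∪ DR) (internals σ) := by
    refine ⟨?_, ?_, ?_⟩
    · rw [Finset.disjoint_union_left, Finset.disjoint_union_right, Finset.disjoint_union_right]
      exact ⟨⟨d2, d3⟩, d4, d5⟩
    · rw [Finset.disjoint_left]
      intro x
      simp only [hext, UL, UR, DL, DR, Finset.mem_filter, Finset.mem_union, Finset.mem_univ,
        true_and]
      tauto
    · ext x
      simp only [hext, UL, UR, DL, DR, Finset.mem_filter, Finset.mem_union, Finset.mem_univ,
        true_and, iff_true]
      tauto
  have sL : IsSplit ((UL ∪ DL).image σ) ((UR ∪ DR).image σ) ((internals σ).image σ) := by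
    refine ⟨?_, ?_, ?_⟩
    · rw [Finset.disjoint_image σ.injective, Finset.disjoint_union_left,
        Finset.disjoint_union_right, Finset.disjoint_union_right]
      exact ⟨⟨d1, d3⟩, d4.symm, d6⟩
    · rw [← Finset.image_union, Finset.disjoint_image σ.injective]
      have := sU.disjoint_union
      rwa [Finset.union_union_union_comm] at this
    · rw [← Finset.image_union, ← Finset.image_union, Finset.union_union_union_comm, sU.union_eq,
        Finset.image_univ_of_surjective σ.surjective]
  have hcard := sU.card
  rw [Finset.card_union_of_disjoint d1, Finset.card_union_of_disjoint d6] at hcard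
  have rL : ∀ i, rank ((UL ∪ DL).image σ) (σ i) =
      (UL.filter fun j => σ j < σ i).card + (DL.filter fun j => σ j < σ i).card := fun i => by
    rw [rank_image, Finset.filter_union,
      Finset.card_union_of_disjoint (Finset.disjoint_filter_filter d2)]
  have rR : ∀ i, rank ((UR ∪ DR).image σ) (σ i) =
      (UR.filter fun j => σ j < σ i).card + (DR.filter fun j => σ j < σ i).card := fun i => by
    rw [rank_image, Finset.filter_union,
      Finset.card_union_of_disjoint (Finset.disjoint_filter_filter d5)]
  have rU : ∀ i : Fin N, rank (UL ∪ UR) i =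
      (UL.filter fun j => j < i).card + (UR.filter fun j => j < i).card := fun i =>
    rank_union d1 i
  have rD : ∀ i : Fin N, rank (DL ∪ DR) i =
      (DL.filter fun j => j < i).card + (DR.filter fun j => j < i).card := fun i =>
    rank_union d6 i
  refine ⟨UL ∪ UR, DL ∪ DR, (UL ∪ DL).image σ, (UR ∪ DR).image σ, DL.card, sU, sL,
    Finset.card_le_card Finset.subset_union_left, ?_, ?_⟩
  · intro i hi
    rw [Finset.mem_union] at hi
    rcases hi with hi | hi
    · left
      refine ⟨Finset.mem_image_of_mem _ (Finset.mem_union_left _ hi), ?_⟩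
      rw [rL, rU, Finset.filter_congr fun j hj => AA (mUL hi) (mUL hj),
        Finset.filter_true_of_mem (s := DL) fun j hj => AC (mUL hi) (mDL hj)
          (Finset.disjoint_left.1 d2 hi |> fun h e => h (e ▸ hj)),
        Finset.filter_false_of_mem (s := UR) fun j hj => (AB (mUL hi) (mUR hj)
          (Finset.disjoint_left.1 d1 hi |> fun h e => h (e ▸ hj))).not_gt, Finset.card_empty]
      omega
    · right
      refine ⟨Finset.mem_image_of_mem _ (Finset.mem_union_left _ hi), ?_⟩
      rw [rR, rU, Finset.filter_congr fun j hj => BB (mUR hi) (mUR hj),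
        Finset.filter_true_of_mem (s := DR) fun j hj => BF (mUR hi) (mDR hj)
          (Finset.disjoint_left.1 d5 hi |> fun h e => h (e ▸ hj)),
        Finset.filter_true_of_mem (s := UL) fun j hj => AB (mUL hj) (mUR hi)
          (Finset.disjoint_left.1 d1 hj |> fun h e => h (e ▸ hi))]
      have := card_filter_lt_add_card_filter_gt hi
      omega
  · intro i hi
    rw [Finset.mem_union] at hi
    rcases hi with hi | hi
    · left
      refine ⟨Finset.mem_image_of_mem _ (Finset.mem_union_right _ hi), ?_⟩
      rw [rL, rD, Finset.filter_congr (s := DL) fun j hj => CC (mDL hi) (mDL hj),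
        Finset.filter_false_of_mem (s := UL) fun j hj => (AC (mUL hj) (mDL hi)
          (Finset.disjoint_left.1 d2 hj |> fun h e => h (e ▸ hi))).not_gt,
        Finset.filter_false_of_mem (s := DR) fun j hj => (CF (mDL hi) (mDR hj)
          (Finset.disjoint_left.1 d6 hi |> fun h e => h (e ▸ hj))).not_gt, Finset.card_empty]
      have := card_filter_lt_add_card_filter_gt hi
      omega
    · right
      refine ⟨Finset.mem_image_of_mem _ (Finset.mem_union_right _ hi), ?_⟩
      rw [rR, rD, Finset.filter_congr (s := DR) fun j hj => FF (mDR hi) (mDR hj),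
        Finset.filter_false_of_mem (s := UR) fun j hj => (BF (mUR hj) (mDR hi)
          (Finset.disjoint_left.1 d5 hj |> fun h e => h (e ▸ hi))).not_gt,
        Finset.filter_true_of_mem (s := DL) fun j hj => CF (mDL hj) (mDR hi)
          (Finset.disjoint_left.1 d6 hj |> fun h e => h (e ▸ hi)), Finset.card_empty]
      omega

/-! ### Permutations with balanced codes are nearly rectangular -/

/-- A code whose four sets of labels are balanced. -/
structure BalancedFits {N : ℕ} (E : ℕ) (U D L R : Finset (Fin N)) (m n : ℕ)
    (σ : Equiv.Perm (Fin N)) : Prop extends Fits U D L R m n σ where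
  balU : Balanced E U
  balD : Balanced E D
  balL : Balanced E L
  balR : Balanced E R

section
variable {N E m n : ℕ} {U D L R : Finset (Fin N)} {σ : Equiv.Perm (Fin N)}

/-- Doubling the rank identities of `Fits` and replacing twice a rank by the index, at a cost `E`
each, gives the equations of the two upper sides of the rectangle. -/
lemma BalancedFits.near_upper (h : BalancedFits E U D L R m n σ) {i : Fin N} (hi : i ∈ U) :
    ((σ i : ℕ) ≤ i + 2 * m + 2 * E ∧ i + 2 * m ≤ σ i + 2 * E) ∨
    ((i : ℕ) + σ i + 2 * m ≤ 2 * n + 2 * E ∧ 2 * n ≤ i + σ i + 2 * m + 2 + 2 * E) := by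
  have h1 := h.balU i i.2.le
  have h2 := h.balL (σ i) (σ i).2.le
  have h3 := h.balR (σ i) (σ i).2.le
  rcases h.upper i hi with ⟨-, h4⟩ | ⟨-, h4⟩ <;> omega

lemma BalancedFits.near_lower (h : BalancedFits E U D L R m n σ) {i : Fin N} (hi : i ∈ D) :
    ((σ i : ℕ) + i ≤ 2 * m + 2 * E ∧ 2 * m ≤ σ i + i + 2 + 2 * E) ∨
    ((i : ℕ) ≤ 2 * m + σ i + 2 * E ∧ 2 * m + σ i ≤ i + 2 * E) := by
  have h1 := h.balD i i.2.le
  have h2 := h.balL (σ i) (σ i).2.le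
  have h3 := h.balR (σ i) (σ i).2.le
  rcases h.lower i hi with ⟨-, h4⟩ | ⟨-, h4⟩ <;> omega

end

/-- The points of the grid in a neighbourhood of the rectangle with parameter `2 m / N`. -/
def outerRegion (N m C : ℕ) : Finset (Fin N × Fin N) :=
  Finset.univ.filter fun a => (a.2 : ℕ) ≤ a.1 + 2 * m + C ∧ (a.1 : ℕ) ≤ a.2 + 2 * m + C ∧
    2 * m ≤ a.1 + a.2 + C ∧ (a.1 : ℕ) + a.2 + 2 * m ≤ 2 * N + C

/-- The points of the grid well inside the rectangle with parameter `2 m / N`. -/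
def innerRegion (N m C : ℕ) : Finset (Fin N × Fin N) :=
  Finset.univ.filter fun a => (a.2 : ℕ) + C ≤ a.1 + 2 * m ∧ (a.1 : ℕ) + C ≤ a.2 + 2 * m ∧
    2 * m + C ≤ a.1 + a.2 ∧ (a.1 : ℕ) + a.2 + 2 * m + C ≤ 2 * N

lemma mem_outerRegion {N m C : ℕ} {a : Fin N × Fin N} : a ∈ outerRegion N m C ↔
    (a.2 : ℕ) ≤ a.1 + 2 * m + C ∧ (a.1 : ℕ) ≤ a.2 + 2 * m + C ∧
    2 * m ≤ a.1 + a.2 + C ∧ (a.1 : ℕ) + a.2 + 2 * m ≤ 2 * N + C := by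
  simp [outerRegion]

lemma mem_innerRegion {N m C : ℕ} {a : Fin N × Fin N} : a ∈ innerRegion N m C ↔
    (a.2 : ℕ) + C ≤ a.1 + 2 * m ∧ (a.1 : ℕ) + C ≤ a.2 + 2 * m ∧
    2 * m + C ≤ a.1 + a.2 ∧ (a.1 : ℕ) + a.2 + 2 * m + C ≤ 2 * N := by
  simp [innerRegion]

/-- An internal point has external points in the four quadrants around it. -/
lemma IsInternal.exists_external {N : ℕ} {σ : Equiv.Perm (Fin N)} {i : Fin N}
    (h : IsInternal σ i) :
    (∃ j, IsExternal σ j ∧ j < i ∧ σ i < σ j) ∧ (∃ j, IsExternal σ j ∧ j < i ∧ σ j < σ i) ∧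
    (∃ j, IsExternal σ j ∧ i < j ∧ σ i < σ j) ∧ (∃ j, IsExternal σ j ∧ i < j ∧ σ j < σ i) := by
  simp only [IsInternal, IsExternal, not_or, not_forall, not_lt] at h
  obtain ⟨⟨a, ha, ha'⟩, ⟨b, hb, hb'⟩, ⟨c, hc, hc'⟩, ⟨d, hd, hd'⟩⟩ := h
  refine ⟨?_, ?_, ?_, ?_⟩
  · obtain ⟨j, hj, hmax⟩ := (Finset.Iio i).exists_max_image σ ⟨a, by simpa⟩
    rw [Finset.mem_Iio] at hj
    refine ⟨j, Or.inl fun l hl => ?_, hj, ?_⟩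
    · exact (hmax l (by simpa using hl.trans hj)).lt_of_ne (σ.injective.ne hl.ne)
    · exact (ha'.lt_of_ne (σ.injective.ne ha.ne')).trans_le (hmax a (by simpa))
  · obtain ⟨j, hj, hmax⟩ := (Finset.Iio i).exists_min_image σ ⟨b, by simpa⟩
    rw [Finset.mem_Iio] at hj
    refine ⟨j, Or.inr (Or.inl fun l hl => ?_), hj, ?_⟩
    · exact (hmax l (by simpa using hl.trans hj)).lt_of_ne (σ.injective.ne hl.ne')
    · exact (hmax b (by simpa)).trans_lt (hb'.lt_of_ne (σ.injective.ne hb.ne))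
  · obtain ⟨j, hj, hmax⟩ := (Finset.Ioi i).exists_max_image σ ⟨c, by simpa⟩
    rw [Finset.mem_Ioi] at hj
    refine ⟨j, Or.inr (Or.inr (Or.inl fun l hl => ?_)), hj, ?_⟩
    · exact (hmax l (by simpa using hj.trans hl)).lt_of_ne (σ.injective.ne hl.ne')
    · exact (hc'.lt_of_ne (σ.injective.ne hc.ne)).trans_le (hmax c (by simpa))
  · obtain ⟨j, hj, hmax⟩ := (Finset.Ioi i).exists_min_image σ ⟨d, by simpa⟩
    rw [Finset.mem_Ioi] at hj
    refine ⟨j, Or.inr (Or.inr (Or.inr fun l hl => ?_)), hj, ?_⟩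
    · exact (hmax l (by simpa using hj.trans hl)).lt_of_ne (σ.injective.ne hl.ne)
    · exact (hmax d (by simpa)).trans_lt (hd'.lt_of_ne (σ.injective.ne hd.ne'))

/-- External points lie near the sides. An internal point has an external point in each of the four
quadrants around it, and each of the four inequalities is inherited from one of these. -/
lemma BalancedFits.mem_outerRegion {N E m n k : ℕ} {U D L R : Finset (Fin N)}
    {σ : Equiv.Perm (Fin N)} (h : BalancedFits E U D L R m n σ) (hU : IsSplit U D (internals σ))
    (hm : m ≤ D.card) (hn : n + k = N) (i : Fin N) :
    (i, σ i) ∈ outerRegion N m (4 * E + 2 * k + 2) := by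
  rw [AlmostSquare.mem_outerRegion]
  have ext : ∀ j, IsExternal σ j → (σ j : ℕ) ≤ j + 2 * m + (4 * E + 2 * k + 2) ∧
      (j : ℕ) ≤ σ j + 2 * m + (4 * E + 2 * k + 2) ∧
      2 * m ≤ j + σ j + (4 * E + 2 * k + 2) ∧
      (j : ℕ) + σ j + 2 * m ≤ 2 * N + (4 * E + 2 * k + 2) := by
    intro j hj
    -- The last of these three facts, with `hm`, gives `2 * m ≤ N + E`: opposite sides of the
    -- rectangle are in the right order up to the error, so a point near one side satisfies the
    -- inequality of the opposite one.
    have h1 := j.2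
    have h2 := (σ j).2
    have h0 := h.balD N le_rfl
    rw [rank_eq_card] at h0
    rcases hU.mem j with hj' | hj' | hj'
    · rcases h.near_upper hj' with h3 | h3 <;> omega
    · rcases h.near_lower hj' with h3 | h3 <;> omega
    · exact absurd hj (mem_internals.1 hj')
  by_cases hi : IsExternal σ i
  · exact ext i hi
  · obtain ⟨⟨a, ha, ha1, ha2⟩, ⟨b, hb, hb1, hb2⟩, ⟨c, hc, hc1, hc2⟩, ⟨d, hd, hd1, hd2⟩⟩ :=
      IsInternal.exists_external hi
    have := ext a ha
    have := ext b hb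
    have := ext c hc
    have := ext d hd
    simp only [Fin.lt_def] at *
    refine ⟨?_, ?_, ?_, ?_⟩ <;> omega

/-! ### Constructing permutations from codes -/

/-- The four chains must have `m`, `D.card - m`, `L.card - m` and `U.card + m - L.card` points; the
inequalities assumed say that these are nonnegative. Each value is then the element of `L` or `R` of
the prescribed rank. -/
lemma exists_fits_of_code {N k m n : ℕ} {U D P L R Q : Finset (Fin N)}
    (hUD : IsSplit U D P) (hLR : IsSplit L R Q) (hU : U.card + D.card = n)
    (hL : L.card + R.card = n) (hmD : m ≤ D.card) (hmL : m ≤ L.card) (hLU : L.card ≤ U.card + m)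
    {w : Fin k → Fin N × Fin N} (hP : ∀ i, i ∈ P ↔ ∃ j, (w j).1 = i)
    (hQ : ∀ i, i ∈ Q ↔ ∃ j, (w j).2 = i) (hw₁ : Function.Injective fun j => (w j).1)
    (hw₂ : Function.Injective fun j => (w j).2) :
    ∃ σ : Equiv.Perm (Fin N), Fits U D L R m n σ ∧ ∀ j, σ (w j).1 = (w j).2 := by
  have dU := Finset.disjoint_left.1 hUD.disjoint
  have dP := Finset.disjoint_left.1 hUD.disjoint_union
  have dL := Finset.disjoint_left.1 hLR.disjoint
  have dQ := Finset.disjoint_left.1 hLR.disjoint_union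
  have ex : ∀ i, ∃ v, (i ∈ U → (v ∈ L ∧ rank L v = m + rank U i) ∨
      (v ∈ R ∧ rank U i + rank R v + m + 1 = n)) ∧
      (i ∈ D → (v ∈ L ∧ rank L v + rank D i + 1 = m) ∨ (v ∈ R ∧ rank D i = m + rank R v)) ∧
      (∀ j, (w j).1 = i → v = (w j).2) := by
    intro i
    rcases hUD.mem i with hi | hi | hi
    · have h1 : i ∉ D := dU hi
      have h2 : ∀ j, (w j).1 ≠ i := fun j hj =>
        dP (Finset.mem_union_left _ hi) ((hP i).2 ⟨j, hj⟩)
      have h3 := rank_lt_card hi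
      by_cases h : m + rank U i < L.card
      · obtain ⟨v, hv, hv'⟩ := exists_rank_eq L h
        exact ⟨v, fun _ => Or.inl ⟨hv, hv'⟩, fun h => absurd h h1, fun j hj => absurd hj (h2 j)⟩
      · obtain ⟨v, hv, hv'⟩ := exists_rank_eq R (r := n - 1 - m - rank U i) (by omega)
        exact ⟨v, fun _ => Or.inr ⟨hv, by omega⟩, fun h => absurd h h1,
          fun j hj => absurd hj (h2 j)⟩
    · have h1 : i ∉ U := fun h => dU h hi
      have h2 : ∀ j, (w j).1 ≠ i := fun j hj =>
        dP (Finset.mem_union_right _ hi) ((hP i).2 ⟨j, hj⟩)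
      have h3 := rank_lt_card hi
      by_cases h : rank D i < m
      · obtain ⟨v, hv, hv'⟩ := exists_rank_eq L (r := m - 1 - rank D i) (by omega)
        exact ⟨v, fun h => absurd h h1, fun _ => Or.inl ⟨hv, by omega⟩,
          fun j hj => absurd hj (h2 j)⟩
      · obtain ⟨v, hv, hv'⟩ := exists_rank_eq R (r := rank D i - m) (by omega)
        exact ⟨v, fun h => absurd h h1, fun _ => Or.inr ⟨hv, by omega⟩,
          fun j hj => absurd hj (h2 j)⟩
    · obtain ⟨j, rfl⟩ := (hP i).1 hi
      refine ⟨(w j).2, fun h => absurd hi (dP (Finset.mem_union_left _ h)),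
        fun h => absurd hi (dP (Finset.mem_union_right _ h)), fun j' hj' => ?_⟩
      rw [hw₁ hj']
  choose f fU fD fP using ex
  have fUD : ∀ i, i ∈ U ∪ D → f i ∈ L ∪ R := fun i hi => by
    rw [Finset.mem_union] at hi ⊢
    rcases hi with hi | hi
    · exact (fU i hi).imp And.left And.left
    · exact (fD i hi).imp And.left And.left
  have fPQ : ∀ i, i ∈ P → f i ∈ Q := fun i hi => by
    obtain ⟨j, hj⟩ := (hP i).1 hi
    exact (hQ _).2 ⟨j, (fP i j hj).symm⟩
  have aux : ∀ i ∈ U, ∀ i' ∈ D, f i ≠ f i' := by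
    intro i hi i' hi' h
    have h1 := rank_lt_card hi
    have h2 := rank_lt_card hi'
    rcases fU i hi with ⟨a, b⟩ | ⟨a, b⟩ <;> rcases fD i' hi' with ⟨c, d⟩ | ⟨c, d⟩ <;>
      rw [h] at a b
    · omega
    · exact dL a c
    · exact dL c a
    · omega
  have inj : Function.Injective f := by
    intro i i' h
    rcases hUD.mem i with hi | hi | hi <;> rcases hUD.mem i' with hi' | hi' | hi'
    · rcases fU i hi with ⟨a, b⟩ | ⟨a, b⟩ <;> rcases fU i' hi' with ⟨c, d⟩ | ⟨c, d⟩ <;>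
        rw [h] at a b
      · exact rank_injOn hi hi' (by omega)
      · exact absurd c (dL a)
      · exact absurd a (dL c)
      · exact rank_injOn hi hi' (by omega)
    · exact absurd h (aux i hi i' hi')
    · exact absurd (h ▸ fPQ i' hi') (dQ (fUD i (Finset.mem_union_left _ hi)))
    · exact absurd h.symm (aux i' hi' i hi)
    · rcases fD i hi with ⟨a, b⟩ | ⟨a, b⟩ <;> rcases fD i' hi' with ⟨c, d⟩ | ⟨c, d⟩ <;>
        rw [h] at a b
      · exact rank_injOn hi hi' (by omega)
      · exact absurd c (dL a)
      · exact absurd a (dL c)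
      · exact rank_injOn hi hi' (by omega)
    · exact absurd (h ▸ fPQ i' hi') (dQ (fUD i (Finset.mem_union_right _ hi)))
    · exact absurd (h ▸ fPQ i hi) (dQ (fUD i' (Finset.mem_union_left _ hi')))
    · exact absurd (h ▸ fPQ i hi) (dQ (fUD i' (Finset.mem_union_right _ hi')))
    · obtain ⟨j, hj⟩ := (hP i).1 hi
      obtain ⟨j', hj'⟩ := (hP i').1 hi'
      rw [fP i j hj, fP i' j' hj'] at h
      rw [← hj, ← hj', hw₂ h]
  refine ⟨Equiv.ofBijective f (Finite.injective_iff_bijective.1 inj), ⟨fU, fD⟩, fun j => ?_⟩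
  exact fP _ j rfl

lemma Balanced.exists_before {N E i : ℕ} {s : Finset (Fin N)} (h : Balanced E s) (hi : i ≤ N)
    (hE : E + 2 ≤ i) : ∃ j ∈ s, (j : ℕ) < i ∧ i ≤ j + 2 * E + 2 := by
  have h1 := h i hi
  have h2 := h N le_rfl
  have h3 := rank_mono s hi
  rw [rank_eq_card] at h2 h3
  obtain ⟨j, hj, hr⟩ := exists_rank_eq s (r := rank s i - 1) (by omega)
  have h4 := h j j.2.le
  exact ⟨j, hj, lt_of_rank_lt (s := s) (by omega), by omega⟩

lemma Balanced.exists_after {N E i : ℕ} {s : Finset (Fin N)} (h : Balanced E s)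
    (hE : i + 2 * E + 4 ≤ N) : ∃ j ∈ s, i < (j : ℕ) ∧ (j : ℕ) ≤ i + 2 * E + 2 := by
  have h1 := h i (by omega)
  have h2 := h N le_rfl
  rw [rank_eq_card] at h2
  -- The element of rank `rank s i` could be `i` itself, so the next one is taken.
  obtain ⟨j, hj, hr⟩ := exists_rank_eq s (r := rank s i + 1) (by omega)
  have h4 := h j j.2.le
  exact ⟨j, hj, lt_of_rank_lt (s := s) (by omega), by omega⟩

/-- A balanced code whose permutation has the prescribed internal points. -/
structure CentralFits {N : ℕ} (E : ℕ) (U D P L R Q : Finset (Fin N)) (m n : ℕ)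
    (σ : Equiv.Perm (Fin N)) : Prop extends BalancedFits E U D L R m n σ where
  splitU : IsSplit U D P
  splitL : IsSplit L R Q
  mapsP : ∀ i ∈ P, σ i ∈ Q
  cardP : P.card ≤ E
  cardn : n + P.card = N
  cardQ : P.card = Q.card
  one_le : 1 ≤ E
  small : 200 * E ≤ N
  -- The window `2/9 ≤ m/N ≤ 2/7` around `1/4` keeps all four sides long compared with `E`.
  le_m : 8 * N ≤ 36 * m
  m_le : 28 * m ≤ 8 * N
  inner : ∀ i ∈ P, (i, σ i) ∈ innerRegion N m (20 * E)
  -- The extreme points at the corners may be records of two kinds, which makes the label ambiguous.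
  -- Fixing the labels at the ends removes the ambiguity and costs only a constant factor in the
  -- count.
  zero_pos : ∀ i : Fin N, (i : ℕ) = 0 → i ∈ D
  last_pos : ∀ i : Fin N, (i : ℕ) = N - 1 → i ∈ D
  zero_val : ∀ i : Fin N, (i : ℕ) = 0 → i ∈ L
  last_val : ∀ i : Fin N, (i : ℕ) = N - 1 → i ∈ L

/-! ### Reading a central code off its permutation -/

namespace CentralFits

variable {N E m n : ℕ} {U D P L R Q : Finset (Fin N)} {σ : Equiv.Perm (Fin N)}

/-- The type and the location of a point. -/
lemma cases (h : CentralFits E U D P L R Q m n σ) (j : Fin N) :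
    (j ∈ U ∧ σ j ∈ L ∧ rank L (σ j) = m + rank U j ∧
      (σ j : ℕ) ≤ j + 2 * m + 2 * E ∧ (j : ℕ) + 2 * m ≤ σ j + 2 * E) ∨
    (j ∈ U ∧ σ j ∈ R ∧ rank U j + rank R (σ j) + m + 1 = n ∧
      (j : ℕ) + σ j + 2 * m ≤ 2 * n + 2 * E ∧ 2 * n ≤ j + σ j + 2 * m + 2 + 2 * E) ∨
    (j ∈ D ∧ σ j ∈ L ∧ rank L (σ j) + rank D j + 1 = m ∧
      (σ j : ℕ) + j ≤ 2 * m + 2 * E ∧ 2 * m ≤ σ j + j + 2 + 2 * E) ∨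
    (j ∈ D ∧ σ j ∈ R ∧ rank D j = m + rank R (σ j) ∧
      (j : ℕ) ≤ 2 * m + σ j + 2 * E ∧ 2 * m + σ j ≤ j + 2 * E) ∨
    (j ∈ P ∧ (σ j : ℕ) + 20 * E ≤ j + 2 * m ∧ (j : ℕ) + 20 * E ≤ σ j + 2 * m ∧
      2 * m + 20 * E ≤ j + σ j ∧ (j : ℕ) + σ j + 2 * m + 20 * E ≤ 2 * N) := by
  rcases h.splitU.mem j with hj | hj | hj
  · have h1 := h.balU j j.2.le
    have h2 := h.balL (σ j) (σ j).2.le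
    have h3 := h.balR (σ j) (σ j).2.le
    rcases h.upper j hj with ⟨h4, h5⟩ | ⟨h4, h5⟩
    · left; refine ⟨hj, h4, h5, ?_, ?_⟩ <;> omega
    · right; left; refine ⟨hj, h4, h5, ?_, ?_⟩ <;> omega
  · have h1 := h.balD j j.2.le
    have h2 := h.balL (σ j) (σ j).2.le
    have h3 := h.balR (σ j) (σ j).2.le
    rcases h.lower j hj with ⟨h4, h5⟩ | ⟨h4, h5⟩
    · right; right; left; refine ⟨hj, h4, h5, ?_, ?_⟩ <;> omega
    · right; right; right; left; refine ⟨hj, h4, h5, ?_, ?_⟩ <;> omega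
  · right; right; right; right
    exact ⟨hj, mem_innerRegion.1 (h.inner j hj)⟩

/-- The numbers of labels. -/
lemma cards (h : CentralFits E U D P L R Q m n σ) :
    U.card + D.card = n ∧ L.card + R.card = n ∧ N ≤ 2 * U.card + E ∧ 2 * U.card ≤ N + E ∧
    N ≤ 2 * D.card + E ∧ 2 * D.card ≤ N + E ∧ N ≤ 2 * L.card + E ∧ 2 * L.card ≤ N + E ∧
    N ≤ 2 * R.card + E ∧ 2 * R.card ≤ N + E := by
  have h1 := h.splitU.card
  have h2 := h.splitL.card
  have h3 := h.cardn
  have h4 := h.cardQ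
  have b1 := h.balU N le_rfl
  have b2 := h.balD N le_rfl
  have b3 := h.balL N le_rfl
  have b4 := h.balR N le_rfl
  rw [rank_eq_card] at b1 b2 b3 b4
  refine ⟨?_, ?_, ?_, ?_, ?_, ?_, ?_, ?_, ?_, ?_⟩ <;> omega

/-- An earlier and higher point `j` is excluded by ranks if it shares the label `U` or `L` with `i`,
which covers the regions near the corners, and by location if it is internal or on the opposite
side. The other three record lemmas follow the same division. -/
lemma leftMax (h : CentralFits E U D P L R Q m n σ) {i : Fin N} (hU : i ∈ U) (hL : σ i ∈ L) :
    ∀ j, j < i → σ j < σ i := by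
  intro j hj
  by_contra hc
  have hc' : σ i < σ j := (not_lt.1 hc).lt_of_ne (σ.injective.ne hj.ne')
  rw [Fin.lt_def] at hc' hj
  have := h.cards
  have := h.one_le; have := h.small; have := h.le_m; have := h.m_le; have := h.cardP
  have := h.cardn
  have dU := Finset.disjoint_left.1 h.splitU.disjoint hU
  have dP := Finset.disjoint_left.1 h.splitU.disjoint_union (Finset.mem_union_left _ hU)
  have dL := Finset.disjoint_left.1 h.splitL.disjoint hL
  have r1 := rank_mono U hj.le
  have r3 := rank_lt_rank hL hc'
  have r4 := rank_lt_card hL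
  rcases h.cases i with hi | hi | hi | hi | hi
  · rcases h.cases j with hj' | hj' | hj' | hj' | hj'
    · have := rank_lt_rank hj'.1 hj; omega
    · have := rank_lt_card hj'.2.1; omega
    · omega
    · omega
    · omega
  · exact dL hi.2.1
  · exact dU hi.1
  · exact dU hi.1
  · exact dP hi.1

lemma rightMax (h : CentralFits E U D P L R Q m n σ) {i : Fin N} (hU : i ∈ U) (hR : σ i ∈ R) :
    ∀ j, i < j → σ j < σ i := by
  intro j hj
  by_contra hc
  have hc' : σ i < σ j := (not_lt.1 hc).lt_of_ne (σ.injective.ne hj.ne)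
  rw [Fin.lt_def] at hc' hj
  have := h.cards
  have := h.one_le; have := h.small; have := h.le_m; have := h.m_le; have := h.cardP
  have := h.cardn
  have dU := Finset.disjoint_left.1 h.splitU.disjoint hU
  have dP := Finset.disjoint_left.1 h.splitU.disjoint_union (Finset.mem_union_left _ hU)
  have dL : σ i ∉ L := fun h' => Finset.disjoint_left.1 h.splitL.disjoint h' hR
  have r1 := rank_lt_rank hU hj
  have r3 := rank_lt_rank hR hc'
  have r4 := rank_lt_card hR
  have r5 := rank_lt_card hU
  rcases h.cases i with hi | hi | hi | hi | hi
  · exact dL hi.2.1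
  · rcases h.cases j with hj' | hj' | hj' | hj' | hj'
    · have := rank_lt_card hj'.2.1; omega
    · omega
    · omega
    · have := rank_lt_card hj'.1; omega
    · omega
  · exact dU hi.1
  · exact dU hi.1
  · exact dP hi.1

lemma leftMin (h : CentralFits E U D P L R Q m n σ) {i : Fin N} (hD : i ∈ D) (hL : σ i ∈ L) :
    ∀ j, j < i → σ i < σ j := by
  intro j hj
  by_contra hc
  have hc' : σ j < σ i := (not_lt.1 hc).lt_of_ne (σ.injective.ne hj.ne)
  rw [Fin.lt_def] at hc' hj
  have := h.cards
  have := h.one_le; have := h.small; have := h.le_m; have := h.m_le; have := h.cardP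
  have := h.cardn
  have dU : i ∉ U := fun h' => Finset.disjoint_left.1 h.splitU.disjoint h' hD
  have dP := Finset.disjoint_left.1 h.splitU.disjoint_union (Finset.mem_union_right _ hD)
  have dL := Finset.disjoint_left.1 h.splitL.disjoint hL
  have r1 := rank_mono D hj.le
  have r4 := rank_lt_card hL
  rcases h.cases i with hi | hi | hi | hi | hi
  · exact dU hi.1
  · exact dU hi.1
  · rcases h.cases j with hj' | hj' | hj' | hj' | hj'
    · have := rank_lt_rank hj'.2.1 hc'; omega
    · omega
    · have := rank_lt_rank hj'.2.1 hc'; omega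
    · omega
    · omega
  · exact dL hi.2.1
  · exact dP hi.1

lemma rightMin (h : CentralFits E U D P L R Q m n σ) {i : Fin N} (hD : i ∈ D) (hR : σ i ∈ R) :
    ∀ j, i < j → σ i < σ j := by
  intro j hj
  by_contra hc
  have hc' : σ j < σ i := (not_lt.1 hc).lt_of_ne (σ.injective.ne hj.ne')
  rw [Fin.lt_def] at hc' hj
  have := h.cards
  have := h.one_le; have := h.small; have := h.le_m; have := h.m_le; have := h.cardP
  have := h.cardn
  have dU : i ∉ U := fun h' => Finset.disjoint_left.1 h.splitU.disjoint h' hD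
  have dP := Finset.disjoint_left.1 h.splitU.disjoint_union (Finset.mem_union_right _ hD)
  have dL : σ i ∉ L := fun h' => Finset.disjoint_left.1 h.splitL.disjoint h' hR
  have r1 := rank_lt_rank hD hj
  have r4 := rank_lt_card hD
  rcases h.cases i with hi | hi | hi | hi | hi
  · exact dU hi.1
  · exact dU hi.1
  · exact dL hi.2.1
  · rcases h.cases j with hj' | hj' | hj' | hj' | hj'
    · omega
    · have := rank_lt_rank hj'.2.1 hc'; have := rank_lt_card hj'.1; omega
    · omega
    · have := rank_lt_rank hj'.2.1 hc'; omega
    · omega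
  · exact dP hi.1

/-- A point of the lower left side, far from its ends. -/
lemma exists_mid_lower_left (h : CentralFits E U D P L R Q m n σ) :
    ∃ i : Fin N, (i : ℕ) ≤ m + E ∧ (σ i : ℕ) ≤ m + 4 * E := by
  have := h.cards
  have := h.one_le; have := h.small; have := h.le_m; have := h.m_le
  obtain ⟨i, hi, hr⟩ := exists_rank_eq D (r := m / 2) (by omega)
  have h1 := h.balD i i.2.le
  have h2 := h.near_lower hi
  have dU : i ∉ U := fun h' => Finset.disjoint_left.1 h.splitU.disjoint h' hi
  rcases h.lower i hi with ⟨h4, h5⟩ | ⟨h4, h5⟩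
  · have h3 := h.balL (σ i) (σ i).2.le
    exact ⟨i, by omega, by omega⟩
  · omega

/-- A point of the upper left side, far from its ends. -/
lemma exists_mid_upper_left (h : CentralFits E U D P L R Q m n σ) :
    ∃ i : Fin N, (i : ℕ) ≤ m + E ∧ 3 * m ≤ (σ i : ℕ) + 4 * E := by
  have := h.cards
  have := h.one_le; have := h.small; have := h.le_m; have := h.m_le
  obtain ⟨i, hi, hr⟩ := exists_rank_eq U (r := m / 2) (by omega)
  have h1 := h.balU i i.2.le
  rcases h.upper i hi with ⟨h4, h5⟩ | ⟨h4, h5⟩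
  · have h3 := h.balL (σ i) (σ i).2.le
    exact ⟨i, by omega, by omega⟩
  · have h3 := rank_lt_card h4
    omega

/-- A point of the lower right side, far from its ends. -/
lemma exists_mid_lower_right (h : CentralFits E U D P L R Q m n σ) :
    ∃ i : Fin N, 3 * m ≤ (i : ℕ) + 4 * E ∧ (σ i : ℕ) ≤ m + 4 * E := by
  have := h.cards
  have := h.one_le; have := h.small; have := h.le_m; have := h.m_le
  obtain ⟨i, hi, hr⟩ := exists_rank_eq D (r := m + m / 2) (by omega)
  have h1 := h.balD i i.2.le
  rcases h.lower i hi with ⟨h4, h5⟩ | ⟨h4, h5⟩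
  · omega
  · have h3 := h.balR (σ i) (σ i).2.le
    exact ⟨i, by omega, by omega⟩

/-- Near the left corner the location estimates do not separate the upper chain from the lower one.
There the witness is the point at position `0`: labelled D, it has `L`-rank `m - 1`, below every
value of the upper left chain. On the upper right side a point in the middle of the lower left side
serves. -/
lemma not_leftMin_of_mem_U (h : CentralFits E U D P L R Q m n σ) {i : Fin N} (hU : i ∈ U) :
    ∃ j, j < i ∧ σ j < σ i := by
  have := h.cards
  have := h.one_le; have := h.small; have := h.le_m; have := h.m_le; have := h.cardP
  have := h.cardn
  have dU := Finset.disjoint_left.1 h.splitU.disjoint hU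
  have dP := Finset.disjoint_left.1 h.splitU.disjoint_union (Finset.mem_union_left _ hU)
  rcases h.cases i with hi | hi | hi | hi | hi
  · have hz := h.zero_pos ⟨0, by omega⟩ rfl
    have hr : rank D ((⟨0, by omega⟩ : Fin N) : ℕ) = 0 := by simp [rank]
    refine ⟨⟨0, by omega⟩, ?_, ?_⟩
    · rw [Fin.lt_def]
      refine Nat.pos_of_ne_zero fun h0 => dU ?_
      exact h.zero_pos i h0
    · rcases h.lower _ hz with ⟨h4, h5⟩ | ⟨h4, h5⟩
      · exact lt_of_rank_lt (s := L) (by omega)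
      · omega
  · obtain ⟨j, hj, hj'⟩ := h.exists_mid_lower_left
    refine ⟨j, ?_, ?_⟩ <;> rw [Fin.lt_def] <;> omega
  · exact absurd hi.1 dU
  · exact absurd hi.1 dU
  · exact absurd hi.1 dP

/-- For the upper right chain the witness is the point at the last position, labelled D; its
`R`-rank is below those of that chain. -/
lemma not_rightMin_of_mem_U (h : CentralFits E U D P L R Q m n σ) {i : Fin N} (hU : i ∈ U) :
    ∃ j, i < j ∧ σ j < σ i := by
  have := h.cards
  have := h.one_le; have := h.small; have := h.le_m; have := h.m_le; have := h.cardP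
  have := h.cardn
  have dU := Finset.disjoint_left.1 h.splitU.disjoint hU
  have dP := Finset.disjoint_left.1 h.splitU.disjoint_union (Finset.mem_union_left _ hU)
  rcases h.cases i with hi | hi | hi | hi | hi
  · obtain ⟨j, hj, hj'⟩ := h.exists_mid_lower_right
    refine ⟨j, ?_, ?_⟩ <;> rw [Fin.lt_def] <;> omega
  · have hz := h.last_pos ⟨N - 1, by omega⟩ rfl
    have hb := h.balD (N - 1) (by omega)
    have hl : rank D ((⟨N - 1, by omega⟩ : Fin N) : ℕ) < D.card := rank_lt_card hz
    have hU' := rank_lt_card hU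
    refine ⟨⟨N - 1, by omega⟩, ?_, ?_⟩
    · rw [Fin.lt_def]
      have : (i : ℕ) ≠ N - 1 := fun h0 => dU (h.last_pos i h0)
      simp only
      omega
    · rcases h.lower _ hz with ⟨h4, h5⟩ | ⟨h4, h5⟩
      · simp only at h5; omega
      · exact lt_of_rank_lt (s := R) (by omega)
  · exact absurd hi.1 dU
  · exact absurd hi.1 dU
  · exact absurd hi.1 dP

/-- For the upper right chain the witness is the point of highest value, labelled L: it belongs to
the upper left chain, and comparing `U`-ranks puts it earlier. -/
lemma not_leftMax_of_mem_R (h : CentralFits E U D P L R Q m n σ) {i : Fin N} (hR : σ i ∈ R) :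
    ∃ j, j < i ∧ σ i < σ j := by
  have := h.cards
  have := h.one_le; have := h.small; have := h.le_m; have := h.m_le; have := h.cardP
  have := h.cardn
  have dL : σ i ∉ L := fun h' => Finset.disjoint_left.1 h.splitL.disjoint h' hR
  have dQ := Finset.disjoint_left.1 h.splitL.disjoint_union (Finset.mem_union_right _ hR)
  rcases h.cases i with hi | hi | hi | hi | hi
  · exact absurd hi.2.1 dL
  · have hv := h.last_val ⟨N - 1, by omega⟩ rfl
    have hb := h.balL (N - 1) (by omega)
    obtain ⟨t, ht⟩ := σ.surjective ⟨N - 1, by omega⟩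
    rw [← ht] at hv
    have htv : (σ t : ℕ) = N - 1 := by rw [ht]
    have hl := rank_lt_card hv
    have hl' := rank_lt_card hR
    rw [← htv] at hb
    have dR : σ t ∉ R := fun h' => Finset.disjoint_left.1 h.splitL.disjoint hv h'
    refine ⟨t, ?_, ?_⟩
    · rcases h.cases t with ht' | ht' | ht' | ht' | ht'
      · exact lt_of_rank_lt (s := U) (by omega)
      · exact absurd ht'.2.1 dR
      · omega
      · exact absurd ht'.2.1 dR
      · exact absurd (h.mapsP t ht'.1)
          (Finset.disjoint_left.1 h.splitL.disjoint_union (Finset.mem_union_left _ hv))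
    · rw [Fin.lt_def]
      have : (σ i : ℕ) ≠ N - 1 := fun h0 => dL (h.last_val _ h0)
      omega
  · exact absurd hi.2.1 dL
  · obtain ⟨j, hj, hj'⟩ := h.exists_mid_upper_left
    refine ⟨j, ?_, ?_⟩ <;> rw [Fin.lt_def] <;> omega
  · exact absurd (h.mapsP i hi.1) dQ

lemma not_leftMin_of_mem_R (h : CentralFits E U D P L R Q m n σ) {i : Fin N} (hR : σ i ∈ R) :
    ∃ j, j < i ∧ σ j < σ i := by
  have := h.cards
  have := h.one_le; have := h.small; have := h.le_m; have := h.m_le; have := h.cardP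
  have := h.cardn
  have dL : σ i ∉ L := fun h' => Finset.disjoint_left.1 h.splitL.disjoint h' hR
  have dQ := Finset.disjoint_left.1 h.splitL.disjoint_union (Finset.mem_union_right _ hR)
  rcases h.cases i with hi | hi | hi | hi | hi
  · exact absurd hi.2.1 dL
  · exact h.not_leftMin_of_mem_U hi.1
  · exact absurd hi.2.1 dL
  · have hv := h.zero_val ⟨0, by omega⟩ rfl
    obtain ⟨t, ht⟩ := σ.surjective ⟨0, by omega⟩
    rw [← ht] at hv
    have htv : (σ t : ℕ) = 0 := by rw [ht]
    have hr : rank L (σ t) = 0 := by simp [htv, rank]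
    have dR : σ t ∉ R := fun h' => Finset.disjoint_left.1 h.splitL.disjoint hv h'
    refine ⟨t, ?_, ?_⟩
    · rcases h.cases t with ht' | ht' | ht' | ht' | ht'
      · omega
      · exact absurd ht'.2.1 dR
      · exact lt_of_rank_lt (s := D) (by omega)
      · exact absurd ht'.2.1 dR
      · exact absurd (h.mapsP t ht'.1)
          (Finset.disjoint_left.1 h.splitL.disjoint_union (Finset.mem_union_left _ hv))
    · rw [Fin.lt_def]
      have : (σ i : ℕ) ≠ 0 := fun h0 => dL (h.zero_val _ h0)
      omega
  · exact absurd (h.mapsP i hi.1) dQ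

lemma isExternal (h : CentralFits E U D P L R Q m n σ) {i : Fin N} (hi : i ∉ P) :
    IsExternal σ i := by
  rcases h.splitU.mem i with hj | hj | hj
  · rcases h.upper i hj with ⟨h4, -⟩ | ⟨h4, -⟩
    · exact Or.inl (h.leftMax hj h4)
    · exact Or.inr (Or.inr (Or.inl (h.rightMax hj h4)))
  · rcases h.lower i hj with ⟨h4, -⟩ | ⟨h4, -⟩
    · exact Or.inr (Or.inl (h.leftMin hj h4))
    · exact Or.inr (Or.inr (Or.inr (h.rightMin hj h4)))
  · exact absurd hj hi

/-- Balance provides points of `U` and of `D` within `2 * E + 2` positions on either side of `i`.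
They lie within `O(E)` of the sides, and the margin `20 * E` of the inner region puts them above and
below `i` respectively. -/
lemma isInternal (h : CentralFits E U D P L R Q m n σ) {i : Fin N} (hi : i ∈ P) :
    IsInternal σ i := by
  have h1 := h.one_le
  have h2 := h.small
  have h3 := h.cardP
  have h4 := h.cardn
  have h5 := i.2
  have h6 := (σ i).2
  have hin := mem_innerRegion.1 (h.inner i hi)
  simp only at hin
  simp only [IsInternal, IsExternal, not_or, not_forall, not_lt, Fin.le_def]
  refine ⟨?_, ?_, ?_, ?_⟩
  · obtain ⟨j, hj, hj1, hj2⟩ := h.balU.exists_before h5.le (by omega)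
    refine ⟨j, hj1, ?_⟩
    rcases h.near_upper hj with h | h <;> omega
  · obtain ⟨j, hj, hj1, hj2⟩ := h.balD.exists_before h5.le (by omega)
    refine ⟨j, hj1, ?_⟩
    rcases h.near_lower hj with h | h <;> omega
  · obtain ⟨j, hj, hj1, hj2⟩ := h.balU.exists_after (i := i) (by omega)
    refine ⟨j, hj1, ?_⟩
    rcases h.near_upper hj with h | h <;> omega
  · obtain ⟨j, hj, hj1, hj2⟩ := h.balD.exists_after (i := i) (by omega)
    refine ⟨j, hj1, ?_⟩
    rcases h.near_lower hj with h | h <;> omega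

lemma internals_eq (h : CentralFits E U D P L R Q m n σ) : internals σ = P := by
  ext i
  rw [mem_internals]
  exact ⟨fun hi => by_contra fun hc => hi (h.isExternal hc), h.isInternal⟩

/-- The labels of the positions can be read off from the permutation. -/
lemma mem_U_iff (h : CentralFits E U D P L R Q m n σ) (i : Fin N) :
    i ∈ U ↔ i ∉ internals σ ∧ (∃ j, j < i ∧ σ j < σ i) ∧ ∃ j, i < j ∧ σ j < σ i := by
  rw [h.internals_eq]
  constructor
  · intro hi
    exact ⟨Finset.disjoint_left.1 h.splitU.disjoint_union (Finset.mem_union_left _ hi),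
      h.not_leftMin_of_mem_U hi, h.not_rightMin_of_mem_U hi⟩
  · rintro ⟨h1, ⟨a, ha, ha'⟩, ⟨b, hb, hb'⟩⟩
    rcases h.splitU.mem i with hj | hj | hj
    · exact hj
    · rcases h.lower i hj with ⟨h4, -⟩ | ⟨h4, -⟩
      · exact absurd (h.leftMin hj h4 a ha) ha'.not_gt
      · exact absurd (h.rightMin hj h4 b hb) hb'.not_gt
    · exact absurd hj h1

/-- The labels of the values can be read off from the permutation. -/
lemma mem_R_iff (h : CentralFits E U D P L R Q m n σ) (i : Fin N) :
    σ i ∈ R ↔ i ∉ internals σ ∧ (∃ j, j < i ∧ σ j < σ i) ∧ ∃ j, j < i ∧ σ i < σ j := by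
  rw [h.internals_eq]
  constructor
  · intro hi
    refine ⟨fun hc => ?_, h.not_leftMin_of_mem_R hi, h.not_leftMax_of_mem_R hi⟩
    exact Finset.disjoint_left.1 h.splitL.disjoint_union (Finset.mem_union_right _ hi)
      (h.mapsP i hc)
  · rintro ⟨h1, ⟨a, ha, ha'⟩, ⟨b, hb, hb'⟩⟩
    rcases h.splitU.mem i with hj | hj | hj
    · rcases h.upper i hj with ⟨h4, -⟩ | ⟨h4, -⟩
      · exact absurd (h.leftMax hj h4 b hb) hb'.not_gt
      · exact h4
    · rcases h.lower i hj with ⟨h4, -⟩ | ⟨h4, -⟩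
      · exact absurd (h.leftMin hj h4 a ha) ha'.not_gt
      · exact h4
    · exact absurd hj h1

/-- The code can be read off from the permutation. -/
lemma unique {U' D' P' L' R' Q' : Finset (Fin N)} {m' : ℕ} (h : CentralFits E U D P L R Q m n σ)
    (h' : CentralFits E U' D' P' L' R' Q' m' n σ) (hQ : Q = Q') : m = m' ∧ U = U' ∧ R = R' := by
  have hU : U = U' := by ext i; rw [h.mem_U_iff, h'.mem_U_iff]
  have hR : R = R' := by
    ext v
    obtain ⟨i, rfl⟩ := σ.surjective v
    rw [h.mem_R_iff, h'.mem_R_iff]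
  have hP : P = P' := h.internals_eq.symm.trans h'.internals_eq
  have hL : L = L' := by rw [h.splitL.symm.eq_compl, h'.splitL.symm.eq_compl, hR, hQ]
  refine ⟨?_, hU, hR⟩
  have := h.one_le; have := h.small; have := h.le_m; have := h'.le_m
  have hr : ∀ s : Finset (Fin N), rank s ((⟨0, by omega⟩ : Fin N) : ℕ) = 0 := by simp [rank]
  -- Position `0` has `D`-rank `0`, so its value has `L`-rank `m - 1`; this recovers `m`.
  have h1 := h.lower _ (h.zero_pos ⟨0, by omega⟩ rfl)
  have h2 := h'.lower _ (h'.zero_pos ⟨0, by omega⟩ rfl)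
  rw [hr] at h1 h2
  rw [← hL] at h2
  omega

end CentralFits

/-! ### The sizes of the regions -/

/-- In the coordinates `b - a` and `⌊(a + b) / 2⌋` the tilted rectangle becomes upright. The map is
injective because `a + b` has the parity of `b - a`. -/
lemma card_outerRegion_le (N m c : ℕ) :
    (outerRegion N m (2 * c)).card ≤ (4 * m + 4 * c + 1) * (N + 2 * c + 1 - 2 * m) := by
  let f : Fin N × Fin N → ℤ × ℤ := fun a =>
    ((a.2 : ℤ) - (a.1 : ℤ), ((a.1 : ℤ) + (a.2 : ℤ)) / 2)
  calc _ ≤ (Finset.Icc (-(2 * m + 2 * c : ℤ)) (2 * m + 2 * c) ×ˢ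
        Finset.Icc (m - c : ℤ) (N - m + c)).card := by
        refine Finset.card_le_card_of_injOn f ?_ ?_
        · intro a ha
          rw [Finset.mem_coe, mem_outerRegion] at ha
          simp only [f, Finset.coe_product, Finset.coe_Icc, Set.mem_prod, Set.mem_Icc]
          omega
        · rintro ⟨a, b⟩ - ⟨a', b'⟩ - h
          simp only [f, Prod.mk.injEq] at h
          ext <;> simp only <;> omega
    _ ≤ _ := by
        rw [Finset.card_product, Int.card_Icc, Int.card_Icc]
        apply Nat.mul_le_mul <;> omega

/-- The same change of coordinates, read backwards: every integer point of a slightly smaller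
upright rectangle has a preimage in the grid. -/
lemma le_card_innerRegion {N m c : ℕ} (hc : 1 ≤ c) (hm : c ≤ m) :
    (4 * m + 1 - 4 * c) * (N - 2 * m - 2 * c) ≤ (innerRegion N m (2 * c)).card := by
  classical
  let f : Fin N × Fin N → ℤ × ℤ := fun a =>
    ((a.2 : ℤ) - (a.1 : ℤ), ((a.1 : ℤ) + (a.2 : ℤ)) / 2)
  calc _ ≤ (Finset.Icc (-(2 * m - 2 * c : ℤ)) (2 * m - 2 * c) ×ˢ
        Finset.Icc (m + c : ℤ) (N - m - c - 1)).card := by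
        rw [Finset.card_product, Int.card_Icc, Int.card_Icc]
        apply Nat.mul_le_mul <;> omega
    _ ≤ ((innerRegion N m (2 * c)).image f).card := by
        refine Finset.card_le_card ?_
        rintro ⟨u, b⟩ h
        simp only [Finset.mem_product, Finset.mem_Icc] at h
        rw [Finset.mem_image]
        refine ⟨(⟨(b - u / 2).toNat, by omega⟩, ⟨(b + u - u / 2).toNat, by omega⟩), ?_, ?_⟩
        · rw [mem_innerRegion]
          simp only
          omega
        · simp only [f, Prod.mk.injEq]
          omega
    _ ≤ _ := Finset.card_image_le

/-! ### Counting permutations through their codes -/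

/-- The possible codes: a number `m`, the internal points `w`, and two sets of labels. -/
abbrev CodeType (N k : ℕ) : Type :=
  Σ _ : ℕ, Σ _ : Fin k → Fin N × Fin N, Finset (Fin N) × Finset (Fin N)

/-- The codes with `m` in `M`, internal points in `A m` and labels in `Z w`. -/
def codes {N : ℕ} (M : Finset ℕ) (A : ℕ → Finset (Fin N × Fin N)) (k : ℕ)
    (Z : (Fin k → Fin N × Fin N) → Finset (Finset (Fin N) × Finset (Fin N))) :
    Finset (CodeType N k) :=
  M.sigma fun m => (goodTuples (A m) k).sigma Z

lemma mem_codes {N k : ℕ} {M : Finset ℕ} {A : ℕ → Finset (Fin N × Fin N)}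
    {Z : (Fin k → Fin N × Fin N) → Finset (Finset (Fin N) × Finset (Fin N))} {x : CodeType N k} :
    x ∈ codes M A k Z ↔ x.1 ∈ M ∧ x.2.1 ∈ goodTuples (A x.1) k ∧ x.2.2 ∈ Z x.2.1 := by
  simp [codes]

lemma card_goodTuples_le {N : ℕ} (A : Finset (Fin N × Fin N)) (k : ℕ) :
    (goodTuples A k).card ≤ A.card ^ k := by
  refine (Finset.card_filter_le _ _).trans ?_
  simp

lemma card_codes_le {N k : ℕ} {M : Finset ℕ} {A : ℕ → Finset (Fin N × Fin N)}
    {Z : (Fin k → Fin N × Fin N) → Finset (Finset (Fin N) × Finset (Fin N))} {B z : ℕ}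
    (hA : ∀ m ∈ M, (A m).card ≤ B)
    (hZ : ∀ m ∈ M, ∀ w ∈ goodTuples (A m) k, (Z w).card ≤ z) :
    (codes M A k Z).card ≤ M.card * (B ^ k * z) := by
  rw [codes, Finset.card_sigma, ← smul_eq_mul, ← Finset.sum_const]
  refine Finset.sum_le_sum fun m hm => ?_
  rw [Finset.card_sigma]
  calc _ ≤ ∑ _w ∈ goodTuples (A m) k, z := Finset.sum_le_sum fun w hw => hZ m hm w hw
    _ = (goodTuples (A m) k).card * z := by rw [Finset.sum_const, smul_eq_mul]
    _ ≤ _ := Nat.mul_le_mul_right _ ((card_goodTuples_le _ _).trans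
        (Nat.pow_le_pow_left (hA m hm) k))

lemma le_card_codes {N k : ℕ} {M : Finset ℕ} {A : ℕ → Finset (Fin N × Fin N)}
    {Z : (Fin k → Fin N × Fin N) → Finset (Finset (Fin N) × Finset (Fin N))} {B z : ℕ}
    (hA : ∀ m ∈ M, B ≤ (A m).card)
    (hZ : ∀ m ∈ M, ∀ w ∈ goodTuples (A m) k, z ≤ (Z w).card) :
    M.card * ((B - 2 * k * N) ^ k * z) ≤ (codes M A k Z).card := by
  rw [codes, Finset.card_sigma, ← smul_eq_mul, ← Finset.sum_const]
  refine Finset.sum_le_sum fun m hm => ?_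
  rw [Finset.card_sigma]
  calc _ ≤ (goodTuples (A m) k).card * z := Nat.mul_le_mul_right _
        ((Nat.pow_le_pow_left (Nat.sub_le_sub_right (hA m hm) _) k).trans
          (pow_le_card_goodTuples _ _))
    _ = ∑ _w ∈ goodTuples (A m) k, z := by rw [Finset.sum_const, smul_eq_mul]
    _ ≤ _ := Finset.sum_le_sum fun w hw => hZ m hm w hw

open Classical in
/-- The permutations of `S` with an ordering of their internal points. -/
def orderedPerms {N : ℕ} (S : Finset (Equiv.Perm (Fin N))) (k : ℕ) :
    Finset (Σ _ : Equiv.Perm (Fin N), Fin k → Fin N) :=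
  S.sigma fun σ => (Finset.univ : Finset (Fin k → Fin N)).filter fun p =>
      Function.Injective p ∧ Finset.univ.image p = internals σ

lemma mem_orderedPerms {N k : ℕ} {S : Finset (Equiv.Perm (Fin N))}
    {x : Σ _ : Equiv.Perm (Fin N), Fin k → Fin N} : x ∈ orderedPerms S k ↔
      x.1 ∈ S ∧ Function.Injective x.2 ∧ Finset.univ.image x.2 = internals x.1 := by
  simp [orderedPerms]

lemma card_orderedPerms {N k : ℕ} {S : Finset (Equiv.Perm (Fin N))}
    (hS : ∀ σ ∈ S, (internals σ).card = k) :
    (orderedPerms S k).card = S.card * k.factorial := by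
  classical
  rw [orderedPerms, Finset.card_sigma, ← smul_eq_mul, ← Finset.sum_const]
  exact Finset.sum_congr rfl fun σ hσ => card_orderings _ (hS σ hσ)

/-- If all the codes of the permutations of `S` belong to `T`, then `S` is small. -/
lemma card_mul_factorial_le {N n k : ℕ} (hn : n + k = N) {S : Finset (Equiv.Perm (Fin N))}
    {T : Finset (CodeType N k)} (hS : ∀ σ ∈ S, (internals σ).card = k)
    (h : ∀ σ ∈ S, ∃ (U D L R : Finset (Fin N)) (m : ℕ), IsSplit U D (internals σ) ∧
      IsSplit L R ((internals σ).image σ) ∧ Fits U D L R m n σ ∧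
      ∀ p : Fin k → Fin N, Function.Injective p → Finset.univ.image p = internals σ →
        (⟨m, fun j => (p j, σ (p j)), U, R⟩ : CodeType N k) ∈ T) :
    S.card * k.factorial ≤ T.card := by
  -- One code is selected for each permutation, so other codes of the same permutation do no harm.
  choose! U D L R m hU hL hF hT using h
  rw [← card_orderedPerms hS]
  refine Finset.card_le_card_of_injOn
    (fun x => ⟨m x.1, fun j => (x.2 j, x.1 (x.2 j)), U x.1, R x.1⟩) ?_ ?_
  · rintro ⟨σ, p⟩ hx
    obtain ⟨h1, h2, h3⟩ := mem_orderedPerms.1 hx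
    exact hT σ h1 p h2 h3
  · rintro ⟨σ, p⟩ hx ⟨σ', p'⟩ hx' heq
    obtain ⟨h1, h2, h3⟩ := mem_orderedPerms.1 hx
    obtain ⟨h1', h2', h3'⟩ := mem_orderedPerms.1 hx'
    simp only [Sigma.mk.injEq, heq_eq_eq, Prod.mk.injEq] at heq h1 h2 h3 h1' h2' h3'
    obtain ⟨e1, e2, e3, e4⟩ := heq
    have e5 : ∀ j, p j = p' j ∧ σ (p j) = σ' (p' j) := fun j => by
      simpa using congrFun e2 j
    have e6 : p = p' := funext fun j => (e5 j).1
    subst e6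
    have hI : internals σ = internals σ' := h3.symm.trans h3'
    have hσP : ∀ i ∈ internals σ, σ i = σ' i := by
      intro i hi
      rw [← h3, Finset.mem_image] at hi
      obtain ⟨j, -, rfl⟩ := hi
      exact (e5 j).2
    have hQ : (internals σ).image σ = (internals σ').image σ' := by
      rw [← hI]; exact Finset.image_congr fun i hi => hσP i hi
    -- `D` and `L` are not part of the code: they are the complements of `U` and `R` outside the
    -- internal positions and values.
    have eD : D σ = D σ' := by
      rw [(hU σ h1).eq_compl, (hU σ' h1').eq_compl, hI, e3]
    have eL : L σ = L σ' := by
      rw [(hL σ h1).symm.eq_compl, (hL σ' h1').symm.eq_compl, hQ, e4]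
    have hF' := hF σ' h1'
    rw [← e1, ← e3, ← e4, ← eD, ← eL] at hF'
    have : σ = σ' := (hF σ h1).eq_of_eqOn hF' (hU σ h1) (hL σ h1)
      (by rw [Finset.card_image_of_injective _ σ.injective, hS σ h1, hn]) hσP
    rw [this]

lemma card_powerset_compl_image {N n k : ℕ} (hn : n + k = N) {p : Fin k → Fin N}
    (hp : Function.Injective p) : ((Finset.univ.image p)ᶜ).powerset.card = 2 ^ n := by
  rw [Finset.card_powerset, Finset.card_compl, Finset.card_image_of_injective _ hp]
  simp only [Fintype.card_fin, Finset.card_univ]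
  congr 1; omega

/-- The permutations with a balanced code have few choices. -/
lemma card_balanced_le {N n k E B : ℕ} (hn : n + k = N) {S : Finset (Equiv.Perm (Fin N))}
    (hS : ∀ σ ∈ S, (internals σ).card = k) {M : Finset ℕ}
    (h : ∀ σ ∈ S, ∃ (U D L R : Finset (Fin N)) (m : ℕ), IsSplit U D (internals σ) ∧
      IsSplit L R ((internals σ).image σ) ∧ m ≤ D.card ∧ m ∈ M ∧ BalancedFits E U D L R m n σ)
    (hB : ∀ m ∈ M, (outerRegion N m (4 * E + 2 * k + 2)).card ≤ B) :
    S.card * k.factorial ≤ M.card * (B ^ k * (2 ^ n * 2 ^ n)) := by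
  classical
  refine (card_mul_factorial_le hn hS (T := codes M
    (fun m => outerRegion N m (4 * E + 2 * k + 2)) k (fun w =>
      ((Finset.univ.image fun j => (w j).1)ᶜ).powerset ×ˢ
        ((Finset.univ.image fun j => (w j).2)ᶜ).powerset)) ?_).trans
    (card_codes_le hB fun m _ w hw => ?_)
  · intro σ hσ
    obtain ⟨U, D, L, R, m, hU, hL, hm, hM, hF⟩ := h σ hσ
    refine ⟨U, D, L, R, m, hU, hL, hF.toFits, fun p hp hp' => ?_⟩
    rw [mem_codes]
    refine ⟨hM, mem_goodTuples.2 ⟨fun j => hF.mem_outerRegion hU hm hn (p j), hp,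
      σ.injective.comp hp⟩, ?_⟩
    have e : (Finset.univ.image fun j => σ (p j)) = (internals σ).image σ := by
      rw [← hp', Finset.image_image]; rfl
    simp only [Finset.mem_product, Finset.mem_powerset]
    rw [e, hp']
    constructor
    · rw [Finset.subset_compl_iff_disjoint_right]
      exact hU.disjoint_union.mono_left Finset.subset_union_left
    · rw [Finset.subset_compl_iff_disjoint_right]
      exact hL.disjoint_union.mono_left Finset.subset_union_right
  · obtain ⟨-, h1, h2⟩ := mem_goodTuples.1 hw
    rw [Finset.card_product, card_powerset_compl_image hn h1, card_powerset_compl_image hn h2]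

open Classical in
/-- The number of sets that are not balanced. -/
def numNotBalanced (N E : ℕ) : ℕ :=
  ((Finset.univ : Finset (Finset (Fin N))).filter fun s => ¬ Balanced E s).card

/-- The permutations with a code that is not balanced have few choices. -/
lemma card_not_balanced_code_le {N n k E : ℕ} (hn : n + k = N) {S : Finset (Equiv.Perm (Fin N))}
    (hS : ∀ σ ∈ S, (internals σ).card = k)
    (h : ∀ σ ∈ S, ∃ (U D L R : Finset (Fin N)) (m : ℕ), IsSplit U D (internals σ) ∧
      IsSplit L R ((internals σ).image σ) ∧ m ≤ n ∧ Fits U D L R m n σ ∧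
      (¬ Balanced E U ∨ ¬ Balanced E R)) :
    S.card * k.factorial ≤ (n + 1) * ((N * N) ^ k * (2 * (numNotBalanced N E * 2 ^ n))) := by
  classical
  set bad := (Finset.univ : Finset (Finset (Fin N))).filter fun s => ¬ Balanced E s with hbad
  have hcard : bad.card = numNotBalanced N E := by rw [numNotBalanced]
  have hn1 : n + 1 = (Finset.range (n + 1)).card := by simp
  rw [hn1]
  refine (card_mul_factorial_le hn hS (T := codes (Finset.range (n + 1))
    (fun m => Finset.univ) k (fun w =>
      -- Only the balanced-or-not alternative is kept for the bad set, which need not avoid the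
      -- internal points; the other set still has `2 ^ n` choices. The loss is a factor `2 ^ k`,
      -- absorbed later.
      (bad ×ˢ ((Finset.univ.image fun j => (w j).2)ᶜ).powerset) ∪
        (((Finset.univ.image fun j => (w j).1)ᶜ).powerset ×ˢ bad))) ?_).trans
    (card_codes_le (fun m _ => by simp) fun m _ w hw => ?_)
  · intro σ hσ
    obtain ⟨U, D, L, R, m, hU, hL, hm, hF, hb⟩ := h σ hσ
    refine ⟨U, D, L, R, m, hU, hL, hF, fun p hp hp' => ?_⟩
    rw [mem_codes]
    refine ⟨Finset.mem_range.2 (show m < n + 1 by omega), mem_goodTuples.2 ⟨fun j => Finset.mem_univ _, hp,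
      σ.injective.comp hp⟩, ?_⟩
    have e : (Finset.univ.image fun j => σ (p j)) = (internals σ).image σ := by
      rw [← hp', Finset.image_image]; rfl
    simp only [Finset.mem_union, Finset.mem_product, Finset.mem_powerset, hbad, Finset.mem_filter,
      Finset.mem_univ, true_and]
    rw [e, hp', Finset.subset_compl_iff_disjoint_right, Finset.subset_compl_iff_disjoint_right]
    have h1 := hU.disjoint_union.mono_left Finset.subset_union_left
    have h2 := hL.disjoint_union.mono_left Finset.subset_union_right
    tauto
  · obtain ⟨-, h1, h2⟩ := mem_goodTuples.1 hw
    refine (Finset.card_union_le _ _).trans ?_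
    rw [Finset.card_product, Finset.card_product, card_powerset_compl_image hn h1,
      card_powerset_compl_image hn h2, hcard]
    apply le_of_eq; ring

open Classical in
/-- The balanced sets of labels that avoid `X` and the two ends. -/
def labelSets {N : ℕ} (E : ℕ) (X : Finset (Fin N)) : Finset (Finset (Fin N)) :=
  Finset.univ.filter fun U => Disjoint U X ∧ (∀ i ∈ U, (i : ℕ) ≠ 0 ∧ (i : ℕ) ≠ N - 1) ∧
    Balanced E U

lemma mem_labelSets {N E : ℕ} {X U : Finset (Fin N)} : U ∈ labelSets E X ↔
    Disjoint U X ∧ (∀ i ∈ U, (i : ℕ) ≠ 0 ∧ (i : ℕ) ≠ N - 1) ∧ Balanced E U := by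
  simp [labelSets]

/-- At least `N - (k + 2) = n - 2` elements remain outside `p` and the two ends; all their subsets
qualify except those that are not balanced. -/
lemma le_card_labelSets {N n k E : ℕ} (hn : n + k = N) (hN : 0 < N) {p : Fin k → Fin N}
    (hp : Function.Injective p) :
    2 ^ (n - 2) - numNotBalanced N E ≤ (labelSets E (Finset.univ.image p)).card := by
  classical
  let X : Finset (Fin N) := insert ⟨0, hN⟩ (insert ⟨N - 1, by omega⟩ (Finset.univ.image p))
  have hX : X.card ≤ k + 2 := by
    refine (Finset.card_insert_le _ _).trans ?_
    have := Finset.card_insert_le (⟨N - 1, by omega⟩ : Fin N) (Finset.univ.image p)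
    rw [Finset.card_image_of_injective _ hp, Finset.card_univ, Fintype.card_fin] at this
    omega
  have h1 : 2 ^ (n - 2) ≤ (Xᶜ).powerset.card := by
    rw [Finset.card_powerset, Finset.card_compl, Fintype.card_fin]
    exact Nat.pow_le_pow_right (by norm_num) (by omega)
  have h2 : (Xᶜ).powerset ⊆ labelSets E (Finset.univ.image p) ∪
      (Finset.univ : Finset (Finset (Fin N))).filter fun s => ¬ Balanced E s := by
    intro U hU
    rw [Finset.mem_powerset, Finset.subset_compl_iff_disjoint_right, Finset.disjoint_insert_right,
      Finset.disjoint_insert_right] at hU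
    obtain ⟨a, b, c⟩ := hU
    rw [Finset.mem_union, mem_labelSets, Finset.mem_filter]
    by_cases hb : Balanced E U
    · refine Or.inl ⟨c, fun i hi => ⟨fun h => a ?_, fun h => b ?_⟩, hb⟩
      · convert hi; exact h.symm
      · convert hi; exact h.symm
    · exact Or.inr ⟨Finset.mem_univ _, hb⟩
  have h3 := (Finset.card_le_card h2).trans (Finset.card_union_le _ _)
  rw [← numNotBalanced] at h3
  omega

/-- There are many almost square permutations. -/
lemma le_card_mul_factorial {N n k E E₀ B : ℕ} (hn : n + k = N) {S : Finset (Equiv.Perm (Fin N))}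
    (hS : ∀ σ, σ ∈ S ↔ (internals σ).card = k) (hE : E₀ + 2 * k ≤ E) (hE1 : 1 ≤ E)
    (hEN : 200 * E ≤ N) {M : Finset ℕ} (hM : ∀ m ∈ M, 8 * N ≤ 36 * m ∧ 28 * m ≤ 8 * N)
    (hB : ∀ m ∈ M, B ≤ (innerRegion N m (20 * E)).card) :
    M.card * ((B - 2 * k * N) ^ k * ((2 ^ (n - 2) - numNotBalanced N E₀) *
      (2 ^ (n - 2) - numNotBalanced N E₀))) ≤ S.card * k.factorial := by
  classical
  have hN : 0 < N := by omega
  let Z : (Fin k → Fin N × Fin N) → Finset (Finset (Fin N) × Finset (Fin N)) := fun w =>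
    labelSets E₀ (Finset.univ.image fun j => (w j).1) ×ˢ
      labelSets E₀ (Finset.univ.image fun j => (w j).2)
  refine (le_card_codes (A := fun m => innerRegion N m (20 * E)) (Z := Z) hB
    (fun m _ w hw => ?_)).trans ?_
  · obtain ⟨-, h1, h2⟩ := mem_goodTuples.1 hw
    rw [Finset.card_product]
    exact Nat.mul_le_mul (le_card_labelSets hn hN h1) (le_card_labelSets hn hN h2)
  have key : ∀ x ∈ codes M (fun m => innerRegion N m (20 * E)) k Z,
      ∃ σ : Equiv.Perm (Fin N), ∃ D L : Finset (Fin N),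
        CentralFits E x.2.2.1 D (Finset.univ.image fun j => (x.2.1 j).1) L x.2.2.2
          (Finset.univ.image fun j => (x.2.1 j).2) x.1 n σ ∧
        ∀ j, σ (x.2.1 j).1 = (x.2.1 j).2 := by
    rintro ⟨m, w, U, R⟩ hx
    obtain ⟨hm, hw, hZ⟩ := mem_codes.1 hx
    simp only at hm hw hZ ⊢
    obtain ⟨hw0, hw1, hw2⟩ := mem_goodTuples.1 hw
    obtain ⟨hU, hR⟩ := Finset.mem_product.1 hZ
    obtain ⟨u1, u2, u3⟩ := mem_labelSets.1 hU
    obtain ⟨r1, r2, r3⟩ := mem_labelSets.1 hR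
    simp only at u1 u2 u3 r1 r2 r3
    set P := Finset.univ.image fun j => (w j).1 with hP
    set Q := Finset.univ.image fun j => (w j).2 with hQ
    have cP : P.card = k := by rw [hP, Finset.card_image_of_injective _ hw1]; simp
    have cQ : Q.card = k := by rw [hQ, Finset.card_image_of_injective _ hw2]; simp
    have sU := isSplit_compl u1
    have sR := isSplit_compl r1
    have bD := u3.compl sU.disjoint sU.disjoint_union sU.union_eq cP.le
    have bL := r3.compl sR.disjoint sR.disjoint_union sR.union_eq cQ.le
    have c1 := sU.card
    have c2 := sR.card
    have d1 := u3 N le_rfl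
    have d2 := r3 N le_rfl
    have d3 := bD N le_rfl
    have d4 := bL N le_rfl
    rw [rank_eq_card] at d1 d2 d3 d4
    have hm' := hM m hm
    -- The margin of the inner region keeps internal points off the first and last rows and columns,
    -- so the ends do receive the labels D and L.
    have win : ∀ j, (w j).1 ≠ ⟨0, hN⟩ ∧ (w j).2 ≠ ⟨0, hN⟩ ∧ ((w j).1 : ℕ) ≠ N - 1 ∧
        ((w j).2 : ℕ) ≠ N - 1 := by
      intro j
      have := mem_innerRegion.1 (hw0 j)
      simp only [ne_eq, Fin.ext_iff]
      omega
    obtain ⟨σ, hσ, hσw⟩ := exists_fits_of_code (m := m) (n := n) sU sR.symm (by omega) (by omega)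
      (by omega) (by omega) (by omega) (w := w) (fun i => by simp [hP]) (fun i => by simp [hQ])
      hw1 hw2
    refine ⟨σ, (U ∪ P)ᶜ, (R ∪ Q)ᶜ, ?_, hσw⟩
    refine { toFits := hσ, balU := u3.mono (by omega), balD := bD.mono hE, balL := bL.mono hE,
             balR := r3.mono (by omega), splitU := sU, splitL := sR.symm, mapsP := ?_,
             cardP := by omega, cardn := by omega, cardQ := by omega, one_le := hE1, small := hEN,
             le_m := hm'.1, m_le := hm'.2, inner := ?_, zero_pos := ?_, last_pos := ?_,
             zero_val := ?_, last_val := ?_ }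
    · intro i hi
      rw [hP, Finset.mem_image] at hi
      obtain ⟨j, -, rfl⟩ := hi
      rw [hσw]
      exact Finset.mem_image_of_mem _ (Finset.mem_univ j)
    · intro i hi
      rw [hP, Finset.mem_image] at hi
      obtain ⟨j, -, rfl⟩ := hi
      rw [hσw]
      exact hw0 j
    · intro i hi
      rw [Finset.mem_compl, Finset.mem_union, not_or, hP, Finset.mem_image]
      refine ⟨fun h => (u2 i h).1 hi, ?_⟩
      rintro ⟨j, -, rfl⟩
      exact (win j).1 (Fin.ext hi)
    · intro i hi
      rw [Finset.mem_compl, Finset.mem_union, not_or, hP, Finset.mem_image]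
      refine ⟨fun h => (u2 i h).2 hi, ?_⟩
      rintro ⟨j, -, rfl⟩
      exact (win j).2.2.1 hi
    · intro i hi
      rw [Finset.mem_compl, Finset.mem_union, not_or, hQ, Finset.mem_image]
      refine ⟨fun h => (r2 i h).1 hi, ?_⟩
      rintro ⟨j, -, rfl⟩
      exact (win j).2.1 (Fin.ext hi)
    · intro i hi
      rw [Finset.mem_compl, Finset.mem_union, not_or, hQ, Finset.mem_image]
      refine ⟨fun h => (r2 i h).2 hi, ?_⟩
      rintro ⟨j, -, rfl⟩
      exact (win j).2.2.2 hi
  choose! σ D L hσ hσw using key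
  rw [← card_orderedPerms fun τ hτ => (hS τ).1 hτ]
  refine Finset.card_le_card_of_injOn (fun x => ⟨σ x, fun j => (x.2.1 j).1⟩) ?_ ?_
  · intro x hx
    have hinj := (mem_goodTuples.1 (mem_codes.1 hx).2.1).2.1
    rw [Finset.mem_coe, mem_orderedPerms]
    refine ⟨(hS _).2 ?_, hinj, (hσ x hx).internals_eq.symm⟩
    rw [(hσ x hx).internals_eq, Finset.card_image_of_injective _ hinj]
    simp
  · rintro ⟨m, w, U, R⟩ hx ⟨m', w', U', R'⟩ hx' heq
    simp only [Sigma.mk.injEq, heq_eq_eq] at heq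
    obtain ⟨e1, e2⟩ := heq
    have h1 := hσ _ hx
    have h2 := hσ _ hx'
    have w1 := hσw _ hx
    have w2 := hσw _ hx'
    rw [← e1] at h2 w2
    simp only at h1 h2 w1 w2
    -- The permutation carries the ordered positions to the ordered values, so the pair recovers the
    -- whole list of internal points.
    have ew : w = w' := by
      funext j
      refine Prod.ext (congrFun e2 j) ?_
      rw [← w1, ← w2, congrFun e2 j]
    subst ew
    obtain ⟨rfl, rfl, rfl⟩ := h1.unique h2 rfl
    rfl

/-! ### Permutations near the square -/

/-- Up to an error `η N`, the points of `σ` with positions in `U` lie on the two upper sides of the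
square with corners at the midpoints, those with positions in `D` lie on the two lower sides, these
are nearly all the points, and they are equally distributed between `U` and `D`. -/
structure NearSquare {N : ℕ} (η : ℝ) (σ : Equiv.Perm (Fin N)) (U D : Finset (Fin N)) : Prop where
  disjoint : Disjoint U D
  card : (N : ℝ) - (U.card + D.card) ≤ η * N
  balance : ∀ i ≤ N, |(rank U i : ℝ) - rank D i| ≤ η * N
  upper : ∀ i ∈ U, |((σ i : ℕ) : ℝ) - min ((N : ℝ) / 2 + (i : ℕ)) (3 * (N : ℝ) / 2 - (i : ℕ))| ≤ η * N
  lower : ∀ i ∈ D, |((σ i : ℕ) : ℝ) - abs ((N : ℝ) / 2 - (i : ℕ))| ≤ η * N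

/-- With `4 * m` close to `N`, the rectangle of `near_upper` and `near_lower` is close to the
square. Replacing `m` by `N / 4` and `n` by `N` costs a bounded multiple of `ε N`. -/
lemma BalancedFits.nearSquare {N E m n k : ℕ} {U D L R P : Finset (Fin N)}
    {σ : Equiv.Perm (Fin N)} (h : BalancedFits E U D L R m n σ) (hU : IsSplit U D P)
    (hP : P.card = k) (hn : n + k = N) {ε : ℝ} (hm : |4 * (m : ℝ) - N| ≤ 2 * ε * N)
    (hE : (E : ℝ) + k + 2 ≤ ε * N) : NearSquare (10 * ε) σ U D := by
  have hk0 : (0 : ℝ) ≤ k := k.cast_nonneg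
  have hE0 : (0 : ℝ) ≤ E := E.cast_nonneg
  have hn' : (n : ℝ) + k = N := by exact_mod_cast hn
  obtain ⟨hm1, hm2⟩ := abs_le.1 hm
  refine ⟨hU.disjoint, ?_, fun i hi => ?_, fun i hi => ?_, fun i hi => ?_⟩
  · have h1 : (U.card : ℝ) + D.card + P.card = N := by exact_mod_cast hU.card
    rw [hP] at h1
    linarith
  · have h1 := h.balU i hi
    have h2 := h.balD i hi
    have h3 : (rank U i : ℝ) ≤ rank D i + E := by
      exact_mod_cast (by omega : rank U i ≤ rank D i + E)
    have h4 : (rank D i : ℝ) ≤ rank U i + E := by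
      exact_mod_cast (by omega : rank D i ≤ rank U i + E)
    rw [abs_le]
    constructor <;> linarith
  -- Since values do not exceed `N`, a point near one of the two increasing or decreasing lines
  -- stays, up to the error, on the part where that line realises the minimum.
  · have hv : ((σ i : ℕ) : ℝ) ≤ N := by exact_mod_cast (σ i).2.le
    rcases h.near_upper hi with ⟨h1, h2⟩ | ⟨h1, h2⟩
    · have h1' : ((σ i : ℕ) : ℝ) ≤ (i : ℕ) + 2 * m + 2 * E := by exact_mod_cast h1
      have h2' : ((i : ℕ) : ℝ) + 2 * m ≤ (σ i : ℕ) + 2 * E := by exact_mod_cast h2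
      rw [abs_le]
      rcases min_cases ((N : ℝ) / 2 + (i : ℕ)) (3 * (N : ℝ) / 2 - (i : ℕ)) with ⟨e, e'⟩ | ⟨e, e'⟩ <;>
        rw [e] <;> constructor <;> linarith
    · have h1' : ((i : ℕ) : ℝ) + (σ i : ℕ) + 2 * m ≤ 2 * n + 2 * E := by exact_mod_cast h1
      have h2' : 2 * (n : ℝ) ≤ (i : ℕ) + (σ i : ℕ) + 2 * m + 2 + 2 * E := by exact_mod_cast h2
      rw [abs_le]
      rcases min_cases ((N : ℝ) / 2 + (i : ℕ)) (3 * (N : ℝ) / 2 - (i : ℕ)) with ⟨e, e'⟩ | ⟨e, e'⟩ <;>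
        rw [e] <;> constructor <;> linarith
  · have hv : (0 : ℝ) ≤ (σ i : ℕ) := Nat.cast_nonneg _
    rcases h.near_lower hi with ⟨h1, h2⟩ | ⟨h1, h2⟩
    · have h1' : ((σ i : ℕ) : ℝ) + (i : ℕ) ≤ 2 * m + 2 * E := by exact_mod_cast h1
      have h2' : 2 * (m : ℝ) ≤ (σ i : ℕ) + (i : ℕ) + 2 + 2 * E := by exact_mod_cast h2
      rw [abs_le]
      rcases abs_cases ((N : ℝ) / 2 - (i : ℕ)) with ⟨e, e'⟩ | ⟨e, e'⟩ <;>
        rw [e] <;> constructor <;> linarith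
    · have h1' : ((i : ℕ) : ℝ) ≤ 2 * m + (σ i : ℕ) + 2 * E := by exact_mod_cast h1
      have h2' : 2 * (m : ℝ) + (σ i : ℕ) ≤ (i : ℕ) + 2 * E := by exact_mod_cast h2
      rw [abs_le]
      rcases abs_cases ((N : ℝ) / 2 - (i : ℕ)) with ⟨e, e'⟩ | ⟨e, e'⟩ <;>
        rw [e] <;> constructor <;> linarith

/-! ### Most almost square permutations are near the square -/

/-- Completing the square leaves about `(N² - (4m - N)²) / 2` points, so a deviation `2 ε N` of `4 *
m` costs `2 ε² N²`. The choice `δ = ε² / 400` makes the boundary strip return at most a tenth of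
this. -/
lemma card_outerRegion_le_real {N m c : ℕ} {ε δ : ℝ} (hε : 0 < ε) (hε' : ε ≤ 1 / 10)
    (hδ : δ = ε ^ 2 / 400) (hN : 1 ≤ δ * N) (hm : 2 * ε * N ≤ |4 * (m : ℝ) - N|)
    (hc : (c : ℝ) ≤ 8 * δ * N) :
    ((outerRegion N m (2 * c)).card : ℝ) ≤ (1 / 2 - 9 / 5 * ε ^ 2) * N ^ 2 := by
  have hN0 : (0 : ℝ) ≤ N := N.cast_nonneg
  have hc0 : (0 : ℝ) ≤ c := c.cast_nonneg
  have hδ0 : 0 < δ := by rw [hδ]; positivity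
  have hε2 : ε ^ 2 ≤ 1 / 100 := by nlinarith
  -- In the second case the truncated factor vanishes and the region is empty.
  rcases le_total (2 * m) (N + 2 * c + 1) with h | h
  · have h1 : ((outerRegion N m (2 * c)).card : ℝ) ≤
        (4 * m + 4 * c + 1) * (N + 2 * c + 1 - 2 * m) := by
      have := card_outerRegion_le N m c
      calc ((outerRegion N m (2 * c)).card : ℝ) ≤
          (((4 * m + 4 * c + 1) * (N + 2 * c + 1 - 2 * m) : ℕ) : ℝ) := by exact_mod_cast this
        _ = _ := by rw [Nat.cast_mul, Nat.cast_sub h]; push_cast; ring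
    have e : (4 * m + 4 * c + 1) * ((N : ℝ) + 2 * c + 1 - 2 * m) =
        1 / 2 * ((N + 4 * c + 3 / 2) ^ 2 - (4 * m - N - 1 / 2) ^ 2) := by ring
    have h2 : (N + 4 * (c : ℝ) + 3 / 2) ^ 2 ≤ ((1 + 34 * δ) * N) ^ 2 := by
      apply pow_le_pow_left₀ (by positivity); linarith
    have h3 : ((2 * ε - δ) * N) ^ 2 ≤ (4 * (m : ℝ) - N - 1 / 2) ^ 2 := by
      have h0 : 0 ≤ (2 * ε - δ) * N := mul_nonneg (by rw [hδ]; nlinarith) hN0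
      rcases abs_cases (4 * (m : ℝ) - N) with ⟨h4, h5⟩ | ⟨h4, h5⟩ <;> rw [h4] at hm
      · exact pow_le_pow_left₀ h0 (by linarith) 2
      · rw [← neg_sq (4 * (m : ℝ) - N - 1 / 2)]
        exact pow_le_pow_left₀ h0 (by linarith) 2
    have h4 : 1 / 2 * ((1 + 34 * δ) ^ 2 - (2 * ε - δ) ^ 2) ≤ 1 / 2 - 9 / 5 * ε ^ 2 := by
      have h5 : ε ^ 2 = 400 * δ := by rw [hδ]; ring
      have h6 : δ * δ ≤ 1 / 40000 * δ := by gcongr; rw [hδ]; linarith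
      have h7 : ε * δ ≤ 1 / 10 * δ := by gcongr
      rw [h5]
      have e' : 1 / 2 * ((1 + 34 * δ) ^ 2 - (2 * ε - δ) ^ 2) =
        1 / 2 + 34 * δ + 1155 / 2 * (δ * δ) - 2 * ε ^ 2 + 2 * (ε * δ) := by ring
      rw [e', h5]
      linarith
    calc _ ≤ _ := h1
      _ ≤ 1 / 2 * ((1 + 34 * δ) ^ 2 - (2 * ε - δ) ^ 2) * N ^ 2 := by
        rw [e]; rw [mul_pow] at h2 h3; linarith
      _ ≤ _ := by gcongr
  · have := card_outerRegion_le N m c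
    rw [Nat.sub_eq_zero_of_le h, mul_zero, Nat.le_zero] at this
    rw [this, Nat.cast_zero]
    apply mul_nonneg _ (sq_nonneg _)
    linarith

/-- A deviation `ε N` of `4 * m` costs only `ε² N² / 2`; the other half of the allowance pays for
the boundary strip and for the rows and columns lost to distinctness. The deficit `ε²`, against `9/5
ε²` for the wrong parameters, is what separates the two counts. -/
lemma le_card_innerRegion_real {N m c k : ℕ} {ε δ : ℝ} (hε : 0 < ε) (hε' : ε ≤ 1 / 10)
    (hδ : δ = ε ^ 2 / 400) (hm : |4 * (m : ℝ) - N| ≤ ε * N) (hc1 : 1 ≤ c)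
    (hc : (c : ℝ) ≤ 30 * δ * N) (hk : (k : ℝ) ≤ δ * N) :
    (1 / 2 - ε ^ 2) * N ^ 2 ≤ ((innerRegion N m (2 * c)).card : ℝ) - 2 * k * N := by
  have hN0 : (0 : ℝ) ≤ N := N.cast_nonneg
  have hc0 : (0 : ℝ) ≤ c := c.cast_nonneg
  have hε2 : ε ^ 2 ≤ 1 / 100 := by nlinarith
  obtain ⟨hm1, hm2⟩ := abs_le.1 hm
  have hεN : ε * N ≤ 1 / 10 * N := by gcongr
  have hδN : δ * N ≤ 1 / 40000 * N := by
    gcongr; rw [hδ]; linarith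
  have hcm : c ≤ m := by
    have : (c : ℝ) ≤ m := by linarith
    exact_mod_cast this
  have hcm' : 2 * m + 2 * c ≤ N := by
    have : 2 * (m : ℝ) + 2 * c ≤ N := by linarith
    exact_mod_cast this
  have h1 : (4 * (m : ℝ) - 4 * c) * (N - 2 * m - 2 * c) ≤ (innerRegion N m (2 * c)).card := by
    have h := le_card_innerRegion (N := N) hc1 hcm
    calc _ ≤ (4 * (m : ℝ) + 1 - 4 * c) * (N - 2 * m - 2 * c) := by
          apply mul_le_mul_of_nonneg_right (by linarith)
          have : 2 * (m : ℝ) + 2 * c ≤ N := by exact_mod_cast hcm'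
          linarith
      _ = (((4 * m + 1 - 4 * c) * (N - 2 * m - 2 * c) : ℕ) : ℝ) := by
          rw [Nat.cast_mul, Nat.cast_sub (by omega), Nat.cast_sub (by omega),
            Nat.cast_sub (by omega)]
          push_cast; ring
      _ ≤ _ := by exact_mod_cast h
  have e : (4 * (m : ℝ) - 4 * c) * (N - 2 * m - 2 * c) =
      1 / 2 * ((N - 4 * c) ^ 2 - (4 * m - N) ^ 2) := by ring
  have h2 : (4 * (m : ℝ) - N) ^ 2 ≤ (ε * N) ^ 2 := sq_le_sq' (by linarith) (by linarith)
  have h3 : (c : ℝ) * N ≤ 30 * δ * N * N := mul_le_mul_of_nonneg_right hc hN0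
  have h4 : (k : ℝ) * N ≤ δ * N * N := mul_le_mul_of_nonneg_right hk hN0
  have h5 : δ * N * N = ε ^ 2 * N ^ 2 / 400 := by rw [hδ]; ring
  have h6 : 0 ≤ ε ^ 2 * (N : ℝ) ^ 2 := by positivity
  have h7 : (0 : ℝ) ≤ (c : ℝ) ^ 2 := by positivity
  rw [e] at h1
  nlinarith

/-- The scale that controls the number of sets that are not balanced. -/
def tailScale (c : ℝ) (N : ℕ) : ℝ := N * Real.exp (-(c * N))

/-- With `E ≥ δ N / 2` the Chernoff exponent `E² / (2 N)` is at least `2 c N`. One of the two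
factors `exp (-c N)` will absorb constants to the power `k`, the other remains as `tailScale`. -/
lemma numNotBalanced_le {N n k E : ℕ} {δ c : ℝ} (hn : n + k = N) (hδ : 0 < δ)
    (hc : c = δ ^ 2 / 16) (hN : 1 ≤ N) (hE : δ * N / 2 ≤ E) :
    (numNotBalanced N E : ℝ) ≤ 4 * N * Real.exp (-(c * N)) * Real.exp (-(c * N)) * 2 ^ k * 2 ^ n := by
  have hN0 : (1 : ℝ) ≤ N := by exact_mod_cast hN
  have h1 := card_not_balanced_le (N := N) (by omega) E
  refine h1.trans ?_
  rw [mul_assoc (4 * (N : ℝ)), ← Real.exp_add, mul_assoc _ ((2 : ℝ) ^ k), ← pow_add, add_comm k n, hn]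
  have h2 : Real.exp (-((E : ℝ) ^ 2 / (2 * N))) ≤ Real.exp (-(c * N) + -(c * N)) := by
    apply Real.exp_le_exp.2
    have : (δ * N / 2) ^ 2 ≤ (E : ℝ) ^ 2 := pow_le_pow_left₀ (by positivity) hE 2
    have h3 : (δ * N / 2) ^ 2 / (2 * N) ≤ (E : ℝ) ^ 2 / (2 * N) := by gcongr
    have h4 : (δ * N / 2) ^ 2 / (2 * N) = c * N + c * N := by
      rw [hc]; field_simp; ring
    linarith
  calc _ ≤ 2 * ((N : ℝ) + N) * 2 ^ N * Real.exp (-(c * N) + -(c * N)) := by gcongr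
    _ = _ := by ring

lemma eight_pow_mul_exp_le {k : ℕ} {x : ℝ} (h : 3 * (k : ℝ) ≤ x) :
    8 ^ k * Real.exp (-x) ≤ 1 := by
  have h1 : (8 : ℝ) ≤ Real.exp 3 := by
    have := Real.exp_one_gt_d9
    rw [show (3 : ℝ) = (3 : ℕ) * 1 by norm_num, Real.exp_nat_mul]
    nlinarith [sq_nonneg (Real.exp 1 - 2)]
  rw [Real.exp_neg, ← div_eq_mul_inv, div_le_one (Real.exp_pos _)]
  calc (8 : ℝ) ^ k ≤ Real.exp 3 ^ k := by gcongr
    _ = Real.exp (3 * k) := by rw [← Real.exp_nat_mul, mul_comm]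
    _ ≤ _ := Real.exp_le_exp.2 h

/-- A lower bound for the number of almost square permutations. -/
lemma le_card_mul_factorial_real {N n k : ℕ} {ε δ c : ℝ} (hn : n + k = N) (hε : 0 < ε)
    (hε' : ε ≤ 1 / 10) (hδ : δ = ε ^ 2 / 400) (hc : c = δ ^ 2 / 16) (hN : 8 ≤ δ * N)
    (hk : 3 * k ≤ c * N) (ht : 32 * tailScale c N ≤ 1) {S : Finset (Equiv.Perm (Fin N))}
    (hS : ∀ σ, σ ∈ S ↔ (internals σ).card = k) :
    ε * N / 4 * ((1 / 2 - ε ^ 2) * N ^ 2) ^ k * (4 ^ n / 64) ≤ S.card * k.factorial := by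
  have hδ0 : 0 < δ := by rw [hδ]; positivity
  have hε2 : ε ^ 2 ≤ 1 / 100 := by nlinarith
  have hδ1 : δ ≤ 1 / 40000 := by rw [hδ]; linarith
  have hN0 : (0 : ℝ) ≤ N := N.cast_nonneg
  have hN1 : 320000 ≤ (N : ℝ) := by nlinarith
  have hN1' : 1 ≤ N := by
    have : (1 : ℝ) ≤ N := by linarith
    exact_mod_cast this
  have hkδ : (k : ℝ) ≤ δ * N / 100 := by
    have : c * N ≤ δ * N / 40 := by
      rw [hc]; nlinarith [mul_nonneg hδ0.le hN0]
    have h0 : (0 : ℝ) ≤ k := k.cast_nonneg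
    nlinarith [mul_nonneg hδ0.le hN0, mul_nonneg (mul_nonneg hδ0.le hN0) (sub_nonneg.2 hδ1)]
  -- `E₀` is the tolerance for the freely chosen sets `U` and `R`; their complements `D` and `L`
  -- lose up to `k` elements more, hence `E = E₀ + 2 * k`.
  set E₀ := ⌊δ * N⌋₊ with hE₀
  have hE₀1 : (E₀ : ℝ) ≤ δ * N := Nat.floor_le (by positivity)
  have hE₀2 : δ * N - 1 < E₀ := Nat.sub_one_lt_floor _
  set E := E₀ + 2 * k with hE
  have hE' : (E : ℝ) = E₀ + 2 * k := by rw [hE]; push_cast; ring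
  have hE1 : 1 ≤ E := by
    have : (1 : ℝ) ≤ E := by rw [hE']; linarith [(k.cast_nonneg : (0 : ℝ) ≤ k)]
    exact_mod_cast this
  have hEN : 200 * E ≤ N := by
    have : 200 * (E : ℝ) ≤ N := by rw [hE']; nlinarith
    exact_mod_cast this
  -- the admissible values of `m`
  set M := Finset.Icc ⌈(1 - ε) * N / 4⌉₊ ⌊(1 + ε) * N / 4⌋₊ with hM
  have hMm : ∀ m ∈ M, |4 * (m : ℝ) - N| ≤ ε * N := by
    intro m hm
    rw [hM, Finset.mem_Icc, Nat.ceil_le, Nat.le_floor_iff (by positivity)] at hm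
    rw [abs_le]
    constructor <;> linarith [hm.1, hm.2]
  have hMcard : ε * N / 4 ≤ (M.card : ℝ) := by
    rw [hM, Nat.card_Icc]
    have h1 : (⌈(1 - ε) * N / 4⌉₊ : ℝ) < (1 - ε) * N / 4 + 1 :=
      Nat.ceil_lt_add_one (by apply div_nonneg (mul_nonneg (by linarith) hN0) (by norm_num))
    have h2 : (1 + ε) * N / 4 - 1 < (⌊(1 + ε) * N / 4⌋₊ : ℝ) := Nat.sub_one_lt_floor _
    have h3 : 4 ≤ ε * N := by
      have : δ ≤ ε := by rw [hδ]; nlinarith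
      nlinarith
    have h4 : (⌊(1 + ε) * N / 4⌋₊ : ℝ) + 1 - ⌈(1 - ε) * N / 4⌉₊ ≤
        ((⌊(1 + ε) * N / 4⌋₊ + 1 - ⌈(1 - ε) * N / 4⌉₊ : ℕ) : ℝ) := by
      have : ⌊(1 + ε) * N / 4⌋₊ + 1 ≤ (⌊(1 + ε) * N / 4⌋₊ + 1 - ⌈(1 - ε) * N / 4⌉₊) +
        ⌈(1 - ε) * N / 4⌉₊ := by omega
      have : ((⌊(1 + ε) * N / 4⌋₊ + 1 : ℕ) : ℝ) ≤
        (((⌊(1 + ε) * N / 4⌋₊ + 1 - ⌈(1 - ε) * N / 4⌉₊) + ⌈(1 - ε) * N / 4⌉₊ : ℕ) : ℝ) := by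
        exact_mod_cast this
      push_cast at this
      linarith
    linarith
  set b := (1 / 2 - ε ^ 2) * (N : ℝ) ^ 2 with hb
  have hb0 : 0 ≤ b := mul_nonneg (by linarith) (sq_nonneg _)
  set B := ⌈b + 2 * k * N⌉₊ with hB
  have hBle : ∀ m ∈ M, B ≤ (innerRegion N m (20 * E)).card := by
    intro m hm
    rw [hB, Nat.ceil_le]
    have h1 := le_card_innerRegion_real (c := 10 * E) (k := k) hε hε' hδ (hMm m hm) (by omega)
      (by push_cast; rw [hE']; linarith) (by linarith)
    rw [show 2 * (10 * E) = 20 * E by ring] at h1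
    linarith
  have hbB : b ≤ ((B - 2 * k * N : ℕ) : ℝ) := by
    have h1 : b + 2 * k * N ≤ B := Nat.le_ceil _
    have h2 : (B : ℝ) ≤ ((B - 2 * k * N : ℕ) : ℝ) + 2 * k * N := by
      exact_mod_cast (by omega : B ≤ (B - 2 * k * N) + 2 * k * N)
    linarith
  -- Avoiding both ends leaves `2 ^ n / 4` sets, and at most `2 ^ n / 8` of them are unbalanced;
  -- squaring gives the factor `4 ^ n / 64`.
  have ho : (2 : ℝ) ^ n / 8 ≤ ((2 ^ (n - 2) - numNotBalanced N E₀ : ℕ) : ℝ) := by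
    have hbad := numNotBalanced_le hn hδ0 hc hN1' (E := E₀) (by linarith)
    have h1 := eight_pow_mul_exp_le hk
    have h2 : (2 : ℝ) ^ k ≤ 8 ^ k := by gcongr; norm_num
    have h3 : (numNotBalanced N E₀ : ℝ) ≤ 2 ^ n / 8 := by
      calc _ ≤ 4 * N * Real.exp (-(c * N)) * Real.exp (-(c * N)) * 2 ^ k * 2 ^ n := hbad
        _ ≤ 4 * N * Real.exp (-(c * N)) * Real.exp (-(c * N)) * 8 ^ k * 2 ^ n := by gcongr
        _ = 4 * tailScale c N * (8 ^ k * Real.exp (-(c * N))) * 2 ^ n := by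
          rw [tailScale]; ring
        _ ≤ 4 * tailScale c N * 1 * 2 ^ n := by
          have : 0 ≤ tailScale c N := mul_nonneg hN0 (Real.exp_nonneg _)
          gcongr
        _ ≤ 1 / 8 * 2 ^ n := by gcongr; linarith
        _ = _ := by ring
    have hn2 : 2 ≤ n := by
      have : (2 : ℝ) ≤ n := by
        have h5 : (n : ℝ) + k = N := by exact_mod_cast hn
        nlinarith
      exact_mod_cast this
    have h4 : (2 : ℝ) ^ n = 4 * 2 ^ (n - 2) := by
      rw [show n = (n - 2) + 2 by omega, pow_add]; norm_num; ring
    have h5 : ((2 ^ (n - 2) : ℕ) : ℝ) ≤ ((2 ^ (n - 2) - numNotBalanced N E₀ : ℕ) : ℝ) +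
        numNotBalanced N E₀ := by
      exact_mod_cast (by omega : 2 ^ (n - 2) ≤ (2 ^ (n - 2) - numNotBalanced N E₀) +
        numNotBalanced N E₀)
    push_cast at h5
    linarith
  have main := le_card_mul_factorial (E := E) (E₀ := E₀) hn hS le_rfl hE1 hEN (M := M)
    (fun m hm => by
      obtain ⟨h1, h2⟩ := abs_le.1 (hMm m hm)
      have h3 : ε * N ≤ 1 / 10 * N := by gcongr
      constructor
      · have : 8 * (N : ℝ) ≤ 36 * m := by linarith
        exact_mod_cast this
      · have : 28 * (m : ℝ) ≤ 8 * N := by linarith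
        exact_mod_cast this) hBle
  calc ε * N / 4 * b ^ k * (4 ^ n / 64) =
        ε * N / 4 * (b ^ k * (2 ^ n / 8 * (2 ^ n / 8))) := by
        have h4 : (4 : ℝ) ^ n = 2 ^ n * 2 ^ n := by rw [← mul_pow]; norm_num
        rw [h4]; ring
    _ ≤ M.card * (((B - 2 * k * N : ℕ) : ℝ) ^ k *
        (((2 ^ (n - 2) - numNotBalanced N E₀ : ℕ) : ℝ) *
          ((2 ^ (n - 2) - numNotBalanced N E₀ : ℕ) : ℝ))) := by gcongr
    _ ≤ _ := by exact_mod_cast main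

open Classical in
/-- Few almost square permutations are far from the square. -/
lemma card_not_nearSquare_le {N n k : ℕ} {ε δ c : ℝ} (hn : n + k = N) (hε : 0 < ε)
    (hε' : ε ≤ 1 / 10) (hδ : δ = ε ^ 2 / 400) (hc : c = δ ^ 2 / 16) (hN : 8 ≤ δ * N)
    (hk : 3 * k ≤ c * N) (ht : 32 * tailScale c N ≤ 1) {S : Finset (Equiv.Perm (Fin N))}
    (hS : ∀ σ, σ ∈ S ↔ (internals σ).card = k) :
    ((S.filter fun σ => ¬ ∃ U D, NearSquare (10 * ε) σ U D).card : ℝ) ≤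
      (512 / ε * ((1 / 2 - 9 / 5 * ε ^ 2) / (1 / 2 - ε ^ 2)) ^ k +
        4096 / ε * tailScale c N) * S.card := by
  have hlow := le_card_mul_factorial_real hn hε hε' hδ hc hN hk ht hS
  have hδ0 : 0 < δ := by rw [hδ]; positivity
  have hε2 : ε ^ 2 ≤ 1 / 100 := by nlinarith
  have hδε : δ ≤ ε / 4000 := by rw [hδ]; nlinarith
  have hN0 : (0 : ℝ) ≤ N := N.cast_nonneg
  have hN1 : 1 ≤ (N : ℝ) := by nlinarith
  have hN1' : 1 ≤ N := by exact_mod_cast hN1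
  have hk0 : (0 : ℝ) ≤ k := k.cast_nonneg
  have hkδ : (k : ℝ) ≤ δ * N / 10 := by
    have : c * N ≤ δ * N / 10 := by
      rw [hc]; nlinarith [mul_nonneg hδ0.le hN0]
    linarith
  have hδεN : δ * N ≤ ε * N / 4000 := by
    rw [mul_div_right_comm]; gcongr
  have hT : 0 ≤ tailScale c N := mul_nonneg hN0 (Real.exp_nonneg _)
  set E₀ := ⌊δ * N⌋₊ with hE₀
  have hE₀1 : (E₀ : ℝ) ≤ δ * N := Nat.floor_le (by positivity)
  have hE₀2 : δ * N - 1 < E₀ := Nat.sub_one_lt_floor _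
  set E := E₀ + 2 * k with hE
  have hE' : (E : ℝ) = E₀ + 2 * k := by rw [hE]; push_cast; ring
  set S₁ := S.filter fun σ => ∃ (U D L R : Finset (Fin N)) (m : ℕ), IsSplit U D (internals σ) ∧
      IsSplit L R ((internals σ).image σ) ∧ m ≤ D.card ∧
      m ∈ (Finset.range (n + 1)).filter (fun m : ℕ => 2 * ε * N ≤ |4 * (m : ℝ) - N|) ∧
      BalancedFits E U D L R m n σ with hS₁
  set S₂ := S.filter fun σ => ∃ (U D L R : Finset (Fin N)) (m : ℕ), IsSplit U D (internals σ) ∧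
      IsSplit L R ((internals σ).image σ) ∧ m ≤ n ∧ Fits U D L R m n σ ∧
      (¬ Balanced E₀ U ∨ ¬ Balanced E₀ R) with hS₂
  have hsub : (S.filter fun σ => ¬ ∃ U D, NearSquare (10 * ε) σ U D) ⊆ S₁ ∪ S₂ := by
    intro σ hσ
    rw [Finset.mem_filter] at hσ
    obtain ⟨hσ, hfar⟩ := hσ
    have hcard := (hS σ).1 hσ
    obtain ⟨U, D, L, R, m, hU, hL, hm, hF⟩ := exists_fits (n := n) σ (by rw [hcard, hn])
    have hc1 := hU.card
    have hmn : m ≤ n := by omega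
    rw [Finset.mem_union]
    by_cases hbU : Balanced E₀ U
    · by_cases hbR : Balanced E₀ R
      · left
        have hB : BalancedFits E U D L R m n σ :=
          { toFits := hF
            balU := hbU.mono (by omega)
            balD := hbU.compl hU.disjoint hU.disjoint_union hU.union_eq hcard.le
            balL := hbR.compl hL.symm.disjoint hL.symm.disjoint_union hL.symm.union_eq
              (by rw [Finset.card_image_of_injective _ σ.injective, hcard])
            balR := hbR.mono (by omega) }
        rw [hS₁, Finset.mem_filter]
        refine ⟨hσ, U, D, L, R, m, hU, hL, hm, ?_, hB⟩
        rw [Finset.mem_filter, Finset.mem_range]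
        refine ⟨by omega, not_lt.1 fun hlt => hfar ⟨U, D, ?_⟩⟩
        refine hB.nearSquare hU hcard hn hlt.le ?_
        rw [hE']; linarith
      · exact Or.inr (Finset.mem_filter.2 ⟨hσ, U, D, L, R, m, hU, hL, hmn, hF, Or.inr hbR⟩)
    · exact Or.inr (Finset.mem_filter.2 ⟨hσ, U, D, L, R, m, hU, hL, hmn, hF, Or.inl hbU⟩)
  have hcard : ((S.filter fun σ => ¬ ∃ U D, NearSquare (10 * ε) σ U D).card : ℝ) ≤
      S₁.card + S₂.card := by
    exact_mod_cast (Finset.card_le_card hsub).trans (Finset.card_union_le _ _)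
  set α := 1 / 2 - 9 / 5 * ε ^ 2 with hα
  set β := 1 / 2 - ε ^ 2 with hβ
  have hα0 : 0 ≤ α := by rw [hα]; linarith
  have hβ4 : 1 / 4 ≤ β := by rw [hβ]; linarith
  have hn2 : ((n : ℝ) + 1) ≤ 2 * N := by
    have : (n : ℝ) + k = N := by exact_mod_cast hn
    linarith
  have hfact : (0 : ℝ) < k.factorial := by exact_mod_cast k.factorial_pos
  -- balanced codes with a wrong parameter
  have h1 : (S₁.card : ℝ) * k.factorial ≤ 512 / ε * (α / β) ^ k *
      (ε * N / 4 * (β * N ^ 2) ^ k * (4 ^ n / 64)) := by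
    have h := card_balanced_le (E := E) (B := ⌊α * N ^ 2⌋₊) hn (S := S₁)
      (fun σ hσ => (hS σ).1 (Finset.mem_filter.1 hσ).1)
      (M := (Finset.range (n + 1)).filter (fun m : ℕ => 2 * ε * N ≤ |4 * (m : ℝ) - N|))
      (fun σ hσ => (Finset.mem_filter.1 hσ).2) (fun m hm => by
        rw [Nat.le_floor_iff (mul_nonneg hα0 (sq_nonneg _)),
          show 4 * E + 2 * k + 2 = 2 * (2 * E + k + 1) by ring]
        refine card_outerRegion_le_real hε hε' hδ (by linarith) (Finset.mem_filter.1 hm).2 ?_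
        push_cast
        rw [hE']
        linarith)
    have hMc : ((((Finset.range (n + 1)).filter
        (fun m : ℕ => 2 * ε * N ≤ |4 * (m : ℝ) - N|)).card : ℕ) : ℝ) ≤ 2 * N := by
      refine le_trans ?_ hn2
      have := Finset.card_filter_le (Finset.range (n + 1))
        (fun m : ℕ => 2 * ε * N ≤ |4 * (m : ℝ) - N|)
      rw [Finset.card_range] at this
      exact_mod_cast this
    have hBf : (⌊α * (N : ℝ) ^ 2⌋₊ : ℝ) ≤ α * N ^ 2 :=
      Nat.floor_le (mul_nonneg hα0 (sq_nonneg _))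
    have h' : (S₁.card : ℝ) * k.factorial ≤ (((Finset.range (n + 1)).filter
        (fun m : ℕ => 2 * ε * N ≤ |4 * (m : ℝ) - N|)).card : ℕ) *
          ((⌊α * (N : ℝ) ^ 2⌋₊ : ℝ) ^ k * (2 ^ n * 2 ^ n)) := by exact_mod_cast h
    calc _ ≤ _ := h'
      _ ≤ 2 * N * ((α * N ^ 2) ^ k * (2 ^ n * 2 ^ n)) := by gcongr
      _ = _ := by
        have h4 : (4 : ℝ) ^ n = 2 ^ n * 2 ^ n := by rw [← mul_pow]; norm_num
        have hβ0 : β ^ k ≠ 0 := pow_ne_zero _ (by linarith)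
        rw [h4, div_pow, mul_pow, mul_pow]
        field_simp
        ring
  -- codes that are not balanced
  have h2 : (S₂.card : ℝ) * k.factorial ≤ 4096 / ε * tailScale c N *
      (ε * N / 4 * (β * N ^ 2) ^ k * (4 ^ n / 64)) := by
    have h := card_not_balanced_code_le (E := E₀) hn (S := S₂)
      (fun σ hσ => (hS σ).1 (Finset.mem_filter.1 hσ).1) (fun σ hσ => (Finset.mem_filter.1 hσ).2)
    have hbad := numNotBalanced_le hn hδ0 hc hN1' (E := E₀) (by linarith)
    have h' : (S₂.card : ℝ) * k.factorial ≤ ((n : ℝ) + 1) * (((N : ℝ) * N) ^ k *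
        (2 * (numNotBalanced N E₀ * 2 ^ n))) := by exact_mod_cast h
    have h8 := eight_pow_mul_exp_le hk
    have h4 : (4 : ℝ) ^ n = 2 ^ n * 2 ^ n := by rw [← mul_pow]; norm_num
    -- Internal points were placed anywhere in the grid, which loses `4 ^ k` against the base `β N²
    -- ≥ N² / 4`; with the `2 ^ k` of the unbalanced sets the total loss is `8 ^ k`.
    have h48 : (8 : ℝ) ^ k * (1 / 4) ^ k = 2 ^ k := by rw [← mul_pow]; norm_num
    calc _ ≤ _ := h'
      _ ≤ 2 * N * (((N : ℝ) * N) ^ k * (2 * ((4 * N * Real.exp (-(c * N)) * Real.exp (-(c * N)) *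
          2 ^ k * 2 ^ n) * 2 ^ n))) := by gcongr
      _ = 16 * N * tailScale c N * (1 / 4 * N ^ 2) ^ k * (8 ^ k * Real.exp (-(c * N))) * 4 ^ n := by
        rw [tailScale, h4, ← h48, mul_pow (1 / 4 : ℝ), sq]; ring
      _ ≤ 16 * N * tailScale c N * (β * N ^ 2) ^ k * 1 * 4 ^ n := by gcongr
      _ = _ := by field_simp; ring
  refine le_of_mul_le_mul_right ?_ hfact
  have hρ : 0 ≤ (α / β) ^ k := pow_nonneg (div_nonneg hα0 (by linarith)) _
  calc _ ≤ ((S₁.card : ℝ) + S₂.card) * k.factorial := by gcongr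
    _ ≤ (512 / ε * (α / β) ^ k + 4096 / ε * tailScale c N) *
        (ε * N / 4 * (β * N ^ 2) ^ k * (4 ^ n / 64)) := by
      rw [add_mul, add_mul]; exact add_le_add h1 h2
    _ ≤ (512 / ε * (α / β) ^ k + 4096 / ε * tailScale c N) * (S.card * k.factorial) := by
      gcongr
    _ = _ := by ring

/-- The permutations in `ASq(n, k)`. -/
def asqFinset (n k : ℕ) : Finset (Equiv.Perm (Fin (n + k))) := by
  classical exact Finset.univ.filter fun σ => σ ∈ ASq n k

lemma coe_asqFinset (n k : ℕ) : (asqFinset n k : Set (Equiv.Perm (Fin (n + k)))) = ASq n k := by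
  ext σ; simp [asqFinset]

lemma mem_asqFinset {n k : ℕ} {σ : Equiv.Perm (Fin (n + k))} :
    σ ∈ asqFinset n k ↔ (internals σ).card = k := by
  rw [← mem_ASq, ← coe_asqFinset, Finset.mem_coe]

lemma NearSquare.mono {N : ℕ} {η η' : ℝ} {σ : Equiv.Perm (Fin N)} {U D : Finset (Fin N)}
    (h : NearSquare η σ U D) (hη : η ≤ η') : NearSquare η' σ U D := by
  have hN : η * N ≤ η' * N := by gcongr
  exact ⟨h.disjoint, h.card.trans hN, fun i hi => (h.balance i hi).trans hN,
    fun i hi => (h.upper i hi).trans hN, fun i hi => (h.lower i hi).trans hN⟩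

lemma tendsto_tailScale {c : ℝ} (hc : 0 < c) : Tendsto (tailScale c) atTop (𝓝 0) := by
  have h1 := (Real.tendsto_pow_mul_exp_neg_atTop_nhds_zero 1).comp
    (tendsto_natCast_atTop_atTop.const_mul_atTop hc)
  have h2 := h1.const_mul c⁻¹
  rw [mul_zero] at h2
  refine h2.congr fun N => ?_
  simp only [Function.comp_apply, tailScale, pow_one]
  field_simp

open Classical in
/-- The proportion of almost square permutations that are far from the square tends to zero. -/
lemma eventually_card_not_nearSquare_le {n k : ℕ → ℕ} (hn : Tendsto n atTop atTop)
    (hk : Tendsto k atTop atTop)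
    (hkn : (fun m => (k m : ℝ)) =o[atTop] fun m => (n m : ℝ)) {η r : ℝ} (hη : 0 < η)
    (hr : 0 < r) :
    ∀ᶠ m in atTop, (((asqFinset (n m) (k m)).filter
      fun σ => ¬ ∃ U D, NearSquare η σ U D).card : ℝ) ≤ r * (asqFinset (n m) (k m)).card := by
  obtain ⟨ε, hε, hε1, hε2⟩ : ∃ ε : ℝ, 0 < ε ∧ ε ≤ 1 / 10 ∧ 10 * ε ≤ η :=
    ⟨min (1 / 10) (η / 10), lt_min (by norm_num) (by positivity), min_le_left _ _, by
      have := min_le_right (1 / 10) (η / 10); linarith⟩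
  set δ := ε ^ 2 / 400 with hδ
  set c := δ ^ 2 / 16 with hc
  have hδ0 : 0 < δ := by positivity
  have hc0 : 0 < c := by positivity
  have hN : Tendsto (fun m => n m + k m) atTop atTop := tendsto_atTop_mono
    (fun m => Nat.le_add_right _ _) hn
  have hT := (tendsto_tailScale hc0).comp hN
  have e1 : ∀ᶠ m in atTop, 8 ≤ δ * ((n m + k m : ℕ) : ℝ) :=
    ((tendsto_natCast_atTop_atTop.comp hN).const_mul_atTop hδ0).eventually_ge_atTop 8
  have e2 : ∀ᶠ m in atTop, 3 * (k m : ℝ) ≤ c * ((n m + k m : ℕ) : ℝ) := by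
    filter_upwards [hkn.bound (show 0 < c / 3 by positivity)] with m hm
    rw [Real.norm_natCast, Real.norm_natCast] at hm
    push_cast
    have : 0 ≤ c * (k m : ℝ) := by positivity
    linarith
  have e3 : ∀ᶠ m in atTop, tailScale c (n m + k m) ≤ 1 / 32 :=
    hT.eventually_le_const (by norm_num)
  have hρ : Tendsto (fun m => 512 / ε * ((1 / 2 - 9 / 5 * ε ^ 2) / (1 / 2 - ε ^ 2)) ^ k m +
        4096 / ε * tailScale c (n m + k m)) atTop (𝓝 (512 / ε * 0 + 4096 / ε * 0)) := by
    have hε3 : ε ^ 2 ≤ 1 / 100 := by nlinarith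
    have hε4 : 0 < ε ^ 2 := by positivity
    refine Tendsto.add (Tendsto.const_mul _ ?_) (Tendsto.const_mul _ hT)
    -- The divergence of `k` enters here: without many internal points nothing would force `m`
    -- towards `N / 4`.
    refine (tendsto_pow_atTop_nhds_zero_of_lt_one ?_ ?_).comp hk
    · apply div_nonneg <;> linarith
    · rw [div_lt_one] <;> linarith
  have e4 := hρ.eventually_le_const (show 512 / ε * 0 + 4096 / ε * 0 < r by simpa using hr)
  filter_upwards [e1, e2, e3, e4] with m h1 h2 h3 h4
  have h5 := card_not_nearSquare_le (N := n m + k m) rfl hε hε1 hδ hc h1 h2 (by linarith)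
    (S := asqFinset (n m) (k m)) fun σ => mem_asqFinset
  calc _ ≤ (((asqFinset (n m) (k m)).filter
        fun σ => ¬ ∃ U D, NearSquare (10 * ε) σ U D).card : ℝ) := by
        have : ((asqFinset (n m) (k m)).filter fun σ => ¬ ∃ U D, NearSquare η σ U D) ⊆
            (asqFinset (n m) (k m)).filter fun σ => ¬ ∃ U D, NearSquare (10 * ε) σ U D := by
          refine Finset.monotone_filter_right _ fun σ _ hσ ⟨U, D, h⟩ => hσ ⟨U, D, h.mono hε2⟩
        exact_mod_cast Finset.card_le_card this
    _ ≤ _ := h5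
    _ ≤ _ := by gcongr

/-! ### The square permuton as the law of a point above or below the diagonal -/

/-- The number `1 / 2` in the unit interval. -/
abbrev half : unitInterval := ⟨1 / 2, by norm_num, by norm_num⟩

/-- The ordinate of the upper boundary of the square. -/
def upperSide (x : unitInterval) : unitInterval :=
  ⟨min (1 / 2 + (x : ℝ)) (3 / 2 - x), le_min (by linarith [x.2.1]) (by linarith [x.2.2]), by
    rcases le_total (x : ℝ) (1 / 2) with h | h
    · exact (min_le_left _ _).trans (by linarith)
    · exact (min_le_right _ _).trans (by linarith)⟩

/-- The ordinate of the lower boundary of the square. -/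
def lowerSide (x : unitInterval) : unitInterval :=
  ⟨|1 / 2 - (x : ℝ)|, abs_nonneg _, abs_le.2 ⟨by linarith [x.2.2], by linarith [x.2.1]⟩⟩

lemma dist_upperSide_le (x y : unitInterval) : dist (upperSide x) (upperSide y) ≤ dist x y := by
  rw [Subtype.dist_eq, Subtype.dist_eq, Real.dist_eq, Real.dist_eq]
  simp only [upperSide]
  have h1 := abs_min_sub_min_le_max (1 / 2 + (x : ℝ)) (3 / 2 - x) (1 / 2 + (y : ℝ)) (3 / 2 - y)
  refine h1.trans (max_le ?_ ?_)
  · rw [add_sub_add_left_eq_sub]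
  · rw [sub_sub_sub_cancel_left, abs_sub_comm]

lemma dist_lowerSide_le (x y : unitInterval) : dist (lowerSide x) (lowerSide y) ≤ dist x y := by
  rw [Subtype.dist_eq, Subtype.dist_eq, Real.dist_eq, Real.dist_eq]
  simp only [lowerSide]
  refine (abs_abs_sub_abs_le_abs_sub _ _).trans ?_
  rw [sub_sub_sub_cancel_left, abs_sub_comm]

lemma continuous_upperSide : Continuous upperSide :=
  (LipschitzWith.of_dist_le' (K := 1) fun x y => by
    simpa using dist_upperSide_le x y).continuous

lemma continuous_lowerSide : Continuous lowerSide :=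
  (LipschitzWith.of_dist_le' (K := 1) fun x y => by
    simpa using dist_lowerSide_le x y).continuous

lemma volume_inter_Iic_add_volume_inter_Ici (A : Set unitInterval) (a : unitInterval) :
    volume (A ∩ Iic a) + volume (A ∩ Ici a) = volume A := by
  rw [← measure_inter_add_sdiff A (measurableSet_Iic (a := a))]
  congr 1
  have : A \ Iic a = A ∩ Ioi a := by
    ext x; simp
  rw [this]
  exact measure_congr ((ae_eq_refl A).inter Ioi_ae_eq_Ici.symm)

/-- The segments 2 and 4 are the two halves of the graph of `upperSide`, and 1 and 3 those of
`lowerSide`; they meet only over the null set `{half}`. -/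
lemma rectMeasure_half_apply {S : Set Square} (hS : MeasurableSet S) :
    rectMeasure half S = 1 / 2 * volume {x | (x, upperSide x) ∈ S} +
      1 / 2 * volume {x | (x, lowerSide x) ∈ S} := by
  obtain ⟨c₁, c₂, c₃, c₄⟩ := isClosed_seg half
  obtain ⟨i₁, i₂, i₃, i₄⟩ := injOn_seg half
  have e₁ : Prod.fst '' (S ∩ seg₁ half) = {x | (x, lowerSide x) ∈ S} ∩ Iic half := by
    ext x
    simp only [mem_image, mem_inter_iff, seg₁, mem_ofPred_eq, Prod.exists, exists_and_right,
      exists_eq_right, mem_Iic]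
    constructor
    · rintro ⟨y, hy, h⟩
      have hx : (x : ℝ) ≤ 1 / 2 := by linarith [y.2.1]
      have : y = lowerSide x := Subtype.ext (by
        simp only [lowerSide]; rw [abs_of_nonneg (by linarith)]; linarith)
      exact ⟨this ▸ hy, hx⟩
    · rintro ⟨h, hx⟩
      have hx : (x : ℝ) ≤ 1 / 2 := hx
      refine ⟨_, h, ?_⟩
      simp only [lowerSide]; rw [abs_of_nonneg (by linarith)]; ring
  have e₃ : Prod.fst '' (S ∩ seg₃ half) = {x | (x, lowerSide x) ∈ S} ∩ Ici half := by
    ext x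
    simp only [mem_image, mem_inter_iff, seg₃, mem_ofPred_eq, Prod.exists, exists_and_right,
      exists_eq_right, mem_Ici]
    constructor
    · rintro ⟨y, hy, h⟩
      have hx : 1 / 2 ≤ (x : ℝ) := by linarith [y.2.1]
      have : y = lowerSide x := Subtype.ext (by
        simp only [lowerSide]; rw [abs_of_nonpos (by linarith)]; linarith)
      exact ⟨this ▸ hy, hx⟩
    · rintro ⟨h, hx⟩
      have hx : 1 / 2 ≤ (x : ℝ) := hx
      refine ⟨_, h, ?_⟩
      simp only [lowerSide]; rw [abs_of_nonpos (by linarith)]; ring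
  have e₂ : Prod.fst '' (S ∩ seg₂ half) = {x | (x, upperSide x) ∈ S} ∩ Iic half := by
    ext x
    simp only [mem_image, mem_inter_iff, seg₂, mem_ofPred_eq, Prod.exists, exists_and_right,
      exists_eq_right, mem_Iic]
    constructor
    · rintro ⟨y, hy, h⟩
      have hx : (x : ℝ) ≤ 1 / 2 := by linarith [y.2.2]
      have : y = upperSide x := Subtype.ext (by
        simp only [upperSide]; rw [min_eq_left (by linarith)]; linarith)
      exact ⟨this ▸ hy, hx⟩
    · rintro ⟨h, hx⟩
      have hx : (x : ℝ) ≤ 1 / 2 := hx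
      refine ⟨_, h, ?_⟩
      simp only [upperSide]; rw [min_eq_left (by linarith)]; ring
  have e₄ : Prod.fst '' (S ∩ seg₄ half) = {x | (x, upperSide x) ∈ S} ∩ Ici half := by
    ext x
    simp only [mem_image, mem_inter_iff, seg₄, mem_ofPred_eq, Prod.exists, exists_and_right,
      exists_eq_right, mem_Ici]
    constructor
    · rintro ⟨y, hy, h⟩
      have hx : 1 / 2 ≤ (x : ℝ) := by linarith [y.2.2]
      have : y = upperSide x := Subtype.ext (by
        simp only [upperSide]; rw [min_eq_right (by linarith)]; linarith)
      exact ⟨this ▸ hy, hx⟩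
    · rintro ⟨h, hx⟩
      have hx : 1 / 2 ≤ (x : ℝ) := hx
      refine ⟨_, h, ?_⟩
      simp only [upperSide]; rw [min_eq_right (by linarith)]; ring
  simp only [rectMeasure, Measure.add_apply]
  rw [segMeasure_apply c₁ i₁ hS, segMeasure_apply c₂ i₂ hS, segMeasure_apply c₃ i₃ hS,
    segMeasure_apply c₄ i₄ hS, e₁, e₂, e₃, e₄,
    ← volume_inter_Iic_add_volume_inter_Ici {x | (x, upperSide x) ∈ S} half,
    ← volume_inter_Iic_add_volume_inter_Ici {x | (x, lowerSide x) ∈ S} half, mul_add, mul_add]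
  abel

lemma rectMeasure_half_eq : rectMeasure half =
    (1 / 2 : ℝ≥0∞) • (volume.map fun x => (x, upperSide x)) +
      (1 / 2 : ℝ≥0∞) • (volume.map fun x => (x, lowerSide x)) := by
  ext S hS
  have m₁ : Measurable fun x => (x, upperSide x) :=
    measurable_id.prodMk continuous_upperSide.measurable
  have m₂ : Measurable fun x => (x, lowerSide x) :=
    measurable_id.prodMk continuous_lowerSide.measurable
  rw [rectMeasure_half_apply hS, Measure.add_apply, Measure.smul_apply, Measure.smul_apply,
    Measure.map_apply m₁ hS, Measure.map_apply m₂ hS]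
  rfl

lemma integrable_of_continuous {X : Type*} [TopologicalSpace X] [CompactSpace X] [T2Space X]
    [MeasurableSpace X] [OpensMeasurableSpace X] {μ : Measure X} [IsFiniteMeasure μ] {f : X → ℝ}
    (hf : Continuous f) : Integrable f μ := by
  simpa using hf.continuousOn.integrableOn_compact (μ := μ) isCompact_univ

lemma integral_rectMeasure_half {f : Square → ℝ} (hf : Continuous f) :
    ∫ p, f p ∂(rectMeasure half) =
      ∫ x, 1 / 2 * (f (x, upperSide x) + f (x, lowerSide x)) := by
  have c₁ : Continuous fun x => (x, upperSide x) := continuous_id.prodMk continuous_upperSide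
  have c₂ : Continuous fun x => (x, lowerSide x) := continuous_id.prodMk continuous_lowerSide
  have i₁ : Integrable f (volume.map fun x => (x, upperSide x)) := by
    rw [integrable_map_measure hf.aestronglyMeasurable c₁.aemeasurable]
    exact integrable_of_continuous (hf.comp c₁)
  have i₂ : Integrable f (volume.map fun x => (x, lowerSide x)) := by
    rw [integrable_map_measure hf.aestronglyMeasurable c₂.aemeasurable]
    exact integrable_of_continuous (hf.comp c₂)
  rw [rectMeasure_half_eq, integral_add_measure (i₁.smul_measure (by simp))
    (i₂.smul_measure (by simp)), integral_smul_measure, integral_smul_measure,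
    integral_map c₁.aemeasurable hf.aestronglyMeasurable,
    integral_map c₂.aemeasurable hf.aestronglyMeasurable, integral_const_mul,
    integral_add (f := fun x => f (x, upperSide x)) (g := fun x => f (x, lowerSide x))
      (integrable_of_continuous (hf.comp c₁)) (integrable_of_continuous (hf.comp c₂))]
  simp
  ring

/-! ### Integrals with respect to the permuton of a permutation -/

lemma HasUniformMarginals.map_fst {μ : Measure Square} (h : HasUniformMarginals μ) :
    μ.map Prod.fst = volume := by
  have := h.isProbabilityMeasure
  have : IsProbabilityMeasure (μ.map Prod.fst) :=
    Measure.isProbabilityMeasure_map measurable_fst.aemeasurable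
  refine Measure.ext_of_Iic _ _ fun b => ?_
  have e : Prod.fst ⁻¹' Iic b = Icc 0 b ×ˢ (univ : Set unitInterval) := by
    ext p; simp
  rw [Measure.map_apply measurable_fst measurableSet_Iic, e, (h 0 b b.2.1).2,
    unitInterval.volume_Iic]
  simp

/-- Each of the `N` cells has mass `1 / N`, so an integral is an average of approximate cell values.
-/
lemma abs_integral_permMeasure_sub_le {N : ℕ} (hN : 0 < N) (σ : Equiv.Perm (Fin N))
    {F : Square → ℝ} (hF : Continuous F) {c e : Fin N → ℝ}
    (h : ∀ i, ∀ p ∈ cell N i ×ˢ cell N (σ i), |F p - c i| ≤ e i) :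
    |∫ p, F p ∂(permMeasure σ) - (∑ i, c i) / N| ≤ (∑ i, e i) / N := by
  have hN0 : (0 : ℝ) < N := by exact_mod_cast hN
  have hm : ∀ i, MeasurableSet (cell N i ×ˢ cell N (σ i)) := fun i =>
    (measurableSet_cell i).prod (measurableSet_cell _)
  have hvol : ∀ i, (volume : Measure Square).real (cell N i ×ˢ cell N (σ i)) = (N : ℝ)⁻¹ * (N : ℝ)⁻¹ := by
    intro i
    rw [measureReal_def, Measure.volume_eq_prod, Measure.prod_prod, volume_cell, volume_cell]
    simp
  have hint : ∀ i, Integrable F (volume.restrict (cell N i ×ˢ cell N (σ i))) := fun i =>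
    integrable_of_continuous hF
  have key : ∀ i, |(∫ p in cell N i ×ˢ cell N (σ i), F p) - (N : ℝ)⁻¹ * (N : ℝ)⁻¹ * c i| ≤
      e i * ((N : ℝ)⁻¹ * (N : ℝ)⁻¹) := by
    intro i
    have h1 : ∫ p in cell N i ×ˢ cell N (σ i), (F p - c i) =
        (∫ p in cell N i ×ˢ cell N (σ i), F p) - (N : ℝ)⁻¹ * (N : ℝ)⁻¹ * c i := by
      rw [integral_sub (hint i) (integrable_const _), setIntegral_const, hvol, smul_eq_mul]
    rw [← hvol i, ← Real.norm_eq_abs]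
    rw [← hvol i] at h1
    refine le_trans (le_of_eq ?_) (norm_setIntegral_le_of_norm_le_const
      (f := fun p => F p - c i) (measure_lt_top _ _) (h i))
    rw [h1]
  rw [permMeasure, integral_smul_measure, integral_finsetSum_measure fun i _ => hint i,
    ENNReal.toReal_natCast, smul_eq_mul, Finset.mul_sum, Finset.sum_div, ← Finset.sum_sub_distrib,
    Finset.sum_div]
  refine (Finset.abs_sum_le_sum_abs _ _).trans (Finset.sum_le_sum fun i _ => ?_)
  have h2 : (N : ℝ) * (∫ p in cell N i ×ˢ cell N (σ i), F p) - c i / N =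
      N * ((∫ p in cell N i ×ˢ cell N (σ i), F p) - (N : ℝ)⁻¹ * (N : ℝ)⁻¹ * c i) := by
    field_simp
  rw [h2, abs_mul, abs_of_pos hN0]
  calc _ ≤ (N : ℝ) * (e i * ((N : ℝ)⁻¹ * (N : ℝ)⁻¹)) := by gcongr; exact key i
    _ = _ := by field_simp

/-! ### The permuton of a permutation near the square -/

/-- Summation by parts: bounded partial sums of `s` against a slowly varying `a`. It exploits the
cancellation between the labels U and D. -/
lemma abs_sum_mul_le_of_abs_sum_le {N : ℕ} {a s : ℕ → ℝ} {A B C : ℝ} (hB : 0 ≤ B) (hC : 0 ≤ C)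
    (hs : ∀ j ≤ N, |∑ i ∈ Finset.range j, s i| ≤ A) (ha : ∀ i, |a i| ≤ B)
    (ha' : ∀ i, |a (i + 1) - a i| ≤ C) :
    |∑ i ∈ Finset.range N, a i * s i| ≤ (B + N * C) * A := by
  have hA : 0 ≤ A := (abs_nonneg _).trans (hs 0 (Nat.zero_le _))
  have h := Finset.sum_range_by_parts a s N
  simp only [smul_eq_mul] at h
  rw [h]
  refine (abs_sub _ _).trans ?_
  rw [add_mul]
  refine add_le_add ?_ ?_
  · rw [abs_mul]
    exact mul_le_mul (ha _) (hs N le_rfl) (abs_nonneg _) hB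
  · refine (Finset.abs_sum_le_sum_abs _ _).trans ?_
    calc _ ≤ ∑ _i ∈ Finset.range (N - 1), C * A := by
          refine Finset.sum_le_sum fun i hi => ?_
          rw [Finset.mem_range] at hi
          rw [abs_mul]
          exact mul_le_mul (ha' i) (hs _ (by omega)) (abs_nonneg _) hC
      _ = ((N - 1 : ℕ) : ℝ) * (C * A) := by rw [Finset.sum_const, Finset.card_range, nsmul_eq_mul]
      _ ≤ N * C * A := by
          rw [mul_assoc]
          gcongr
          exact Nat.sub_le _ _

/-- The point `i / N` of the unit interval. -/
def gridPoint (N i : ℕ) : unitInterval :=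
  ⟨min ((i : ℝ) / N) 1, le_min (by positivity) zero_le_one, min_le_right _ _⟩

lemma coe_gridPoint {N i : ℕ} (hN : 0 < N) (hi : i ≤ N) : (gridPoint N i : ℝ) = i / N := by
  have hN0 : (0 : ℝ) < N := by exact_mod_cast hN
  refine min_eq_left ?_
  rw [div_le_one hN0]
  exact_mod_cast hi

lemma dist_gridPoint_succ_le {N : ℕ} (i : ℕ) :
    dist (gridPoint N (i + 1)) (gridPoint N i) ≤ 1 / N := by
  rw [Subtype.dist_eq, Real.dist_eq]
  refine (abs_min_sub_min_le_max _ _ _ _).trans (max_le ?_ ?_)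
  · rw [← sub_div, Nat.cast_add, Nat.cast_one, add_sub_cancel_left, abs_of_nonneg (by positivity)]
  · simp

lemma dist_gridPoint_le_of_mem_cell {N : ℕ} {i : Fin N} {x : unitInterval} (hx : x ∈ cell N i) :
    dist x (gridPoint N i) ≤ 1 / N := by
  rw [Subtype.dist_eq, Real.dist_eq, coe_gridPoint i.pos i.2.le, abs_le]
  obtain ⟨h1, h2⟩ := hx
  rw [add_div] at h2
  have : (0 : ℝ) ≤ 1 / N := by positivity
  constructor <;> linarith

lemma rank_eq_sum {N : ℕ} (s : Finset (Fin N)) {j : ℕ} (hj : j ≤ N) :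
    (rank s j : ℝ) =
      ∑ i ∈ Finset.range j, if h : i < N then (if (⟨i, h⟩ : Fin N) ∈ s then 1 else 0) else 0 := by
  induction j with
  | zero => simp [rank]
  | succ j ih =>
    rw [Finset.sum_range_succ, ← ih (by omega), rank_succ s hj, dif_pos (show j < N by omega)]
    push_cast
    rfl

lemma dist_unitInterval_le_one (x y : unitInterval) : dist x y ≤ 1 := by
  rw [Subtype.dist_eq, Real.dist_eq, abs_le]
  constructor <;> linarith [x.2.1, x.2.2, y.2.1, y.2.2]

/-- Over a short interval of abscissas, the points of `σ` divide evenly between the upper and the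
lower boundary, as under the square permuton. -/
lemma NearSquare.abs_integral_sub_le {N : ℕ} (hN : 0 < N) {η : ℝ} {σ : Equiv.Perm (Fin N)}
    {U D : Finset (Fin N)} (hσ : NearSquare η σ U D) {f : Square → ℝ} {K : NNReal}
    (hf : LipschitzWith K f) :
    |∫ p, f p ∂(permMeasure σ) - ∫ p, f p ∂(rectMeasure half)| ≤ K * (2 / N + 4 * η) := by
  have hN0 : (0 : ℝ) < N := by exact_mod_cast hN
  have hK : (0 : ℝ) ≤ K := K.2
  have hη : 0 ≤ η := by
    have := (abs_nonneg _).trans (hσ.balance 0 (Nat.zero_le _))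
    exact nonneg_of_mul_nonneg_left this hN0
  have hmarg := permMeasure_hasUniformMarginals hN σ
  have := hmarg.isProbabilityMeasure
  have hfc := hf.continuous
  have cu : Continuous fun x => f (x, upperSide x) :=
    hfc.comp (continuous_id.prodMk continuous_upperSide)
  have cl : Continuous fun x => f (x, lowerSide x) :=
    hfc.comp (continuous_id.prodMk continuous_lowerSide)
  set g : unitInterval → ℝ := fun x => 1 / 2 * (f (x, upperSide x) + f (x, lowerSide x)) with hg
  have cg : Continuous g := (cu.add cl).const_mul _
  -- Both measures have the same first marginal, so the limit integral can be written under
  -- `permMeasure σ` and the comparison becomes pointwise.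
  have hrect : ∫ p, f p ∂(rectMeasure half) = ∫ p, g p.1 ∂(permMeasure σ) := by
    rw [integral_rectMeasure_half hfc, ← hmarg.map_fst,
      integral_map measurable_fst.aemeasurable cg.aestronglyMeasurable]
  rw [hrect, ← integral_sub (g := fun p : Square => g p.1) (integrable_of_continuous hfc)
    (integrable_of_continuous (cg.comp continuous_fst))]
  -- Lipschitz estimates
  have lip : ∀ x y x' y', |f (x, y) - f (x', y')| ≤ K * max (dist x x') (dist y y') := by
    intro x y x' y'
    have := hf.dist_le_mul (x, y) (x', y')
    rwa [Real.dist_eq, Prod.dist_eq] at this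
  have lipu : ∀ x x', |f (x, upperSide x) - f (x', upperSide x')| ≤ K * dist x x' := by
    intro x x'
    refine (lip _ _ _ _).trans ?_
    rw [max_eq_left (dist_upperSide_le x x')]
  have lipl : ∀ x x', |f (x, lowerSide x) - f (x', lowerSide x')| ≤ K * dist x x' := by
    intro x x'
    refine (lip _ _ _ _).trans ?_
    rw [max_eq_left (dist_lowerSide_le x x')]
  have lipv : ∀ x y y', |f (x, y) - f (x, y')| ≤ K := by
    intro x y y'
    refine (lip _ _ _ _).trans ?_
    rw [dist_self, max_eq_right dist_nonneg]
    exact mul_le_of_le_one_right hK (dist_unitInterval_le_one _ _)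
  set a : ℕ → ℝ := fun i => 1 / 2 * (f (gridPoint N i, upperSide (gridPoint N i)) -
    f (gridPoint N i, lowerSide (gridPoint N i))) with ha
  have dU := Finset.disjoint_left.1 hσ.disjoint
  have dcell : ∀ i : Fin N, ∀ y ∈ cell N (σ i), ∀ z : unitInterval,
      |((σ i : ℕ) : ℝ) - z * N| ≤ η * N → dist y z ≤ 1 / N + η := by
    intro i y hy z hz
    obtain ⟨h1, h2⟩ := hy
    rw [Subtype.dist_eq, Real.dist_eq]
    have h3 : |((σ i : ℕ) : ℝ) / N - z| ≤ η := by
      rw [show ((σ i : ℕ) : ℝ) / N - z = (((σ i : ℕ) : ℝ) - z * N) / N by field_simp, abs_div,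
        abs_of_pos hN0, div_le_iff₀ hN0]
      exact hz
    rw [abs_le] at h3 ⊢
    rw [add_div] at h2
    have : (0 : ℝ) ≤ 1 / N := by positivity
    constructor <;> linarith
  have hup : ∀ i : Fin N, (upperSide (gridPoint N i) : ℝ) * N =
      min ((N : ℝ) / 2 + (i : ℕ)) (3 * (N : ℝ) / 2 - (i : ℕ)) := by
    intro i
    simp only [upperSide]
    rw [coe_gridPoint hN i.2.le, min_mul_of_nonneg _ _ hN0.le]
    congr 1 <;> field_simp
  have hlo : ∀ i : Fin N, (lowerSide (gridPoint N i) : ℝ) * N = abs ((N : ℝ) / 2 - (i : ℕ)) := by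
    intro i
    simp only [lowerSide]
    rw [coe_gridPoint hN i.2.le]
    nth_rewrite 2 [← abs_of_pos hN0]
    rw [← abs_mul]
    congr 1
    field_simp
  classical
  have main := abs_integral_permMeasure_sub_le hN σ (F := fun p => f p - g p.1)
    (hfc.sub (cg.comp continuous_fst))
    -- On a cell with `i ∈ U` the integrand `f - g` is close to half the difference between the
    -- upper and lower values of `f`, and on one with `i ∈ D` to its opposite. On the few remaining
    -- cells the bound is the crude constant `K`.
    (c := fun i => a i * ((if i ∈ U then 1 else 0) - if i ∈ D then 1 else 0))
    (e := fun i => K * (2 / N + η) + K * (1 - ((if i ∈ U then 1 else 0) + if i ∈ D then 1 else 0)))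
    (by
      rintro i ⟨x, y⟩ ⟨hx, hy⟩
      have hx1 := dist_gridPoint_le_of_mem_cell hx
      have hxK : (K : ℝ) * dist x (gridPoint N i) ≤ K * (1 / N) := by gcongr
      have e1 := lipu x (gridPoint N i)
      have e2 := lipl x (gridPoint N i)
      have hyK : ∀ z : unitInterval, |((σ i : ℕ) : ℝ) - z * N| ≤ η * N →
          |f (x, y) - f (gridPoint N i, z)| ≤ K * (1 / N + η) := fun z hz =>
        (lip _ _ _ _).trans (mul_le_mul_of_nonneg_left
          (max_le (hx1.trans (by linarith)) (dcell i y hy z hz)) hK)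
      have e3 : (K : ℝ) * (2 / N + η) = K * (1 / N + η) + K * (1 / N) := by ring
      simp only [ha, hg]
      rw [abs_le] at e1 e2
      by_cases hU : i ∈ U
      · have hD : i ∉ D := dU hU
        have e4 := hyK (upperSide (gridPoint N i)) (by rw [hup]; exact hσ.upper i hU)
        rw [abs_le] at e4
        rw [if_pos hU, if_neg hD, e3, abs_le]
        constructor <;> linarith
      · by_cases hD : i ∈ D
        · have e4 := hyK (lowerSide (gridPoint N i)) (by rw [hlo]; exact hσ.lower i hD)
          rw [abs_le] at e4
          rw [if_neg hU, if_pos hD, e3, abs_le]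
          constructor <;> linarith
        · have e4 := lipv x y (upperSide x)
          have e5 := lipv x y (lowerSide x)
          rw [abs_le] at e4 e5
          have e6 : (0 : ℝ) ≤ K * (2 / N + η) := by positivity
          rw [if_neg hU, if_neg hD, abs_le]
          constructor <;> linarith)
  -- the sum of the main terms
  have hsum : |∑ i : Fin N, a i * ((if i ∈ U then 1 else 0) - if i ∈ D then 1 else 0)| ≤
      (K / 2 + N * (K * (1 / N))) * (η * N) := by
    set s : ℕ → ℝ := fun i => (if h : i < N then (if (⟨i, h⟩ : Fin N) ∈ U then 1 else 0) else 0) -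
      if h : i < N then (if (⟨i, h⟩ : Fin N) ∈ D then 1 else 0) else 0 with hs
    have e1 : ∑ i : Fin N, a i * ((if i ∈ U then 1 else 0) - if i ∈ D then 1 else 0) =
        ∑ i ∈ Finset.range N, a i * s i := by
      rw [← Fin.sum_univ_eq_sum_range (fun i => a i * s i)]
      refine Finset.sum_congr rfl fun i _ => ?_
      simp [hs]
    rw [e1]
    refine abs_sum_mul_le_of_abs_sum_le (by positivity) (by positivity) (fun j hj => ?_)
      (fun i => ?_) fun i => ?_
    · rw [hs, Finset.sum_sub_distrib, ← rank_eq_sum U hj, ← rank_eq_sum D hj]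
      exact hσ.balance j hj
    · rw [ha, abs_mul, abs_of_pos (by norm_num)]
      have := lipv (gridPoint N i) (upperSide (gridPoint N i)) (lowerSide (gridPoint N i))
      linarith
    · have hd := dist_gridPoint_succ_le (N := N) i
      have hxK : (K : ℝ) * dist (gridPoint N (i + 1)) (gridPoint N i) ≤ K * (1 / N) := by gcongr
      have e1 := lipu (gridPoint N (i + 1)) (gridPoint N i)
      have e2 := lipl (gridPoint N (i + 1)) (gridPoint N i)
      simp only [ha]
      rw [abs_le] at e1 e2 ⊢
      constructor <;> linarith
  -- the sum of the errors
  have herr : ∑ i : Fin N, ((K : ℝ) * (2 / N + η) +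
      K * (1 - ((if i ∈ U then 1 else 0) + if i ∈ D then 1 else 0))) ≤
      N * (K * (2 / N + η)) + K * (η * N) := by
    have e1 : ∀ s : Finset (Fin N), ∑ i : Fin N, (if i ∈ s then (1 : ℝ) else 0) = s.card := by
      intro s; simp
    rw [Finset.sum_add_distrib, ← Finset.mul_sum _ _ (K : ℝ), ← Finset.mul_sum _ _ (K : ℝ),
      Finset.sum_sub_distrib, Finset.sum_add_distrib (f := fun i => if i ∈ U then (1 : ℝ) else 0),
      e1, e1, Finset.sum_const, Finset.sum_const, Finset.card_univ, Fintype.card_fin, nsmul_eq_mul,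
      nsmul_eq_mul, mul_one]
    have := mul_le_mul_of_nonneg_left hσ.card hK
    linarith
  calc _ = |(∫ p, (f p - g p.1) ∂(permMeasure σ) -
          (∑ i : Fin N, a i * ((if i ∈ U then 1 else 0) - if i ∈ D then 1 else 0)) / N) +
          (∑ i : Fin N, a i * ((if i ∈ U then 1 else 0) - if i ∈ D then 1 else 0)) / N| := by
        rw [sub_add_cancel]
    _ ≤ (N * (K * (2 / N + η)) + K * (η * N)) / N +
          (K / 2 + N * (K * (1 / N))) * (η * N) / N := by
        refine (abs_add_le _ _).trans (add_le_add (main.trans ?_) ?_)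
        · gcongr
        · rw [abs_div, abs_of_pos hN0]; gcongr
    _ = K * (2 / N + 2 * η) + K * (3 / 2 * η) := by field_simp; ring
    _ ≤ _ := by
        have : 0 ≤ (K : ℝ) * η := mul_nonneg hK hη
        linarith

/-! ### Convergence in distribution -/

/-- A neighbourhood of the square permuton contains the permutons of all large permutations that are
near enough to the square. -/
lemma exists_nearSquare_mem {G : Set Permuton} (hG : IsOpen G) (h : rectPermuton half ∈ G) :
    ∃ η : ℝ, 0 < η ∧ ∃ N₀ : ℕ, ∀ N (hN : 0 < N), N₀ ≤ N → ∀ σ : Equiv.Perm (Fin N),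
      (∃ U D, NearSquare η σ U D) → permPermuton hN σ ∈ G := by
  by_contra hc
  push Not at hc
  have hη : ∀ j : ℕ, (0 : ℝ) < 1 / (j + 1) := fun j => by positivity
  -- Counterexamples with `η = 1 / (j + 1)` and size at least `j + 1` form a sequence whose
  -- permutons converge to the square permuton while staying outside the open set `G`.
  choose N hN hNj σ hσ hσG using fun j : ℕ => hc _ (hη j) (j + 1)
  choose U D hUD using hσ
  have hlim : Tendsto (fun j => permPermuton (hN j) (σ j)) atTop (𝓝 (rectPermuton half)) := by
    refine tendsto_subtype_rng.2 ?_
    refine tendsto_iff_forall_lipschitz_integral_tendsto.2 fun f _ ⟨K, hK⟩ => ?_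
    rw [tendsto_iff_dist_tendsto_zero]
    have hz : Tendsto (fun j : ℕ => (K : ℝ) * 6 * (1 / ((j : ℝ) + 1))) atTop (𝓝 0) := by
      have := (tendsto_one_div_add_atTop_nhds_zero_nat (𝕜 := ℝ)).const_mul ((K : ℝ) * 6)
      rwa [mul_zero] at this
    refine squeeze_zero (fun _ => dist_nonneg) (fun j => ?_) hz
    rw [Real.dist_eq]
    refine ((hUD j).abs_integral_sub_le (hN j) hK).trans ?_
    have h1 : (2 : ℝ) / N j ≤ 2 / ((j : ℝ) + 1) := by
      gcongr
      exact_mod_cast hNj j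
    rw [mul_assoc]
    gcongr
    calc _ ≤ 2 / ((j : ℝ) + 1) + 4 * (1 / ((j : ℝ) + 1)) := by gcongr
      _ = _ := by ring
  obtain ⟨j, hj⟩ := (hlim.eventually (hG.mem_nhds h)).exists
  exact hσG j hj

/-- The uniform probability on a finite set of a rare event. -/
lemma uniformOn_le_of_card_le {X : Type*} [MeasurableSpace X] [DiscreteMeasurableSpace X]
    {S B : Finset X} {s : Set X} (hs : (S : Set X) ∩ s ⊆ B) {r : ℝ} (hr : 0 ≤ r)
    (h : (B.card : ℝ) ≤ r * S.card) : uniformOn (S : Set X) s ≤ ENNReal.ofReal r := by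
  rw [uniformOn, cond_apply S.finite_toSet.measurableSet, Measure.count_apply_finset]
  rcases S.eq_empty_or_nonempty with rfl | hS
  · simp
  have hS0 : (S.card : ℝ≥0∞) ≠ 0 := by simpa using hS.ne_empty
  rw [mul_comm, ← div_eq_mul_inv]
  refine ENNReal.div_le_of_le_mul ?_
  calc _ ≤ Measure.count (B : Set X) := measure_mono hs
    _ = (B.card : ℝ≥0∞) := Measure.count_apply_finset _
    _ ≤ ENNReal.ofReal r * S.card := by
      rw [← ENNReal.ofReal_natCast B.card, ← ENNReal.ofReal_natCast S.card, ← ENNReal.ofReal_mul hr]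
      exact ENNReal.ofReal_le_ofReal h

end AlmostSquare

end

/-! ### The convergence theorem -/

open AlmostSquare in
theorem theorem1p4 (n k : ℕ → ℕ) (hn_pos : ∀ m, 0 < n m)
    (hn : Tendsto n atTop atTop) (hk : Tendsto k atTop atTop)
    (hkn : (fun m => (k m : ℝ)) =o[atTop] fun m => (n m : ℝ))
    {Ω : ℕ → Type*} [∀ m, MeasurableSpace (Ω m)]
    (P : ∀ m, Measure (Ω m)) [∀ m, IsProbabilityMeasure (P m)]
    (σ : ∀ m, Ω m → Equiv.Perm (Fin (n m + k m)))
    (hσ : ∀ m, HasLaw (σ m) (uniformOn (AlmostSquare.ASq (n m) (k m))) (P m)) :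
    TendstoInDistribution
      (fun m ω => AlmostSquare.permPermuton (Nat.add_pos_left (hn_pos m) (k m)) (σ m ω)) atTop
      (fun _ : Unit => AlmostSquare.rectPermuton ⟨1 / 2, by norm_num, by norm_num⟩)
      P (Measure.dirac ()) := by
  have hmeas : ∀ m, AEMeasurable (fun ω => AlmostSquare.permPermuton
      (Nat.add_pos_left (hn_pos m) (k m)) (σ m ω)) (P m) := fun m =>
    (Measurable.of_discrete (f := AlmostSquare.permPermuton
      (Nat.add_pos_left (hn_pos m) (k m)))).comp_aemeasurable (hσ m).aemeasurable
  refine ⟨hmeas, measurable_const.aemeasurable, ?_⟩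
  -- Portmanteau: only open sets need a lower bound, and the Dirac limit makes it nontrivial only
  -- for those that contain the square permuton.
  refine tendsto_of_forall_isOpen_le_liminf fun G hG => ?_
  by_cases hmem : rectPermuton half ∈ G
  swap
  · refine le_of_eq_of_le ?_ zero_le
    have h0 : Measure.map (fun _ : Unit => rectPermuton half) (Measure.dirac ()) G = 0 := by
      rw [Measure.map_apply measurable_const hG.measurableSet, preimage_const_of_notMem hmem,
        measure_empty]
    exact (congrArg ENNReal.toNNReal h0).trans ENNReal.toNNReal_zero
  obtain ⟨η, hη, N₀, hN₀⟩ := exists_nearSquare_mem hG hmem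
  refine (ProbabilityMeasure.apply_le_one _ _).trans ?_
  refine le_of_forall_lt fun a ha => ?_
  obtain ⟨b, hab, hb⟩ := exists_between ha
  refine hab.trans_le (le_liminf_of_le (IsBoundedUnder.isCoboundedUnder_ge
    (isBoundedUnder_of ⟨1, fun m => ProbabilityMeasure.apply_le_one _ _⟩)) ?_)
  have hr : 0 < 1 - (b : ℝ) := sub_pos.2 (by exact_mod_cast hb)
  filter_upwards [eventually_card_not_nearSquare_le hn hk hkn hη hr,
    hn.eventually_ge_atTop N₀] with m h1 h2
  classical
  have hpos := Nat.add_pos_left (hn_pos m) (k m)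
  -- `uniformOn` of an empty set would be the zero measure; that `σ m` has this law excludes it.
  have hprob : IsProbabilityMeasure (uniformOn (ASq (n m) (k m))) := by
    rw [← (hσ m).map_eq]
    exact Measure.isProbabilityMeasure_map (hσ m).aemeasurable
  set T : Set (Equiv.Perm (Fin (n m + k m))) := {τ | permPermuton hpos τ ∈ G} with hT
  have h3 : uniformOn (ASq (n m) (k m)) Tᶜ ≤ ENNReal.ofReal (1 - b) := by
    rw [← coe_asqFinset]
    refine uniformOn_le_of_card_le (fun τ hτ => ?_) hr.le h1
    rw [Finset.mem_coe, Finset.mem_filter]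
    exact ⟨hτ.1, fun hnear => hτ.2 (hN₀ _ hpos (h2.trans (Nat.le_add_right _ _)) τ hnear)⟩
  have h4 : (b : ℝ≥0∞) ≤ uniformOn (ASq (n m) (k m)) T := by
    have h5 := prob_add_prob_compl (μ := uniformOn (ASq (n m) (k m)))
      (MeasurableSet.of_discrete (s := T))
    have h6 : (b : ℝ≥0∞) + ENNReal.ofReal (1 - b) = 1 := by
      rw [← ENNReal.ofReal_coe_nnreal, ← ENNReal.ofReal_add b.coe_nonneg hr.le, add_sub_cancel,
        ENNReal.ofReal_one]
    by_contra hc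
    rw [not_le] at hc
    have h7 := ENNReal.add_lt_add_of_lt_of_le (measure_ne_top _ _) hc h3
    rw [h5, h6] at h7
    exact lt_irrefl _ h7
  have h8 : (b : ℝ≥0∞) ≤ Measure.map (fun ω => permPermuton hpos (σ m ω)) (P m) G := by
    refine h4.trans (le_of_eq ?_)
    rw [← (hσ m).map_eq, Measure.map_apply_of_aemeasurable (hσ m).aemeasurable
      MeasurableSet.of_discrete]
    exact (Measure.map_apply_of_aemeasurable (hmeas m) hG.measurableSet).symm
  have := Measure.isProbabilityMeasure_map (hmeas m)
  have h9 := ENNReal.le_toNNReal_of_coe_le h8 (measure_ne_top _ _)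
  exact h9
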